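/- Let $n\ge 2$, $p\in(n/(n-1),\infty)$, $q=np/(n+p)$, $\sigma>0$. For an open set $\Omega\subset\mathbb R^n$ and $u\in W^{1,q}(\Omega)$ (real-valued) put $\|\nabla u\|_{L^q(\Omega)}=\big(\sum_{j=1}^n\int_\Omega|\partial_{x_j}u|^q\,dx\big)^{1/q}$ and $\|u\|_{W^{1,q}(\Omega)}=\big(\|\nabla u\|_{L^q(\Omega)}^q+\sigma\|u\|_{L^q(\Omega)}^q\big)^{1/q}$. Let $T_p$ be a constant with $\|v\|_{L^p(\mathbb R^n)}\le T_p\|\nabla v\|_{L^q(\mathbb R^n)}$ for all $v\in W^{1,q}(\mathbb R^n)$. Let $\Omega\subset\mathbb R^n$ be a domain with minimally smooth boundary, that is, an open set for which there are $\varepsilon_0>0$, an integer $N\ge1$, $M>0$ and open sets $U_1,U_2,\dots\subset\mathbb R^n$ such that (1) for every $x\in\partial\Omega$ the ball $B(x,\varepsilon_0)$ lies in some $U_i$; (2) no point lies in more than $N$ of the $U_i$; (3) for every $i$ there is a special Lipschitz domain $\Omega_i$ with $U_i\cap\Omega=U_i\cap\Omega_i$, where $\Omega_i=R_i\{(x',x_n):x_n>\varphi_i(x')\}$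 with a linear isometry $R_i$ of $\mathbb R^n$ and a function $\varphi_i:\mathbb R^{n-1}\to\mathbb R$ with Lipschitz constant $M_i\le M$. Fix such data and the following further data. * $\varepsilon>0$ such that every $x$ with $\mathrm{dist}(x,\partial\Omega)\le\varepsilon/2$ satisfies $B(x,\varepsilon/2)\subset U_i$ for some $i$ (with $\mathrm{dist}(x,\emptyset)=\infty$). * A nonnegative $\rho\in C^\infty(\mathbb R^n)$ with $\rho(x)=0$ for $|x|\ge1$ and $\int\rho=1$, and a number $b_\varepsilon>0$ with $\int_{\mathbb R^n}|\partial_{x_j}\rho_{\varepsilon/4}|\,dx\le b_\varepsilon$ for all $j$, where $\rho_\delta(x)=\delta^{-n}\rho(x/\delta)$. * $\tau>0$ and $\xi\in(0,1)$. * A function $\psi$ with $t^m\psi$ integrable on $(1,\infty)$ for all $m\ge0$, $\int_1^\infty\psi\,dt=1$, $\int_1^\infty t^m\psi\,dt=0$ for all $m\ge1$, and $|\psi(t)|\le A_0/t^2$, $|\psi(t)|\le A_1/t^3$ for $t\ge1$. * Constants $P_\alpha$ and, for every $i$, a regularized distance $\mathrm{RD}_i\in C^\infty((\overline{\Omega_i})^c)$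 with $(1+\xi)^{-2}d_i\le\mathrm{RD}_i\le(1-\xi)^{-2}d_i$ and $|\partial^\alpha\mathrm{RD}_i|\le P_\alpha(\xi d_i)^{1-|\alpha|}$ for $|\alpha|\ge1$, where $d_i(x)=\mathrm{dist}(x,\overline{\Omega_i})$; and a number $P\ge P_\alpha$ for all $|\alpha|=1$. Let $E^i$ be the extension operator with $E^iu=u$ on $\overline{\Omega_i}$ and $E^iu(x)=\int_1^\infty u\big(x+t\,g_i^*(x)\,R_ie_n\big)\psi(t)\,dt$ off $\overline{\Omega_i}$, where $g_i^*=(1+\tau)(1+\xi)^2\sqrt{1+M_i^2}\;\mathrm{RD}_i$. For numbers $A$ and $A'$ put, with $\gamma=\sigma^{1/q}$ and $R=b_\varepsilon(6NA+NA'+3)n^{1/q}/(NA'+1)$, $$A_q(\Omega)=NA'+1\ \text{ if } R\le\gamma,\qquad A_q(\Omega)=b_\varepsilon(6NA+NA'+3)n^{1/q}/\gamma\ \text{ if } R>\gamma.$$ Then $$\|u\|_{L^p(\Omega)}\le C_p(\Omega)\,\|u\|_{W^{1,q}(\Omega)}\quad\text{for all }u\in W^{1,q}(\Omega),\qquad C_p(\Omega)=2^{(q-1)/q}\,T_p\,A_q(\Omega),$$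 holds in each of the following two cases. (i) All $R_i$ are signed permutations of the coordinates (for example all $R_i$ are the identity), and $A=\sup_iA(\Omega_i)$, $A'=\sup_iA'(\Omega_i)$ with the explicit values $$A(\Omega_i)=\{(A_0Q_i)^q+1\}^{1/q},$$ $$A'(\Omega_i)=\max\Big\{2^{q-1}(A_0Q_i)^q+1,\ \big[(n-1)2^{q-1}(B_iQ_i)^q+\{(A_0+B_i)Q_i\}^q+1\big]^{1/q}\Big\},$$ where $$Q_i=\frac{q(1+\tau)(1+\xi)^2}{(q+1)\tau^{1+1/q}(1-\xi)^2}\sqrt{1+M_i^2},\qquad B_i=A_1P(1+\xi)^2(1+\tau)\sqrt{1+M_i^2}.$$ (ii) The $R_i$ are arbitrary, and $A=\sup_iA_i<\infty$, $A'=\sup_iA'_i<\infty$ for any constants $A_i$, $A'_i$ that satisfy $\|E^iu\|_{L^q(\mathbb R^n)}\le A_i\|u\|_{L^q(\Omega_i)}$ and $\|\nabla(E^iu)\|_{L^q(\mathbb R^n)}\le A'_i\|\nabla u\|_{L^q(\Omega_i)}$ for all $u\in W^{1,q}(\Omega_i)$. -/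

import Mathlib

open MeasureTheory Set Metric
open scoped ENNReal NNReal ContDiff

noncomputable section

namespace SobolevEmb

/-- The Euclidean space of dimension `n`. -/
abbrev Rn (n : ℕ) := EuclideanSpace ℝ (Fin n)

/-- The `j`-th standard basis vector. -/
def stdVec {n : ℕ} (j : Fin n) : Rn n := EuclideanSpace.single j 1

/-! ### Sobolev functions -/

/-- `G` is the weak gradient of `u` on the open set `Ω`: integration by parts against every smooth
test function with compact support in `Ω`. -/
def HasWeakGradient {n : ℕ} (Ω : Set (Rn n)) (u : Rn n → ℝ) (G : Fin n → Rn n → ℝ) : Prop :=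
  ∀ (j : Fin n) (η : Rn n → ℝ), ContDiff ℝ ∞ η → HasCompactSupport η → tsupport η ⊆ Ω →
    ∫ x in Ω, u x * fderiv ℝ η x (stdVec j) = - ∫ x in Ω, G j x * η x

/-- `u` belongs to the Sobolev space `W^{1,q}(Ω)`, and `G` is its weak gradient. -/
structure MemW1 {n : ℕ} (Ω : Set (Rn n)) (q : ℝ) (u : Rn n → ℝ) (G : Fin n → Rn n → ℝ) :
    Prop where
  memLp : MemLp u (ENNReal.ofReal q) (volume.restrict Ω)
  memLp_grad : ∀ j, MemLp (G j) (ENNReal.ofReal q) (volume.restrict Ω)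
  weakGradient : HasWeakGradient Ω u G

/-- The norm `‖u‖_{L^q(Ω)}`. -/
def normLq {n : ℕ} (Ω : Set (Rn n)) (q : ℝ) (u : Rn n → ℝ) : ℝ≥0∞ :=
  eLpNorm u (ENNReal.ofReal q) (volume.restrict Ω)

/-- The norm `‖∇u‖_{L^q(Ω)} = (∑_j ∫_Ω |∂_j u|^q)^{1/q}`, where `G = ∇u`. -/
def normGrad {n : ℕ} (Ω : Set (Rn n)) (q : ℝ) (G : Fin n → Rn n → ℝ) : ℝ≥0∞ :=
  (∑ j, normLq Ω q (G j) ^ q) ^ (1 / q)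

/-- The `σ`-weighted norm `(‖∇u‖_{L^q(Ω)}^q + σ ‖u‖_{L^q(Ω)}^q)^{1/q}`, where `G = ∇u`. -/
def normW1 {n : ℕ} (Ω : Set (Rn n)) (q σ : ℝ) (u : Rn n → ℝ) (G : Fin n → Rn n → ℝ) : ℝ≥0∞ :=
  (normGrad Ω q G ^ q + ENNReal.ofReal σ * normLq Ω q u ^ q) ^ (1 / q)

/-! ### Domains with minimally smooth boundary -/

/-- The epigraph `{(x', x_n) : x_n > φ x'}` in dimension `n = d + 1`. -/
def epigraph {d : ℕ} (φ : Rn d → ℝ) : Set (Rn (d + 1)) :=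
  {x | φ (WithLp.toLp 2 (fun i : Fin d => x i.castSucc)) < x (Fin.last d)}

/-- `Ω` is a domain with minimally smooth boundary in dimension `n = d + 1`, together with the
sets `U i`, the overlap number `N`, the Lipschitz constant `M`, and the special Lipschitz domains
`Ω_i`, the image under the linear isometry `frame i` of the epigraph of the function `φ i`, whose
Lipschitz constant is `lip i`. -/
structure MinimallySmooth {d : ℕ} (Ω : Set (Rn (d + 1))) where
  isOpen : IsOpen Ω
  U : ℕ → Set (Rn (d + 1))
  isOpen_U : ∀ i, IsOpen (U i)
  exists_ball : ∃ ε₀ : ℝ, 0 < ε₀ ∧ ∀ x ∈ frontier Ω, ∃ i, ball x ε₀ ⊆ U i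
  N : ℕ
  one_le_N : 1 ≤ N
  overlap : ∀ x, {i | x ∈ U i}.encard ≤ N
  M : ℝ
  M_pos : 0 < M
  frame : ℕ → (Rn (d + 1) ≃ₗᵢ[ℝ] Rn (d + 1))
  φ : ℕ → Rn d → ℝ
  lip : ℕ → ℝ≥0
  lipschitz : ∀ i, LipschitzWith (lip i) (φ i)
  lip_le : ∀ i, (lip i : ℝ) ≤ M
  inter_eq : ∀ i, U i ∩ Ω = U i ∩ (frame i '' epigraph (φ i))

namespace MinimallySmooth

variable {d : ℕ} {Ω : Set (Rn (d + 1))}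

/-- The `i`-th special Lipschitz domain. -/
def special (D : MinimallySmooth Ω) (i : ℕ) : Set (Rn (d + 1)) := D.frame i '' epigraph (D.φ i)

/-- The unit vector which points upwards in the `i`-th special Lipschitz domain. -/
def up (D : MinimallySmooth Ω) (i : ℕ) : Rn (d + 1) := D.frame i (stdVec (Fin.last d))

/-- The condition on `ε`: every `x` with `dist (x, ∂Ω) ≤ ε / 2` satisfies `B (x, ε / 2) ⊆ U i`
for some `i`. The distance to the empty set is infinite. -/
def Covers (D : MinimallySmooth Ω) (ε : ℝ) : Prop :=
  ∀ x, infEDist x (frontier Ω) ≤ ENNReal.ofReal (ε / 2) → ∃ i, ball x (ε / 2) ⊆ D.U i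

/-- Each of the linear isometries `frame i` is a signed permutation of the coordinate axes, for
example the identity. -/
def AxisPreserving (D : MinimallySmooth Ω) : Prop :=
  ∀ i j, ∃ k, D.frame i (stdVec j) = stdVec k ∨ D.frame i (stdVec j) = - stdVec k

end MinimallySmooth

/-! ### Mollifiers, regularized distances and the extension operator -/

/-- Mollifiers. -/
structure IsMollifier {n : ℕ} (ρ : Rn n → ℝ) : Prop where
  contDiff : ContDiff ℝ ∞ ρ
  nonneg : ∀ x, 0 ≤ ρ x
  eq_zero : ∀ x, 1 ≤ ‖x‖ → ρ x = 0
  integral_eq : ∫ x, ρ x = 1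

/-- The rescaled mollifier `ρ_δ (x) = δ^{-n} ρ (x / δ)`. -/
def scaled {n : ℕ} (ρ : Rn n → ℝ) (δ : ℝ) (x : Rn n) : ℝ := (δ ^ n)⁻¹ * ρ (δ⁻¹ • x)

/-- `g` is a regularized distance from the closed set `S` with parameter `ξ` and derivative bounds
`P α`. The partial derivative `∂^α g` is written as the iterated derivative along the standard
basis vectors of indices `J 0, J 1, …, J (k - 1)`, where `α m` is the number of `l` with `J l = m`
and `k = |α|`. -/
structure IsRegularizedDistance {n : ℕ} (S : Set (Rn n)) (ξ : ℝ) (P : (Fin n → ℕ) → ℝ)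
    (g : Rn n → ℝ) : Prop where
  contDiffOn : ContDiffOn ℝ ∞ g Sᶜ
  lower : ∀ x ∈ Sᶜ, ((1 + ξ) ^ 2)⁻¹ * infDist x S ≤ g x
  upper : ∀ x ∈ Sᶜ, g x ≤ ((1 - ξ) ^ 2)⁻¹ * infDist x S
  deriv_le : ∀ x ∈ Sᶜ, ∀ k : ℕ, 1 ≤ k → ∀ J : Fin k → Fin n,
    |iteratedFDeriv ℝ k g x (fun l => stdVec (J l))| ≤
      P (fun m => (Finset.univ.filter (fun l => J l = m)).card) *
        (ξ * infDist x S) ^ ((1 : ℤ) - (k : ℤ))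

/-- The weight `ψ` of the extension operator, with its bounds `A₀ / t ^ 2` and `A₁ / t ^ 3`. -/
structure IsWeight (ψ : ℝ → ℝ) (A₀ A₁ : ℝ) : Prop where
  integrable : ∀ m : ℕ, IntegrableOn (fun t => t ^ m * ψ t) (Ioi 1)
  integral_eq_one : ∫ t in Ioi 1, ψ t = 1
  moment_eq_zero : ∀ m : ℕ, 1 ≤ m → ∫ t in Ioi 1, t ^ m * ψ t = 0
  bound₀ : ∀ t, 1 ≤ t → |ψ t| ≤ A₀ / t ^ 2
  bound₁ : ∀ t, 1 ≤ t → |ψ t| ≤ A₁ / t ^ 3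

/-- The factor `g* = (1 + τ) (1 + ξ)^2 √(1 + M^2) RD`. -/
def gStar {n : ℕ} (τ ξ M : ℝ) (RD : Rn n → ℝ) (x : Rn n) : ℝ :=
  (1 + τ) * ((1 + ξ) ^ 2 * √(1 + M ^ 2)) * RD x

open Classical in
/-- The extension operator on a special Lipschitz domain `S` with upward unit vector `ν`. -/
def extension {n : ℕ} (S : Set (Rn n)) (ν : Rn n) (g : Rn n → ℝ) (ψ : ℝ → ℝ) (u : Rn n → ℝ)
    (x : Rn n) : ℝ :=
  if x ∈ closure S then u x else ∫ t in Ioi 1, u (x + (t * g x) • ν) * ψ t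

/-- The constant `a` satisfies `‖E u‖_{L^q(ℝⁿ)} ≤ a ‖u‖_{L^q(S)}` for all `u ∈ W^{1,q}(S)`. -/
def IsExtBound {n : ℕ} (S : Set (Rn n)) (q : ℝ) (E : (Rn n → ℝ) → Rn n → ℝ) (a : ℝ) : Prop :=
  ∀ u G, MemW1 S q u G → normLq univ q (E u) ≤ ENNReal.ofReal a * normLq S q u

/-- The constant `a'` satisfies `‖∇(E u)‖_{L^q(ℝⁿ)} ≤ a' ‖∇u‖_{L^q(S)}` for all `u ∈ W^{1,q}(S)`.
That `E u` has a weak gradient in `L^q(ℝⁿ)` is not part of this condition. -/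
def IsExtGradBound {n : ℕ} (S : Set (Rn n)) (q : ℝ) (E : (Rn n → ℝ) → Rn n → ℝ) (a' : ℝ) :
    Prop :=
  ∀ u G, MemW1 S q u G → ∀ H, MemW1 univ q (E u) H →
    normGrad univ q H ≤ ENNReal.ofReal a' * normGrad S q G

/-! ### The constants -/

/-- The constant `Q`. -/
def constQ (q τ ξ M : ℝ) : ℝ :=
  q * (1 + τ) * (1 + ξ) ^ 2 / ((q + 1) * τ ^ (1 + 1 / q) * (1 - ξ) ^ 2) * √(1 + M ^ 2)

/-- The constant `B`. -/
def constB (A₁ P τ ξ M : ℝ) : ℝ := A₁ * P * (1 + ξ) ^ 2 * (1 + τ) * √(1 + M ^ 2)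

/-- The bound for the `L^q` norm of the extension operator on a special Lipschitz domain with
Lipschitz constant `M`. -/
def specialA (q τ ξ A₀ M : ℝ) : ℝ := ((A₀ * constQ q τ ξ M) ^ q + 1) ^ (1 / q)

/-- The bound for the `L^q` norm of the gradient of the extension on a special Lipschitz domain
in dimension `n` with Lipschitz constant `M`. -/
def specialA' (n : ℕ) (q τ ξ A₀ A₁ P M : ℝ) : ℝ :=
  max ((2 : ℝ) ^ (q - 1) * (A₀ * constQ q τ ξ M) ^ q + 1)
    ((((n : ℝ) - 1) * (2 : ℝ) ^ (q - 1) * (constB A₁ P τ ξ M * constQ q τ ξ M) ^ q +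
      ((A₀ + constB A₁ P τ ξ M) * constQ q τ ξ M) ^ q + 1) ^ (1 / q))

/-- The number `b (6 N A + N A' + 3) n^{1/q}`. -/
def lowerOrder (n N : ℕ) (q b A A' : ℝ) : ℝ :=
  b * (6 * N * A + N * A' + 3) * (n : ℝ) ^ (1 / q)

/-- The constant `A_q(Ω)` in dimension `n`, with overlap number `N`. -/
def constAq (n N : ℕ) (q b γ A A' : ℝ) : ℝ :=
  if lowerOrder n N q b A A' / (N * A' + 1) ≤ γ then N * A' + 1
  else lowerOrder n N q b A A' / γ

end SobolevEmb

end

/-!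
The proof constructs, for `u ∈ W^{1,q}(Ω)`, a function `W ∈ W^{1,q}(ℝⁿ)` with `W = u` on `Ω` and
`‖∇W‖ ≤ (N A' + 1) ‖∇u‖ + b (6 N A + N A' + 3) n^{1/q} ‖u‖`, all norms being `L^q` norms. The Sobolev
inequality on `ℝⁿ` applied to `W` bounds `‖u‖_{L^p(Ω)}`, and the two terms on the right-hand side are
absorbed into the weighted norm of `u`, at the cost of the factor `2^{(q-1)/q}`.

*Extension from one special Lipschitz domain* `S` with upward direction `ν`. Below `S` the extension
`Eu` is an average of `u` over a vertical half-line that starts above the boundary, and so is its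
gradient, which is found by differentiation under the integral sign:
`∂_j (Eu)(x) = ∫ ∂_j u (x + t g ν) ψ dt + ∂_j g (x) ∫ ∂_ν u (x + t g ν) t ψ dt`.
As `|ψ| ≤ A₀ / t²` and `|t ψ| ≤ A₁ / t²`, both averages are controlled by Hardy's inequality on vertical
lines, `lintegral_hardy`; it yields the constant `Q` (`IsSpecial.lintegral_vertAvg_le`). That
the pieces on both sides of the boundary form a weakly differentiable function is seen for smooth
Lipschitz `u` first: with `g = 0` on the closure of `S` the formula for `Eu` holds on all of `ℝⁿ`, since
`∫ ψ = 1`, hence `Eu` is Lipschitz and its a.e. derivative is its weak derivative. The general case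
follows by mollification with kernels that only see the interior of `S`
(`IsShift.memW1_extension`). When `ν = ± e_k`, the derivative `∂_ν u` is a single partial derivative,
and summing over `j` gives the explicit gradient bound `IsShift.normGrad_gradExt_le`.

*Gluing.* Put `W = Λ u + ∑ θ_i E_i(κ_i u)`. The functions are made from the mollified indicators `λ_i`
of slightly shrunk `U_i`, whose partial derivatives are bounded by `b / 2` because `∂_j ρ` has mean
zero. The cutoff `κ_i` is a step function of `λ_i`, and `θ_i = Φ(F_{i+1}) - Φ(F_i)`, where `F_i` is a
smooth running maximum of `λ_0, …, λ_{i-1}` and `Φ` a step function. A maximum has no larger derivatives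
than its entries, however many there are; so `|∂ θ_i| ≤ 6 b`, and the telescoping sum `∑ θ_i` has
derivatives bounded by `3 b`, as has `Λ = 1 - ∑ θ_i`, which vanishes near the boundary of `Ω`
(`MinimallySmooth.exists_gluingData`). At each point at most `N` of the terms are nonzero, which
leads to the factors `N` (`exists_extension_of_gluingData`).

The suprema of given constants `A_i`, `A'_i` enter the proof only through their being nonnegative upper
bounds. A negative number could be a bound only if all extensions were zero, which is excluded by
`pos_of_isExtBound`.
-/

open scoped Convolution

namespace SobolevEmb

/-! ### Hardy's inequality -/

theorem lintegral_eq_ofReal_mul_lintegral_comp_affine (F : ℝ → ℝ≥0∞) {a : ℝ} (ha : 0 < a) (b : ℝ) :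
    ∫⁻ t, F t = ENNReal.ofReal a * ∫⁻ r, F (a * r + b) := by
  have h1 : ∫⁻ r, F (a * r + b) = ∫⁻ t, F (t + b) ∂(Measure.map (a * ·) volume) :=
    (lintegral_map_equiv (fun t => F (t + b)) (Homeomorph.mulLeft₀ a ha.ne').toMeasurableEquiv).symm
  rw [h1, Real.map_volume_mul_left ha.ne', lintegral_smul_measure,
    lintegral_add_right_eq_self F b, smul_eq_mul, ← mul_assoc, ← ENNReal.ofReal_mul ha.le,
    abs_of_pos (inv_pos.2 ha), mul_inv_cancel₀ ha.ne', ENNReal.ofReal_one, one_mul]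

theorem lintegral_Ioi_comp_mul_left (F : ℝ → ℝ≥0∞) {r : ℝ} (hr : 0 < r) :
    ∫⁻ h in Ioi 0, F (r * h) = ENNReal.ofReal r⁻¹ * ∫⁻ s in Ioi 0, F s := by
  have h := lintegral_eq_ofReal_mul_lintegral_comp_affine ((Ioi (0 : ℝ)).indicator F) hr 0
  rw [lintegral_indicator measurableSet_Ioi] at h
  rw [h, ← mul_assoc, ← ENNReal.ofReal_mul (inv_pos.2 hr).le, inv_mul_cancel₀ hr.ne',
    ENNReal.ofReal_one, one_mul, ← lintegral_indicator measurableSet_Ioi]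
  congr 1 with x
  by_cases hx : 0 < x
  · simp [indicator, hx, hr]
  · simp [indicator, hx, mul_pos_iff_of_pos_left hr]

/-- The constant `∫_τ^∞ r^{-2-1/q} dr` of the Hardy inequality below. -/
noncomputable def hardyConst (q τ : ℝ) : ℝ := q / ((q + 1) * τ ^ (1 + 1 / q))

theorem lintegral_rpow_eq_hardyConst {q τ : ℝ} (hq : 0 < q) (hτ : 0 < τ) :
    ∫⁻ r in Ioi τ, ENNReal.ofReal (r ^ (-2 - 1 / q)) = ENNReal.ofReal (hardyConst q τ) := by
  have hq' : 0 < 1 / q := by positivity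
  have ha : -2 - 1 / q < -1 := by linarith
  rw [← ofReal_integral_eq_lintegral_ofReal (integrableOn_Ioi_rpow_of_lt ha hτ)
    ((ae_restrict_iff' measurableSet_Ioi).2 (.of_forall fun r hr =>
      Real.rpow_nonneg (hτ.trans hr).le _)), integral_Ioi_rpow_of_lt ha hτ]
  congr 1
  rw [hardyConst, show -2 - 1 / q + 1 = -(1 + 1 / q) by ring, Real.rpow_neg hτ.le, neg_div_neg_eq]
  have : 0 < τ ^ (1 + 1 / q) := by positivity
  field_simp

/-- Hardy's inequality with the sharp constant, from Hölder's inequality for the weight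
`r^{-2-1/q}` and the dilation `s = r h`. -/
theorem lintegral_hardy {q τ : ℝ} (hq : 1 < q) (hτ : 0 < τ) {f : ℝ → ℝ≥0∞} (hf : Measurable f) :
    ∫⁻ h in Ioi 0, (∫⁻ r in Ioi τ, f (r * h) * ENNReal.ofReal ((r ^ 2)⁻¹)) ^ q ≤
      ENNReal.ofReal (hardyConst q τ) ^ q * ∫⁻ s in Ioi 0, f s ^ q := by
  have hq0 : 0 < q := by linarith
  set m := ENNReal.ofReal (hardyConst q τ) with hm
  obtain ⟨q', hqq⟩ : ∃ q', q.HolderConjugate q' := ⟨_, Real.HolderConjugate.conjExponent hq⟩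
  have key : ∀ h, (∫⁻ r in Ioi τ, f (r * h) * ENNReal.ofReal ((r ^ 2)⁻¹)) ^ q ≤
      (∫⁻ r in Ioi τ, f (r * h) ^ q * ENNReal.ofReal (r ^ (-1 - 1 / q))) * m ^ (q - 1) := by
    intro h
    have := ENNReal.lintegral_mul_le_Lp_mul_Lq (volume.restrict (Ioi τ)) hqq
      (f := fun r => f (r * h) * ENNReal.ofReal (r ^ ((-1 - 1 / q) / q)))
      (g := fun r => ENNReal.ofReal (r ^ ((-2 - 1 / q) / q'))) (by fun_prop) (by fun_prop)
    have e1 : ∫⁻ r in Ioi τ, f (r * h) * ENNReal.ofReal ((r ^ 2)⁻¹) =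
        ∫⁻ r in Ioi τ, ((fun r => f (r * h) * ENNReal.ofReal (r ^ ((-1 - 1 / q) / q))) *
          (fun r => ENNReal.ofReal (r ^ ((-2 - 1 / q) / q')))) r := by
      refine setLIntegral_congr_fun measurableSet_Ioi fun r hr => ?_
      have hr0 : 0 < r := hτ.trans hr
      simp only [Pi.mul_apply]
      rw [mul_assoc, ← ENNReal.ofReal_mul (by positivity), ← Real.rpow_add hr0]
      congr 2
      have : (-1 - 1 / q) / q + (-2 - 1 / q) / q' = -2 := by
        have hc : q'⁻¹ = 1 - q⁻¹ := by have := hqq.inv_add_inv_eq_one; linarith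
        rw [div_eq_mul_inv _ q', hc]; field_simp; ring
      rw [this, Real.rpow_neg hr0.le]; norm_cast
    have e2 : ∫⁻ r in Ioi τ, ENNReal.ofReal (r ^ ((-2 - 1 / q) / q')) ^ q' = m := by
      rw [hm, ← lintegral_rpow_eq_hardyConst hq0 hτ]
      refine setLIntegral_congr_fun measurableSet_Ioi fun r hr => ?_
      have hr0 : 0 < r := hτ.trans hr
      have hq'0 : 0 < q' := hqq.symm.pos
      rw [ENNReal.ofReal_rpow_of_nonneg (by positivity) hq'0.le, ← Real.rpow_mul hr0.le,
        div_mul_cancel₀ _ hq'0.ne']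
    have e3 : ∫⁻ r in Ioi τ, (f (r * h) * ENNReal.ofReal (r ^ ((-1 - 1 / q) / q))) ^ q =
        ∫⁻ r in Ioi τ, f (r * h) ^ q * ENNReal.ofReal (r ^ (-1 - 1 / q)) := by
      refine setLIntegral_congr_fun measurableSet_Ioi fun r hr => ?_
      have hr0 : 0 < r := hτ.trans hr
      rw [ENNReal.mul_rpow_of_nonneg _ _ hq0.le, ENNReal.ofReal_rpow_of_nonneg (by positivity)
        hq0.le, ← Real.rpow_mul hr0.le, div_mul_cancel₀ _ hq0.ne']
    rw [← e1, e2, e3] at this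
    refine (ENNReal.rpow_le_rpow this hq0.le).trans_eq ?_
    rw [ENNReal.mul_rpow_of_nonneg _ _ hq0.le, ← ENNReal.rpow_mul, ← ENNReal.rpow_mul,
      one_div_mul_cancel hq0.ne', ENNReal.rpow_one]
    congr 2
    have hc := hqq.inv_add_inv_eq_one
    rw [one_div, show q'⁻¹ = 1 - q⁻¹ by linarith]
    field_simp
  calc _ ≤ ∫⁻ h in Ioi 0, (∫⁻ r in Ioi τ, f (r * h) ^ q * ENNReal.ofReal (r ^ (-1 - 1 / q))) *
        m ^ (q - 1) := lintegral_mono fun h => key h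
    _ = (∫⁻ h in Ioi 0, ∫⁻ r in Ioi τ, f (r * h) ^ q * ENNReal.ofReal (r ^ (-1 - 1 / q))) *
        m ^ (q - 1) := lintegral_mul_const _ (Measurable.lintegral_prod_right (by fun_prop))
    _ = (∫⁻ r in Ioi τ, ∫⁻ h in Ioi 0, f (r * h) ^ q * ENNReal.ofReal (r ^ (-1 - 1 / q))) *
        m ^ (q - 1) := by
      rw [lintegral_lintegral_swap (by fun_prop)]
    _ = (∫⁻ r in Ioi τ, (∫⁻ s in Ioi 0, f s ^ q) * ENNReal.ofReal (r ^ (-2 - 1 / q))) *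
        m ^ (q - 1) := by
      congr 1
      refine setLIntegral_congr_fun measurableSet_Ioi fun r hr => ?_
      have hr0 : 0 < r := hτ.trans hr
      rw [lintegral_mul_const _ (by fun_prop), lintegral_Ioi_comp_mul_left (fun s => f s ^ q) hr0,
        mul_comm (ENNReal.ofReal r⁻¹), mul_assoc, ← ENNReal.ofReal_mul (by positivity)]
      congr 2
      rw [← Real.rpow_neg_one, ← Real.rpow_add hr0]; ring_nf
    _ = m ^ q * ∫⁻ s in Ioi 0, f s ^ q := by
      rw [lintegral_const_mul _ (by fun_prop), lintegral_rpow_eq_hardyConst hq0 hτ, ← hm,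
        mul_assoc, mul_comm (m ^ q)]
      congr 1
      nth_rewrite 1 [← ENNReal.rpow_one m]
      rw [← ENNReal.rpow_add_of_nonneg _ _ zero_le_one (by linarith)]
      congr 1; ring

/-! ### Special Lipschitz domains -/

/-- The open set `S` is the superlevel set `{0 < ht}` of a height function `ht`, which is Lipschitz
with constant `L` and grows with unit speed in the direction of the unit vector `ν`. The last
field asks for measure preserving coordinates `(y, s)`, in which `s` is the height. -/
structure IsSpecial {n : ℕ} (S : Set (Rn n)) (ν : Rn n) (L : ℝ) (ht : Rn n → ℝ) : Prop where
  mem_iff : ∀ x, x ∈ S ↔ 0 < ht x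
  norm_dir : ‖ν‖ = 1
  ht_add : ∀ x (s : ℝ), ht (x + s • ν) = ht x + s
  abs_sub_le : ∀ x y, |ht x - ht y| ≤ L * ‖x - y‖
  coords : ∃ (d : ℕ) (Ψ : (Fin d → ℝ) × ℝ → Rn n), MeasurePreserving Ψ volume volume ∧
    (∀ y s, ht (Ψ (y, s)) = s) ∧ ∀ y (s t : ℝ), Ψ (y, s) + t • ν = Ψ (y, s + t)

namespace IsSpecial

variable {n : ℕ} {S : Set (Rn n)} {ν : Rn n} {L : ℝ} {ht : Rn n → ℝ}

theorem one_le (h : IsSpecial S ν L ht) : 1 ≤ L := by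
  have := h.abs_sub_le (0 + (1 : ℝ) • ν) 0
  rw [h.ht_add] at this
  simpa [h.norm_dir] using this

theorem continuous (h : IsSpecial S ν L ht) : Continuous ht :=
  (LipschitzWith.of_dist_le_mul (K := L.toNNReal) fun x y => by
    rw [Real.coe_toNNReal _ (zero_le_one.trans h.one_le), dist_eq_norm, dist_eq_norm]
    exact h.abs_sub_le x y).continuous

theorem eq_preimage (h : IsSpecial S ν L ht) : S = ht ⁻¹' Ioi 0 := by
  ext x; exact h.mem_iff x

theorem isOpen (h : IsSpecial S ν L ht) : IsOpen S := by
  rw [h.eq_preimage]; exact isOpen_Ioi.preimage h.continuous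

theorem mem_closure_iff (h : IsSpecial S ν L ht) {x : Rn n} : x ∈ closure S ↔ 0 ≤ ht x := by
  constructor
  · intro hx
    exact closure_minimal (fun y hy => ((h.mem_iff y).1 hy).le)
      (isClosed_Ici.preimage h.continuous) hx
  · intro hx
    have hc : Filter.Tendsto (fun s : ℝ => x + s • ν) (nhdsWithin 0 (Ioi 0)) (nhds x) := by
      have : Continuous fun s : ℝ => x + s • ν := by fun_prop
      simpa using (this.tendsto 0).mono_left nhdsWithin_le_nhds
    refine mem_closure_of_tendsto hc ?_
    filter_upwards [self_mem_nhdsWithin] with s hs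
    rw [h.mem_iff, h.ht_add]
    exact add_pos_of_nonneg_of_pos hx hs

theorem notMem_closure_iff (h : IsSpecial S ν L ht) {x : Rn n} : x ∈ (closure S)ᶜ ↔ ht x < 0 := by
  rw [mem_compl_iff, h.mem_closure_iff, not_le]

theorem nonempty (h : IsSpecial S ν L ht) : S.Nonempty := by
  refine ⟨0 + (1 - ht 0) • ν, ?_⟩
  rw [h.mem_iff, h.ht_add]; linarith

theorem compl_closure_nonempty (h : IsSpecial S ν L ht) : (closure S)ᶜ.Nonempty := by
  refine ⟨0 + (-1 - ht 0) • ν, ?_⟩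
  rw [h.notMem_closure_iff, h.ht_add]; linarith

/-- Below the boundary, the depth is comparable with the distance to the domain. -/
theorem neg_le_mul_infDist (h : IsSpecial S ν L ht) (x : Rn n) :
    -ht x ≤ L * infDist x (closure S) := by
  have hL : 0 < L := zero_lt_one.trans_le h.one_le
  rw [← div_le_iff₀' hL, le_infDist h.nonempty.closure]
  intro y hy
  rw [div_le_iff₀' hL, dist_eq_norm]
  have h1 := h.abs_sub_le x y
  have h2 := h.mem_closure_iff.1 hy
  linarith [neg_abs_le (ht x - ht y)]

theorem infDist_le_neg (h : IsSpecial S ν L ht) {x : Rn n} (hx : ht x < 0) :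
    infDist x (closure S) ≤ -ht x := by
  have hmem : x + (-ht x) • ν ∈ closure S := by
    rw [h.mem_closure_iff, h.ht_add]; simp
  refine (infDist_le_dist_of_mem hmem).trans_eq ?_
  rw [dist_self_add_right, norm_smul, h.norm_dir, mul_one, Real.norm_of_nonneg (by linarith)]

theorem closure_diff_null (h : IsSpecial S ν L ht) : volume (closure S \ S) = 0 := by
  obtain ⟨d, Ψ, hΨ, hht, -⟩ := h.coords
  have e : closure S \ S = ht ⁻¹' {0} := by
    ext x
    rw [mem_sdiff, h.mem_closure_iff, h.mem_iff, mem_preimage, mem_singleton_iff, not_lt]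
    exact ⟨fun hx => le_antisymm hx.2 hx.1, fun hx => ⟨hx.ge, hx.le⟩⟩
  have hm : MeasurableSet (ht ⁻¹' {0}) := h.continuous.measurable (measurableSet_singleton 0)
  rw [e, ← hΨ.measure_preimage hm.nullMeasurableSet, Measure.volume_eq_prod,
    Measure.measure_prod_null (hΨ.measurable hm)]
  refine .of_forall fun y => ?_
  have : Prod.mk y ⁻¹' (Ψ ⁻¹' (ht ⁻¹' {0})) = {0} := by
    ext s; simp [hht]
  simp only [this, Pi.zero_apply, Real.volume_singleton]

theorem closure_ae_eq (h : IsSpecial S ν L ht) : closure S =ᵐ[volume] S := by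
  refine (ae_eq_set.2 ⟨h.closure_diff_null, ?_⟩)
  rw [sdiff_eq_empty.2 subset_closure]; simp

/-- The lower integral over a half-space of heights, in the coordinates `(y, s)`. -/
theorem exists_lintegral_eq (h : IsSpecial S ν L ht) :
    ∃ (d : ℕ) (Ψ : (Fin d → ℝ) × ℝ → Rn n), Measurable Ψ ∧
      (∀ y s, ht (Ψ (y, s)) = s) ∧ (∀ y (s t : ℝ), Ψ (y, s) + t • ν = Ψ (y, s + t)) ∧
      ∀ (I : Set ℝ) (f : Rn n → ℝ≥0∞), MeasurableSet I → Measurable f →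
        ∫⁻ x in ht ⁻¹' I, f x = ∫⁻ y, ∫⁻ s in I, f (Ψ (y, s)) := by
  obtain ⟨d, Ψ, hΨ, hht, hadd⟩ := h.coords
  refine ⟨d, Ψ, hΨ.measurable, hht, hadd, fun I f hI hf => ?_⟩
  have hm : MeasurableSet (ht ⁻¹' I) := h.continuous.measurable hI
  have hfm : Measurable ((Ψ ⁻¹' (ht ⁻¹' I)).indicator fun z => f (Ψ z)) :=
    Measurable.indicator (hf.comp hΨ.measurable) (hΨ.measurable hm)
  rw [← hΨ.setLIntegral_comp_preimage hm hf, ← lintegral_indicator (hΨ.measurable hm),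
    Measure.volume_eq_prod, lintegral_prod _ hfm.aemeasurable]
  congr 1 with y
  rw [← lintegral_indicator hI]
  congr 1 with s
  have hmem : (y, s) ∈ Ψ ⁻¹' (ht ⁻¹' I) ↔ s ∈ I := by simp only [mem_preimage, hht]
  by_cases hs : s ∈ I
  · rw [indicator_of_mem (hmem.2 hs), indicator_of_mem hs]
  · rw [indicator_of_notMem (fun h' => hs (hmem.1 h')), indicator_of_notMem hs]

end IsSpecial

/-- The vertical average `∫_1^∞ f (x + t g(x) ν) t^{-2} dt`, which dominates the extension
operator. -/
noncomputable def vertAvg {n : ℕ} (ν : Rn n) (g : Rn n → ℝ) (f : Rn n → ℝ≥0∞) (x : Rn n) : ℝ≥0∞ :=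
  ∫⁻ t in Ioi (1 : ℝ), f (x + (t * g x) • ν) * ENNReal.ofReal ((t ^ 2)⁻¹)

/-- Along a vertical line, the substitution `t g = (1 + r) h`, where `h` is the depth, bounds the
vertical average by the average in Hardy's inequality. -/
theorem vertAvg_le {n : ℕ} {ν : Rn n} {g : Rn n → ℝ} {x : Rn n} {h τ c : ℝ} (hh : 0 < h)
    (hτ : 0 < τ) (hl : (1 + τ) * h ≤ g x) (hu : g x ≤ c * h) (f : Rn n → ℝ≥0∞) :
    vertAvg ν g f x ≤
      ENNReal.ofReal c * ∫⁻ r in Ioi τ, f (x + ((1 + r) * h) • ν) * ENNReal.ofReal ((r ^ 2)⁻¹) := by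
  have hg : 0 < g x := lt_of_lt_of_le (by positivity) hl
  have hc : 0 ≤ c := by
    by_contra hc; push Not at hc; nlinarith
  rw [vertAvg, ← lintegral_indicator measurableSet_Ioi,
    lintegral_eq_ofReal_mul_lintegral_comp_affine _ (div_pos hh hg) (h / g x),
    ← lintegral_const_mul' _ _ ENNReal.ofReal_ne_top, ← lintegral_const_mul' _ _ ENNReal.ofReal_ne_top,
    ← lintegral_indicator measurableSet_Ioi]
  refine lintegral_mono fun r => ?_
  have e : h / g x * r + h / g x = (1 + r) * h / g x := by field_simp; ring
  simp only [indicator]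
  rw [e]
  by_cases h1 : (1 + r) * h / g x ∈ Ioi (1 : ℝ)
  · have h2 : g x < (1 + r) * h := by
      have := h1; rw [mem_Ioi, lt_div_iff₀ hg] at this; linarith
    have hr : τ < r := by
      have : (1 + τ) * h < (1 + r) * h := hl.trans_lt h2
      have := lt_of_mul_lt_mul_right this hh.le
      linarith
    have hr0 : 0 < r := hτ.trans hr
    rw [if_pos h1, if_pos (show r ∈ Ioi τ from hr), div_mul_cancel₀ _ hg.ne']
    rw [mul_left_comm, mul_left_comm (ENNReal.ofReal c), ← ENNReal.ofReal_mul (by positivity),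
      ← ENNReal.ofReal_mul hc]
    have : h / g x * (((1 + r) * h / g x) ^ 2)⁻¹ = (g x / h) * ((1 + r) ^ 2)⁻¹ := by
      field_simp
    rw [this]
    have h3 : g x / h ≤ c := by rwa [div_le_iff₀ hh]
    gcongr
    linarith
  · rw [if_neg h1, mul_zero]; exact zero_le

/-- The vertical average is bounded from `L^q(S)` to `L^q` of the exterior of `S`. -/
theorem IsSpecial.lintegral_vertAvg_le {n : ℕ} {S : Set (Rn n)} {ν : Rn n} {L : ℝ} {ht : Rn n → ℝ}
    (hS : IsSpecial S ν L ht) {g : Rn n → ℝ} {q τ c : ℝ} (hq : 1 < q) (hτ : 0 < τ)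
    (hl : ∀ x, ht x < 0 → (1 + τ) * (-ht x) ≤ g x) (hu : ∀ x, ht x < 0 → g x ≤ c * (-ht x))
    {f : Rn n → ℝ≥0∞} (hf : Measurable f) :
    ∫⁻ x in (closure S)ᶜ, vertAvg ν g f x ^ q ≤
      ENNReal.ofReal (c * hardyConst q τ) ^ q * ∫⁻ x in S, f x ^ q := by
  have hq0 : 0 < q := by linarith
  have hht : Measurable ht := hS.continuous.measurable
  obtain ⟨d, Ψ, hΨ, hΨht, hadd, hint⟩ := hS.exists_lintegral_eq
  have hc : 0 ≤ c := by
    obtain ⟨x, hx⟩ := hS.compl_closure_nonempty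
    rw [hS.notMem_closure_iff] at hx
    by_contra hc; push Not at hc
    nlinarith [hl x hx, hu x hx, mul_pos hτ (neg_pos.2 hx)]
  set J : Rn n → ℝ≥0∞ := fun x =>
    ∫⁻ r in Ioi τ, f (x + ((1 + r) * (-ht x)) • ν) * ENNReal.ofReal ((r ^ 2)⁻¹) with hJ
  have hJm : Measurable J := by
    refine Measurable.lintegral_prod_right ?_
    fun_prop
  have eO : (closure S)ᶜ = ht ⁻¹' Iio 0 := by ext x; exact hS.notMem_closure_iff
  calc ∫⁻ x in (closure S)ᶜ, vertAvg ν g f x ^ q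
      ≤ ∫⁻ x in (closure S)ᶜ, ENNReal.ofReal c ^ q * J x ^ q := by
        refine setLIntegral_mono (by fun_prop) fun x hx => ?_
        rw [hS.notMem_closure_iff] at hx
        rw [← ENNReal.mul_rpow_of_nonneg _ _ hq0.le]
        exact ENNReal.rpow_le_rpow (vertAvg_le (neg_pos.2 hx) hτ (hl x hx) (hu x hx) f) hq0.le
    _ = ENNReal.ofReal c ^ q * ∫⁻ y, ∫⁻ s in Iio 0, J (Ψ (y, s)) ^ q := by
        rw [lintegral_const_mul _ (by fun_prop), eO, hint _ _ measurableSet_Iio (by fun_prop)]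
    _ ≤ ENNReal.ofReal c ^ q * ∫⁻ y, ENNReal.ofReal (hardyConst q τ) ^ q *
          ∫⁻ s in Ioi 0, f (Ψ (y, s)) ^ q := by
        gcongr with y
        have hfy : Measurable fun s => f (Ψ (y, s)) := by fun_prop
        refine le_trans (le_of_eq ?_) (lintegral_hardy hq hτ hfy)
        rw [← lintegral_indicator measurableSet_Iio, ← lintegral_neg_eq_self,
          ← lintegral_indicator measurableSet_Ioi]
        congr 1 with h
        by_cases hh : 0 < h
        · rw [indicator_of_mem (by simpa using hh), indicator_of_mem (by simpa using hh)]
          simp only [hJ, hΨht, neg_neg, hadd]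
          congr 1
          refine lintegral_congr fun r => ?_
          congr 4; ring
        · rw [indicator_of_notMem (by simpa using hh), indicator_of_notMem (by simpa using hh)]
    _ = ENNReal.ofReal (c * hardyConst q τ) ^ q * ∫⁻ x in S, f x ^ q := by
        rw [hS.eq_preimage, hint _ _ measurableSet_Ioi (by fun_prop), lintegral_const_mul'
          _ _ (by finiteness), ← mul_assoc, ← ENNReal.mul_rpow_of_nonneg _ _ hq0.le,
          ← ENNReal.ofReal_mul hc]

/-- The point of `ℝ^{d+1}` with first coordinates `y` and last coordinate `s`. -/
noncomputable def snocPoint {d : ℕ} (y : Fin d → ℝ) (s : ℝ) : Rn (d + 1) :=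
  WithLp.toLp 2 ((MeasurableEquiv.piFinSuccAbove (fun _ => ℝ) (Fin.last d)).symm (s, y))

@[simp] theorem snocPoint_last {d : ℕ} (y : Fin d → ℝ) (s : ℝ) : snocPoint y s (Fin.last d) = s := by
  simp [snocPoint, MeasurableEquiv.piFinSuccAbove]

@[simp] theorem snocPoint_castSucc {d : ℕ} (y : Fin d → ℝ) (s : ℝ) (i : Fin d) :
    snocPoint y s i.castSucc = y i := by
  simp [snocPoint, MeasurableEquiv.piFinSuccAbove]

theorem snocPoint_add_smul {d : ℕ} (y : Fin d → ℝ) (s t : ℝ) :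
    snocPoint y s + t • stdVec (Fin.last d) = snocPoint y (s + t) := by
  ext i
  refine Fin.lastCases ?_ (fun i => ?_) i <;> simp [stdVec]

theorem measurePreserving_snocPoint (d : ℕ) :
    MeasurePreserving (fun p : (Fin d → ℝ) × ℝ => snocPoint p.1 p.2) volume volume :=
  (PiLp.volume_preserving_toLp (Fin (d + 1))).comp
    (((volume_preserving_piFinSuccAbove (fun _ => ℝ) (Fin.last d)).symm).comp
      Measure.measurePreserving_swap)

/-- The height function of a special Lipschitz domain is `x_n - φ x'` in the coordinates of its
frame, and `(y, φ y + s)` are its coordinates `(y, s)`. -/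
theorem MinimallySmooth.exists_isSpecial {d : ℕ} {Ω : Set (Rn (d + 1))} (D : MinimallySmooth Ω)
    (i : ℕ) : ∃ ht, IsSpecial (D.special i) (D.up i) (√(1 + (D.lip i : ℝ) ^ 2)) ht := by
  set R := D.frame i with hR
  let pr : Rn (d + 1) → Rn d := fun x => WithLp.toLp 2 (fun k : Fin d => x k.castSucc)
  have hφ : Continuous (D.φ i) := (D.lipschitz i).continuous
  refine ⟨fun x => R.symm x (Fin.last d) - D.φ i (pr (R.symm x)), ?_, ?_, ?_, ?_, ?_⟩
  · intro x
    rw [MinimallySmooth.special, ← hR, LinearIsometryEquiv.image_eq_preimage_symm, mem_preimage,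
      sub_pos]
    rfl
  · rw [MinimallySmooth.up, LinearIsometryEquiv.norm_map, stdVec]; simp
  · intro x s
    have e1 : R.symm (x + s • D.up i) = R.symm x + s • stdVec (Fin.last d) := by
      rw [map_add, map_smul, MinimallySmooth.up, ← hR, LinearIsometryEquiv.symm_apply_apply]
    have e2 : pr (R.symm x + s • stdVec (Fin.last d)) = pr (R.symm x) := by
      ext k; simp [pr, stdVec]
    rw [e1, e2]
    simp only [PiLp.add_apply, PiLp.smul_apply, stdVec, PiLp.single_apply, if_true,
      smul_eq_mul, mul_one]
    ring
  · intro x y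
    set z := R.symm x
    set w := R.symm y
    have hzw : ‖x - y‖ = ‖z - w‖ := by
      rw [← map_sub, LinearIsometryEquiv.norm_map]
    have hsq : ‖z - w‖ ^ 2 = ‖pr z - pr w‖ ^ 2 + (z (Fin.last d) - w (Fin.last d)) ^ 2 := by
      rw [EuclideanSpace.norm_sq_eq, EuclideanSpace.norm_sq_eq, Fin.sum_univ_castSucc]
      simp [pr]
    have hl : |D.φ i (pr z) - D.φ i (pr w)| ≤ D.lip i * ‖pr z - pr w‖ := by
      simpa [Real.dist_eq, dist_eq_norm] using (D.lipschitz i).dist_le_mul (pr z) (pr w)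
    have h0 : (0 : ℝ) ≤ D.lip i := (D.lip i).2
    rw [hzw, ← Real.sqrt_sq (norm_nonneg (z - w)), ← Real.sqrt_mul (by positivity), hsq]
    refine Real.le_sqrt_of_sq_le ?_
    have h1 : |z (Fin.last d) - D.φ i (pr z) - (w (Fin.last d) - D.φ i (pr w))| ≤
        |z (Fin.last d) - w (Fin.last d)| + D.lip i * ‖pr z - pr w‖ := by
      calc _ = |(z (Fin.last d) - w (Fin.last d)) - (D.φ i (pr z) - D.φ i (pr w))| := by ring_nf
        _ ≤ _ := (abs_sub _ _).trans (by gcongr)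
    rw [← sq_abs (z (Fin.last d) - w (Fin.last d))]
    refine (pow_le_pow_left₀ (abs_nonneg _) h1 2).trans ?_
    nlinarith [sq_nonneg (D.lip i * |z (Fin.last d) - w (Fin.last d)| - ‖pr z - pr w‖)]
  · refine ⟨d, fun p => R (snocPoint p.1 (D.φ i (WithLp.toLp 2 p.1) + p.2)), ?_, ?_, ?_⟩
    · have hsh : MeasurePreserving (fun p : (Fin d → ℝ) × ℝ =>
          (p.1, D.φ i (WithLp.toLp 2 p.1) + p.2)) volume volume := by
        refine MeasurePreserving.skew_product (f := id) (g := fun y s => D.φ i (WithLp.toLp 2 y) + s)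
          (MeasurePreserving.id volume) (by fun_prop) (.of_forall fun y => ?_)
        exact map_add_left_eq_self volume _
      exact R.measurePreserving.comp ((measurePreserving_snocPoint d).comp hsh)
    · intro y s
      have e : pr (snocPoint y (D.φ i (WithLp.toLp 2 y) + s)) = WithLp.toLp 2 y := by
        ext k; simp [pr]
      simp only [LinearIsometryEquiv.symm_apply_apply, e, snocPoint_last]
      ring
    · intro y s t
      simp only [MinimallySmooth.up, ← hR]
      rw [← map_smul, ← map_add, snocPoint_add_smul, add_assoc]

section

/-! ### Weak gradients and `L^q` norms -/

variable {n : ℕ} {q : ℝ}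

theorem one_le_ofReal (hq : 1 < q) : 1 ≤ ENNReal.ofReal q := ENNReal.one_le_ofReal.2 hq.le

theorem normLq_rpow (hq : 0 < q) (Ω : Set (Rn n)) (u : Rn n → ℝ) :
    normLq Ω q u ^ q = ∫⁻ x in Ω, ‖u x‖ₑ ^ q := by
  rw [normLq, eLpNorm_eq_lintegral_rpow_enorm_toReal (by simpa using hq) ENNReal.ofReal_ne_top,
    ENNReal.toReal_ofReal hq.le, ← ENNReal.rpow_mul, one_div_mul_cancel hq.ne', ENNReal.rpow_one]

theorem normGrad_rpow (hq : 0 < q) (Ω : Set (Rn n)) (G : Fin n → Rn n → ℝ) :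
    normGrad Ω q G ^ q = ∑ j, normLq Ω q (G j) ^ q := by
  rw [normGrad, ← ENNReal.rpow_mul, one_div_mul_cancel hq.ne', ENNReal.rpow_one]

theorem normLq_mono {Ω : Set (Rn n)} {u v : Rn n → ℝ} (hΩ : MeasurableSet Ω)
    (h : ∀ x ∈ Ω, |u x| ≤ |v x|) : normLq Ω q u ≤ normLq Ω q v :=
  eLpNorm_mono_ae ((ae_restrict_iff' hΩ).2 (.of_forall fun x hx => by
    simpa [Real.norm_eq_abs] using h x hx))

theorem normGrad_mono (hq : 0 < q) {Ω Ω' : Set (Rn n)} {G H : Fin n → Rn n → ℝ}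
    (h : ∀ j, normLq Ω q (G j) ≤ normLq Ω' q (H j)) : normGrad Ω q G ≤ normGrad Ω' q H := by
  unfold normGrad
  gcongr with j
  exact h j

theorem normGrad_add_le (hq : 1 < q) {Ω : Set (Rn n)} {G H : Fin n → Rn n → ℝ}
    (hG : ∀ j, AEStronglyMeasurable (G j) (volume.restrict Ω))
    (hH : ∀ j, AEStronglyMeasurable (H j) (volume.restrict Ω)) :
    normGrad Ω q (fun j x => G j x + H j x) ≤ normGrad Ω q G + normGrad Ω q H := by
  have hq0 : 0 < q := by linarith
  refine le_trans ?_ (ENNReal.Lp_add_le Finset.univ (fun j => normLq Ω q (G j))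
    (fun j => normLq Ω q (H j)) hq.le)
  unfold normGrad
  gcongr with j
  exact eLpNorm_add_le (hG j) (hH j) (one_le_ofReal hq)

theorem normGrad_const (hq : 0 < q) (Ω : Set (Rn n)) (u : Rn n → ℝ) :
    normGrad Ω q (fun _ => u) = (n : ℝ≥0∞) ^ (1 / q) * normLq Ω q u := by
  rw [normGrad, Finset.sum_const, Finset.card_univ, Fintype.card_fin, nsmul_eq_mul,
    ENNReal.mul_rpow_of_nonneg _ _ (by positivity), ← ENNReal.rpow_mul, mul_one_div_cancel hq.ne',
    ENNReal.rpow_one]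

theorem normLq_const_mul (c : ℝ) (Ω : Set (Rn n)) (u : Rn n → ℝ) :
    normLq Ω q (fun x => c * u x) = ENNReal.ofReal |c| * normLq Ω q u := by
  rw [normLq, ← Real.norm_eq_abs, ofReal_norm]
  exact eLpNorm_const_smul c u _ _

theorem integrable_mul_of_hasCompactSupport (hq : 1 < q) {μ : Measure (Rn n)}
    [IsLocallyFiniteMeasure μ] {u φ : Rn n → ℝ} (hu : MemLp u (ENNReal.ofReal q) μ)
    (hφ : Continuous φ) (hc : HasCompactSupport φ) : Integrable (fun x => u x * φ x) μ := by
  simpa using (hu.locallyIntegrable (one_le_ofReal hq)).integrable_smul_right_of_hasCompactSupport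
    hφ hc

theorem tendsto_integral_mul (hq : 1 < q) {μ : Measure (Rn n)} [IsLocallyFiniteMeasure μ]
    {u : Rn n → ℝ} {v : ℕ → Rn n → ℝ} (hu : MemLp u (ENNReal.ofReal q) μ)
    (hv : ∀ k, MemLp (v k) (ENNReal.ofReal q) μ)
    (h : Filter.Tendsto (fun k => eLpNorm (v k - u) (ENNReal.ofReal q) μ) Filter.atTop (nhds 0))
    {φ : Rn n → ℝ} (hφ : Continuous φ) (hc : HasCompactSupport φ) :
    Filter.Tendsto (fun k => ∫ x, v k x * φ x ∂μ) Filter.atTop (nhds (∫ x, u x * φ x ∂μ)) := by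
  refine tendsto_integral_of_L1 _
    (integrable_mul_of_hasCompactSupport hq hu hφ hc).aestronglyMeasurable
    (.of_forall fun k => integrable_mul_of_hasCompactSupport hq (hv k) hφ hc) ?_
  have : ENNReal.HolderConjugate (ENNReal.ofReal q) (ENNReal.conjExponent (ENNReal.ofReal q)) :=
    ENNReal.HolderConjugate.conjExponent (one_le_ofReal hq)
  have := ENNReal.HolderConjugate.symm (p := ENNReal.ofReal q)
    (q := ENNReal.conjExponent (ENNReal.ofReal q))
  have hφq : MemLp φ (ENNReal.conjExponent (ENNReal.ofReal q)) μ :=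
    hφ.memLp_of_hasCompactSupport hc
  have hlim : Filter.Tendsto (fun k => eLpNorm φ (ENNReal.conjExponent (ENNReal.ofReal q)) μ *
      eLpNorm (v k - u) (ENNReal.ofReal q) μ) Filter.atTop (nhds 0) := by
    simpa using ENNReal.Tendsto.const_mul h (Or.inr hφq.eLpNorm_ne_top)
  refine tendsto_of_tendsto_of_tendsto_of_le_of_le tendsto_const_nhds hlim (fun _ => zero_le) ?_
  intro k
  refine le_trans (le_of_eq ?_) (eLpNorm_smul_le_mul_eLpNorm (r := 1)
    ((hv k).sub hu).aestronglyMeasurable hφq.aestronglyMeasurable)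
  rw [eLpNorm_one_eq_lintegral_enorm]
  refine lintegral_congr fun x => ?_
  simp only [Pi.smul_apply', Pi.sub_apply, smul_eq_mul]
  congr 1; ring

theorem hasCompactSupport_fderiv_apply {η : Rn n → ℝ} (hc : HasCompactSupport η) (w : Rn n) :
    HasCompactSupport fun x => fderiv ℝ η x w :=
  (hc.fderiv (𝕜 := ℝ)).comp_left (g := fun L : Rn n →L[ℝ] ℝ => L w) (by simp)

theorem continuous_fderiv_apply {η : Rn n → ℝ} (hη : ContDiff ℝ ∞ η) (w : Rn n) :
    Continuous fun x => fderiv ℝ η x w :=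
  (hη.continuous_fderiv (by simp)).clm_apply continuous_const

/-- Weak gradients are closed under `L^q` limits. -/
theorem HasWeakGradient.of_tendsto (hq : 1 < q) {Ω : Set (Rn n)} {u : Rn n → ℝ}
    {G : Fin n → Rn n → ℝ} {v : ℕ → Rn n → ℝ} {H : ℕ → Fin n → Rn n → ℝ}
    (hu : MemLp u (ENNReal.ofReal q) (volume.restrict Ω))
    (hG : ∀ j, MemLp (G j) (ENNReal.ofReal q) (volume.restrict Ω))
    (hv : ∀ k, MemW1 Ω q (v k) (H k))
    (h : Filter.Tendsto (fun k => normLq Ω q (v k - u)) Filter.atTop (nhds 0))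
    (hH : ∀ j, Filter.Tendsto (fun k => normLq Ω q (H k j - G j)) Filter.atTop (nhds 0)) :
    HasWeakGradient Ω u G := by
  intro j η hη hc hs
  have h1 := tendsto_integral_mul hq hu (fun k => (hv k).memLp) h
    (continuous_fderiv_apply hη (stdVec j)) (hasCompactSupport_fderiv_apply hc (stdVec j))
  have h2 := (tendsto_integral_mul hq (hG j) (fun k => (hv k).memLp_grad j) (hH j)
    hη.continuous hc).neg
  refine tendsto_nhds_unique h1 (h2.congr fun k => ?_)
  exact ((hv k).weakGradient j η hη hc hs).symm

/-- The almost everywhere derivative of a Lipschitz function is its weak gradient. -/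
theorem hasWeakGradient_of_lipschitzWith {v : Rn n → ℝ} {C : ℝ≥0} (hv : LipschitzWith C v)
    {H : Fin n → Rn n → ℝ} (hH : ∀ j, ∀ᵐ x, HasLineDerivAt ℝ v (H j x) x (stdVec j)) :
    HasWeakGradient univ v H := by
  intro j η hη hc _
  obtain ⟨D, hD⟩ := (hη.of_le (m := 1) (by simp)).lipschitzWith_of_hasCompactSupport hc (by simp)
  have := hv.integral_lineDeriv_mul_eq (μ := volume) hD hc (stdVec j)
  rw [Measure.restrict_univ]
  have e1 : ∫ x, lineDeriv ℝ v x (stdVec j) * η x = ∫ x, H j x * η x :=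
    integral_congr_ae ((hH j).mono fun x hx => by simp only [hx.lineDeriv])
  have e2 : ∫ x, lineDeriv ℝ η x (-stdVec j) * v x = - ∫ x, v x * fderiv ℝ η x (stdVec j) := by
    rw [← integral_neg]
    refine integral_congr_ae (.of_forall fun x => ?_)
    simp only [((hη.differentiable (by simp)) x).lineDeriv_eq_fderiv, map_neg]
    ring
  rw [← e1, this, e2, neg_neg]

theorem indicator_eq_indicator {S Ω : Set (Rn n)} {f : Rn n → ℝ}
    (h1 : ∀ x ∈ S, x ∉ Ω → f x = 0) (h2 : ∀ x ∈ Ω, x ∉ S → f x = 0) :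
    S.indicator f = Ω.indicator f := by
  ext x
  by_cases hS : x ∈ S <;> by_cases hΩ : x ∈ Ω <;> simp [hS, hΩ]
  · exact h1 x hS hΩ
  · exact (h2 x hΩ hS).symm

/-- Multiplication by a smooth function `κ` takes weak gradients on `Ω` to weak gradients on `S`,
when `Ω` and `S` agree on the support of `κ`. -/
theorem HasWeakGradient.mul_smooth (hq : 1 < q) {Ω S : Set (Rn n)} (hΩ : MeasurableSet Ω)
    (hS : MeasurableSet S) {u : Rn n → ℝ} {G : Fin n → Rn n → ℝ} (hu : MemW1 Ω q u G)
    {κ : Rn n → ℝ} (hκ : ContDiff ℝ ∞ κ) (h1 : tsupport κ ∩ S ⊆ Ω) (h2 : tsupport κ ∩ Ω ⊆ S) :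
    HasWeakGradient S (fun x => κ x * u x)
      (fun j x => κ x * G j x + fderiv ℝ κ x (stdVec j) * u x) := by
  intro j η hη hc hs
  have hz : ∀ x, x ∉ tsupport κ → κ x = 0 := fun x hx => image_eq_zero_of_notMem_tsupport hx
  have hz' : ∀ x, x ∉ tsupport κ → fderiv ℝ κ x = 0 := fun x hx =>
    fderiv_of_notMem_tsupport (𝕜 := ℝ) hx
  have key : ∀ f : Rn n → ℝ, (∀ x, x ∉ tsupport κ → f x = 0) → ∫ x in S, f x = ∫ x in Ω, f x := by
    intro f hf
    rw [← integral_indicator hS, ← integral_indicator hΩ, indicator_eq_indicator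
      (fun x hx hx' => hf x fun h => hx' (h1 ⟨h, hx⟩))
      (fun x hx hx' => hf x fun h => hx' (h2 ⟨h, hx⟩))]
  rw [key _ (fun x hx => by simp [hz x hx]), key _ (fun x hx => by simp [hz x hx, hz' x hx])]
  have hκη : ContDiff ℝ ∞ (fun x => κ x * η x) := hκ.mul hη
  have hcκη : HasCompactSupport (fun x => κ x * η x) := hc.mul_left
  have hsub : tsupport (fun x => κ x * η x) ⊆ Ω := fun x hx =>
    h1 ⟨tsupport_mul_subset_left hx, hs (tsupport_mul_subset_right hx)⟩
  have hw := hu.weakGradient j _ hκη hcκη hsub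
  have hd : ∀ x, fderiv ℝ (fun x => κ x * η x) x (stdVec j) =
      κ x * fderiv ℝ η x (stdVec j) + fderiv ℝ κ x (stdVec j) * η x := by
    intro x
    rw [fderiv_fun_mul ((hκ.differentiable (by simp)) x) ((hη.differentiable (by simp)) x)]
    simp only [add_apply, smul_apply, smul_eq_mul]; ring
  have i1 : Integrable (fun x => u x * (κ x * fderiv ℝ η x (stdVec j))) (volume.restrict Ω) :=
    integrable_mul_of_hasCompactSupport hq hu.memLp
      (hκ.continuous.mul (continuous_fderiv_apply hη _))
      ((hasCompactSupport_fderiv_apply hc _).mul_left)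
  have i2 : Integrable (fun x => u x * (fderiv ℝ κ x (stdVec j) * η x)) (volume.restrict Ω) :=
    integrable_mul_of_hasCompactSupport hq hu.memLp
      ((continuous_fderiv_apply hκ _).mul hη.continuous) hc.mul_left
  have i3 : Integrable (fun x => G j x * (κ x * η x)) (volume.restrict Ω) :=
    integrable_mul_of_hasCompactSupport hq (hu.memLp_grad j) hκη.continuous hcκη
  simp only [hd, mul_add] at hw
  rw [integral_add i1 i2] at hw
  have e1 : ∫ x in Ω, κ x * u x * fderiv ℝ η x (stdVec j) =
      ∫ x in Ω, u x * (κ x * fderiv ℝ η x (stdVec j)) := by congr 1 with x; ring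
  have e2 : ∫ x in Ω, (κ x * G j x + fderiv ℝ κ x (stdVec j) * u x) * η x =
      ∫ x in Ω, (G j x * (κ x * η x) + u x * (fderiv ℝ κ x (stdVec j) * η x)) := by
    congr 1 with x; ring
  rw [e1, e2, integral_add i3 i2]
  linarith

theorem memLp_mul_of_agree {Ω S : Set (Rn n)} (hΩ : MeasurableSet Ω) (hS : MeasurableSet S)
    {p : ℝ≥0∞} {u κ : Rn n → ℝ} (hu : MemLp u p (volume.restrict Ω)) (hκ : Continuous κ)
    {c : ℝ} (hc : ∀ x, |κ x| ≤ c) (h1 : tsupport κ ∩ S ⊆ Ω) (h2 : tsupport κ ∩ Ω ⊆ S) :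
    MemLp (fun x => κ x * u x) p (volume.restrict S) := by
  have hz : ∀ x, x ∉ tsupport κ → κ x = 0 := fun x hx => image_eq_zero_of_notMem_tsupport hx
  rw [← memLp_indicator_iff_restrict hS, indicator_eq_indicator
      (fun x hx hx' => by rw [hz x fun h => hx' (h1 ⟨h, hx⟩), zero_mul])
      (fun x hx hx' => by rw [hz x fun h => hx' (h2 ⟨h, hx⟩), zero_mul]),
    memLp_indicator_iff_restrict hΩ]
  refine (hu.const_mul c).of_le (hκ.aestronglyMeasurable.mul hu.aestronglyMeasurable)
    (.of_forall fun x => ?_)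
  rw [norm_mul, norm_mul]
  gcongr
  exact (hc x).trans (le_abs_self c)

theorem MemW1.mul_smooth (hq : 1 < q) {Ω S : Set (Rn n)} (hΩ : MeasurableSet Ω)
    (hS : MeasurableSet S) {u : Rn n → ℝ} {G : Fin n → Rn n → ℝ} (hu : MemW1 Ω q u G)
    {κ : Rn n → ℝ} (hκ : ContDiff ℝ ∞ κ) {c c' : ℝ} (hc : ∀ x, |κ x| ≤ c)
    (hc' : ∀ j x, |fderiv ℝ κ x (stdVec j)| ≤ c')
    (h1 : tsupport κ ∩ S ⊆ Ω) (h2 : tsupport κ ∩ Ω ⊆ S) :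
    MemW1 S q (fun x => κ x * u x)
      (fun j x => κ x * G j x + fderiv ℝ κ x (stdVec j) * u x) where
  memLp := memLp_mul_of_agree hΩ hS hu.memLp hκ.continuous hc h1 h2
  memLp_grad j := by
    have hsub : tsupport (fun x => fderiv ℝ κ x (stdVec j)) ⊆ tsupport κ :=
      closure_minimal (fun x hx => by
        by_contra h
        exact hx (by simp [fderiv_of_notMem_tsupport (𝕜 := ℝ) h])) (isClosed_tsupport κ)
    exact (memLp_mul_of_agree hΩ hS (hu.memLp_grad j) hκ.continuous hc h1 h2).add
      (memLp_mul_of_agree hΩ hS hu.memLp (continuous_fderiv_apply hκ _) (hc' j)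
        (fun x hx => h1 ⟨hsub hx.1, hx.2⟩) (fun x hx => h2 ⟨hsub hx.1, hx.2⟩))
  weakGradient := HasWeakGradient.mul_smooth hq hΩ hS hu hκ h1 h2

/-! ### Mollification -/

/-- The mollification `f * w`. -/
noncomputable def mollify (f w : Rn n → ℝ) : Rn n → ℝ :=
  f ⋆[ContinuousLinearMap.mul ℝ ℝ, volume] w

theorem mollify_apply (f w : Rn n → ℝ) (x : Rn n) : mollify f w x = ∫ t, f t * w (x - t) := by
  rw [mollify, convolution_def]; rfl

theorem mollify_apply_swap (f w : Rn n → ℝ) (x : Rn n) :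
    mollify f w x = ∫ t, f (x - t) * w t := by
  rw [mollify, convolution_eq_swap]; rfl

theorem contDiff_mollify {f w : Rn n → ℝ} (hf : LocallyIntegrable f) (hw : ContDiff ℝ ∞ w)
    (hc : HasCompactSupport w) : ContDiff ℝ ∞ (mollify f w) :=
  hc.contDiff_convolution_right _ hf hw

theorem integrable_mul_comp_sub {f w : Rn n → ℝ} (hf : LocallyIntegrable f) (hw : Continuous w)
    (hc : HasCompactSupport w) (x : Rn n) : Integrable fun t => f t * w (x - t) := by
  have hc' : HasCompactSupport fun t => w (x - t) :=
    hc.comp_homeomorph (Homeomorph.subLeft x)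
  simpa using hf.integrable_smul_right_of_hasCompactSupport (by fun_prop : Continuous
    fun t => w (x - t)) hc'

theorem fderiv_mollify_apply {f w : Rn n → ℝ} (hf : LocallyIntegrable f) (hw : ContDiff ℝ ∞ w)
    (hc : HasCompactSupport w) (x e : Rn n) :
    fderiv ℝ (mollify f w) x e = ∫ t, f t * fderiv ℝ w (x - t) e := by
  have h := hc.hasFDerivAt_convolution_right (ContinuousLinearMap.mul ℝ ℝ) hf
    (hw.of_le (m := 1) (by simp)) x
  rw [mollify, h.fderiv]
  have hi : Integrable fun t => f t • fderiv ℝ w (x - t) :=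
    hf.integrable_smul_right_of_hasCompactSupport
      (((hw.continuous_fderiv (by simp)).comp (continuous_const.sub continuous_id) :
      Continuous fun t => fderiv ℝ w (x - t)))
    ((hc.fderiv (𝕜 := ℝ)).comp_homeomorph (Homeomorph.subLeft x))
  have e0 : (f ⋆[ContinuousLinearMap.precompR (Rn n) (ContinuousLinearMap.mul ℝ ℝ), volume]
      fderiv ℝ w) x = ∫ t, f t • fderiv ℝ w (x - t) := by
    rw [convolution_def]
    congr 1
  rw [e0, ContinuousLinearMap.integral_apply hi]
  rfl

/-- By Hölder's inequality, the convolution of an `L^q` function with a test function is bounded. -/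
theorem exists_integral_mul_comp_sub_le (hq : 1 < q) {f φ : Rn n → ℝ}
    (hf : MemLp f (ENNReal.ofReal q)) (hφ : Continuous φ) (hc : HasCompactSupport φ) :
    ∃ C : ℝ, 0 ≤ C ∧ ∀ x, ∫ t, |f t| * |φ (x - t)| ≤ C := by
  have : ENNReal.HolderConjugate (ENNReal.ofReal q) (ENNReal.conjExponent (ENNReal.ofReal q)) :=
    ENNReal.HolderConjugate.conjExponent (one_le_ofReal hq)
  have := ENNReal.HolderConjugate.symm (p := ENNReal.ofReal q)
    (q := ENNReal.conjExponent (ENNReal.ofReal q))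
  set q' := ENNReal.conjExponent (ENNReal.ofReal q)
  have hφq : MemLp φ q' := hφ.memLp_of_hasCompactSupport hc
  refine ⟨(eLpNorm φ q' volume * eLpNorm f (ENNReal.ofReal q) volume).toReal,
    ENNReal.toReal_nonneg, fun x => ?_⟩
  have hmp : MeasurePreserving (fun t : Rn n => x - t) := Measure.measurePreserving_sub_left volume x
  have h1 : eLpNorm (fun t => φ (x - t)) q' volume = eLpNorm φ q' volume :=
    eLpNorm_comp_measurePreserving hφ.aestronglyMeasurable hmp
  have h2 := eLpNorm_smul_le_mul_eLpNorm (r := 1) (p := q') (q := ENNReal.ofReal q)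
    hf.aestronglyMeasurable
    (by fun_prop : AEStronglyMeasurable (fun t => φ (x - t)) volume)
  rw [h1] at h2
  rw [integral_eq_lintegral_of_nonneg_ae (.of_forall fun t => by positivity)
    (by have := hf.aestronglyMeasurable; fun_prop)]
  refine ENNReal.toReal_mono (ENNReal.mul_ne_top hφq.eLpNorm_ne_top hf.eLpNorm_ne_top)
    (le_trans (le_of_eq ?_) h2)
  rw [eLpNorm_one_eq_lintegral_enorm]
  refine lintegral_congr fun t => ?_
  rw [← abs_mul, ← Real.enorm_eq_ofReal_abs]
  simp only [Pi.smul_apply', smul_eq_mul]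
  rw [mul_comm]

theorem exists_lipschitzWith_mollify (hq : 1 < q) {f w : Rn n → ℝ}
    (hf : MemLp f (ENNReal.ofReal q)) (hw : ContDiff ℝ ∞ w) (hc : HasCompactSupport w) :
    ∃ C, LipschitzWith C (mollify f w) := by
  have hfl := hf.locallyIntegrable (one_le_ofReal hq)
  have hDc : Continuous fun x => ‖fderiv ℝ w x‖ := (hw.continuous_fderiv (by simp)).norm
  have hDs : HasCompactSupport fun x => ‖fderiv ℝ w x‖ := (hc.fderiv (𝕜 := ℝ)).norm
  obtain ⟨C, hC, hb⟩ := exists_integral_mul_comp_sub_le hq hf hDc hDs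
  have hdiff := (contDiff_mollify hfl hw hc).differentiable (by simp)
  refine ⟨C.toNNReal, lipschitzWith_of_nnnorm_fderiv_le hdiff fun x => ?_⟩
  rw [← NNReal.coe_le_coe, coe_nnnorm, Real.coe_toNNReal _ hC]
  refine ContinuousLinearMap.opNorm_le_bound _ hC fun e => ?_
  rw [fderiv_mollify_apply hfl hw hc]
  refine (norm_integral_le_integral_norm _).trans ?_
  refine le_trans ?_ (mul_le_mul_of_nonneg_right (hb x) (norm_nonneg e))
  rw [← integral_mul_const]
  have hi : Integrable fun t => |f t| * |‖fderiv ℝ w (x - t)‖| := by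
    refine integrable_mul_comp_sub (w := fun t => |‖fderiv ℝ w t‖|) ?_ (by fun_prop) ?_ x
    · exact locallyIntegrable_iff.2 fun K hK => (locallyIntegrable_iff.1 hfl K hK).norm
    · exact hDs.norm
  refine integral_mono_of_nonneg (.of_forall fun t => norm_nonneg _) (hi.mul_const _)
    (.of_forall fun t => ?_)
  simp only [norm_mul, Real.norm_eq_abs, abs_norm, mul_assoc]
  gcongr
  exact (fderiv ℝ w (x - t)).le_opNorm e

/-- Mollifying the weak gradient gives the gradient of the mollification, as long as the kernel at
`x` stays inside the domain. -/
theorem fderiv_mollify_indicator (hq : 1 < q) {Ω : Set (Rn n)} (hΩ : MeasurableSet Ω)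
    {u : Rn n → ℝ} {G : Fin n → Rn n → ℝ} (hu : MemW1 Ω q u G) {w : Rn n → ℝ}
    (hw : ContDiff ℝ ∞ w) (hc : HasCompactSupport w) {x : Rn n}
    (hx : tsupport (fun t => w (x - t)) ⊆ Ω) (j : Fin n) :
    fderiv ℝ (mollify (Ω.indicator u) w) x (stdVec j) = mollify (Ω.indicator (G j)) w x := by
  have hl : LocallyIntegrable (Ω.indicator u) :=
    ((memLp_indicator_iff_restrict hΩ).2 hu.memLp).locallyIntegrable (one_le_ofReal hq)
  rw [fderiv_mollify_apply hl hw hc, mollify_apply]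
  have hη : ContDiff ℝ ∞ fun t => w (x - t) := hw.comp (contDiff_const.sub contDiff_id)
  have h := hu.weakGradient j _ hη (hc.comp_homeomorph (Homeomorph.subLeft x)) hx
  have hd : ∀ t, fderiv ℝ (fun t => w (x - t)) t (stdVec j) = - fderiv ℝ w (x - t) (stdVec j) := by
    intro t
    have h1 : HasFDerivAt (fun t => w (x - t))
        ((fderiv ℝ w (x - t)).comp (-ContinuousLinearMap.id ℝ (Rn n))) t :=
      ((hw.differentiable (by simp)) (x - t)).hasFDerivAt.comp t ((hasFDerivAt_id t).const_sub x)
    rw [h1.fderiv]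
    simp
  have ind : ∀ (f φ : Rn n → ℝ), ∫ t, Ω.indicator f t * φ t = ∫ t in Ω, f t * φ t := by
    intro f φ
    rw [← integral_indicator hΩ]
    congr 1 with t
    by_cases ht : t ∈ Ω <;> simp [ht]
  rw [ind, ind]
  simp only [hd, mul_neg, integral_neg, neg_inj] at h
  exact h

/-- Translations are continuous in `L^q`. -/
theorem tendsto_eLpNorm_comp_sub (hq : 1 < q) {f : Rn n → ℝ} (hf : MemLp f (ENNReal.ofReal q)) :
    Filter.Tendsto (fun y : Rn n => eLpNorm (fun x => f (x - y) - f x) (ENNReal.ofReal q) volume)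
      (nhds 0) (nhds 0) := by
  have : Fact (1 ≤ ENNReal.ofReal q) := ⟨one_le_ofReal hq⟩
  have : Fact (ENNReal.ofReal q ≠ ⊤) := ⟨ENNReal.ofReal_ne_top⟩
  have hcont : Continuous fun y : Rn n => DomAddAct.mk (-y) +ᵥ hf.toLp f := by
    have hmk : Continuous fun y : Rn n => DomAddAct.mk (-y) :=
      DomAddAct.continuous_mk.comp continuous_neg
    exact hmk.vadd continuous_const
  have h0 : DomAddAct.mk (-(0 : Rn n)) +ᵥ hf.toLp f = hf.toLp f := by simp
  have h := (hcont.tendsto 0).edist (tendsto_const_nhds (x := hf.toLp f))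
  rw [h0, edist_self] at h
  refine h.congr fun y => ?_
  rw [DomAddAct.mk_vadd_toLp, Lp.edist_toLp_toLp]
  congr 1 with x
  simp only [Pi.sub_apply, vadd_eq_add, sub_eq_neg_add]

/-- Mollification moves `f` in `L^q` by at most as much as the translations by vectors of the
support of the kernel do. -/
theorem eLpNorm_mollify_sub_le (hq : 1 < q) {f w : Rn n → ℝ} (hf : MemLp f (ENNReal.ofReal q))
    (hw : Continuous w) (hc : HasCompactSupport w) (h0 : ∀ t, 0 ≤ w t) (h1 : ∫ t, w t = 1)
    {η : ℝ≥0∞} (hη : ∀ t, w t ≠ 0 →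
      eLpNorm (fun x => f (x - t) - f x) (ENNReal.ofReal q) volume ≤ η) :
    eLpNorm (mollify f w - f) (ENNReal.ofReal q) volume ≤ η := by
  have hq0 : 0 < q := by linarith
  obtain ⟨g, hg, hfg⟩ : ∃ g : Rn n → ℝ, StronglyMeasurable g ∧ f =ᵐ[volume] g :=
    ⟨_, hf.aestronglyMeasurable.stronglyMeasurable_mk, hf.aestronglyMeasurable.ae_eq_mk⟩
  have hgm : Measurable g := hg.measurable
  have hgL : MemLp g (ENNReal.ofReal q) := hf.ae_eq hfg
  have hgl := hgL.locallyIntegrable (one_le_ofReal hq)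
  have hmol : mollify f w = mollify g w := convolution_congr _ hfg (ae_eq_refl w)
  have hηg : ∀ t, w t ≠ 0 → ∫⁻ x, ‖g (x - t) - g x‖ₑ ^ q ≤ η ^ q := by
    intro t ht
    have e : (fun x => f (x - t) - f x) =ᵐ[volume] fun x => g (x - t) - g x :=
      ((measurePreserving_sub_right volume t).quasiMeasurePreserving.ae_eq hfg).sub hfg
    have := hη t ht
    rw [eLpNorm_congr_ae e] at this
    have h2 := normLq_rpow hq0 univ fun x => g (x - t) - g x
    rw [Measure.restrict_univ] at h2
    rw [← h2, normLq, Measure.restrict_univ]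
    exact ENNReal.rpow_le_rpow this hq0.le
  have hwi : Integrable w := hw.integrable_of_hasCompactSupport hc
  set μ : Measure (Rn n) := volume.withDensity fun t => ENNReal.ofReal (w t) with hμ
  have hμ1 : IsProbabilityMeasure μ := ⟨by
    rw [hμ, withDensity_apply _ MeasurableSet.univ, Measure.restrict_univ,
      ← ofReal_integral_eq_lintegral_ofReal hwi (.of_forall h0), h1, ENNReal.ofReal_one]⟩
  have key : ∀ x, ‖(mollify g w - g) x‖ₑ ^ q ≤
      ∫⁻ t, ENNReal.ofReal (w t) * ‖g (x - t) - g x‖ₑ ^ q := by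
    intro x
    have hi1 : Integrable fun t => g (x - t) * w t := by
      have := (integrable_mul_comp_sub hgl hw hc x).comp_sub_left x
      simpa using this
    have e1 : (mollify g w - g) x = ∫ t, (g (x - t) - g x) * w t := by
      simp only [sub_mul]
      rw [integral_sub hi1 (hwi.const_mul _), integral_const_mul, h1, mul_one, Pi.sub_apply,
        mollify_apply_swap]
    have e2 : ‖(mollify g w - g) x‖ₑ ≤ eLpNorm' (fun t => g (x - t) - g x) 1 μ := by
      rw [e1]
      refine (enorm_integral_le_lintegral_enorm _).trans_eq ?_
      rw [eLpNorm'_eq_lintegral_enorm, hμ, lintegral_withDensity_eq_lintegral_mul _ (by fun_prop)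
        (by fun_prop)]
      simp only [ENNReal.rpow_one, div_one, Pi.mul_apply]
      refine lintegral_congr fun t => ?_
      rw [enorm_mul, mul_comm, Real.enorm_of_nonneg (h0 t)]
    have e3 : eLpNorm' (fun t => g (x - t) - g x) 1 μ ≤ eLpNorm' (fun t => g (x - t) - g x) q μ :=
      eLpNorm'_le_eLpNorm'_of_exponent_le one_pos hq.le μ
        (by fun_prop : Measurable fun t => g (x - t) - g x).aestronglyMeasurable
    refine (ENNReal.rpow_le_rpow (e2.trans e3) hq0.le).trans_eq ?_
    rw [eLpNorm'_eq_lintegral_enorm, ← ENNReal.rpow_mul, one_div_mul_cancel hq0.ne',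
      ENNReal.rpow_one, hμ, lintegral_withDensity_eq_lintegral_mul _ (by fun_prop)
        (by fun_prop)]
    rfl
  rw [hmol, eLpNorm_congr_ae (Filter.EventuallyEq.rfl.sub hfg)]
  rw [← ENNReal.rpow_le_rpow_iff hq0]
  have h2 := normLq_rpow hq0 univ (mollify g w - g)
  rw [normLq, Measure.restrict_univ] at h2
  rw [h2]
  calc ∫⁻ x, ‖(mollify g w - g) x‖ₑ ^ q
      ≤ ∫⁻ x, ∫⁻ t, ENNReal.ofReal (w t) * ‖g (x - t) - g x‖ₑ ^ q := lintegral_mono key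
    _ = ∫⁻ t, ENNReal.ofReal (w t) * ∫⁻ x, ‖g (x - t) - g x‖ₑ ^ q := by
        rw [lintegral_lintegral_swap (by fun_prop)]
        refine lintegral_congr fun t => ?_
        rw [lintegral_const_mul _ (by fun_prop)]
    _ ≤ ∫⁻ t, ENNReal.ofReal (w t) * η ^ q := by
        refine lintegral_mono fun t => ?_
        by_cases ht : w t = 0
        · simp [ht]
        · gcongr; exact hηg t ht
    _ = η ^ q := by
        rw [lintegral_mul_const _ (by fun_prop), ← ofReal_integral_eq_lintegral_ofReal hwi
          (.of_forall h0), h1, ENNReal.ofReal_one, one_mul]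

theorem tendsto_eLpNorm_mollify_sub (hq : 1 < q) {f : Rn n → ℝ} (hf : MemLp f (ENNReal.ofReal q))
    {w : ℕ → Rn n → ℝ} {r : ℕ → ℝ} (hw : ∀ k, Continuous (w k))
    (hc : ∀ k, HasCompactSupport (w k)) (h0 : ∀ k t, 0 ≤ w k t) (h1 : ∀ k, ∫ t, w k t = 1)
    (hr : Filter.Tendsto r Filter.atTop (nhds 0)) (hs : ∀ k t, w k t ≠ 0 → ‖t‖ ≤ r k) :
    Filter.Tendsto (fun k => eLpNorm (mollify f (w k) - f) (ENNReal.ofReal q) volume)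
      Filter.atTop (nhds 0) := by
  rw [ENNReal.tendsto_nhds_zero]
  intro η hη
  have h := (ENNReal.tendsto_nhds_zero.1 (tendsto_eLpNorm_comp_sub hq hf)) η hη
  obtain ⟨δ, hδ, hb⟩ := Metric.eventually_nhds_iff.1 h
  filter_upwards [hr.eventually_lt_const hδ] with k hk
  refine eLpNorm_mollify_sub_le hq hf (hw k) (hc k) (h0 k) (h1 k) fun t ht => ?_
  exact hb (by rw [dist_zero_right]; exact (hs k t ht).trans_lt hk)

/-! ### Vertical averages -/

/-- The function `g` vanishes on the closure of the special Lipschitz domain `S`, is comparable to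
the depth below `S`, is Lipschitz, and has partial derivatives bounded by `β` off the closure of
`S`. -/
structure IsShift (S : Set (Rn n)) (ht : Rn n → ℝ) (τ c β : ℝ) (g : Rn n → ℝ) : Prop where
  lipschitz : ∃ K, LipschitzWith K g
  eq_zero : ∀ x ∈ closure S, g x = 0
  lower : ∀ x, ht x < 0 → (1 + τ) * (-ht x) ≤ g x
  upper : ∀ x, ht x < 0 → g x ≤ c * (-ht x)
  differentiableAt : ∀ x, ht x < 0 → DifferentiableAt ℝ g x
  fderiv_le : ∀ x, ht x < 0 → ∀ j, |fderiv ℝ g x (stdVec j)| ≤ β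

/-- The function `w` is measurable on `(1, ∞)` and bounded by `C / t ^ 2`. -/
structure IsQuadWeight (w : ℝ → ℝ) (C : ℝ) : Prop where
  aestronglyMeasurable : AEStronglyMeasurable w (volume.restrict (Ioi 1))
  bound : ∀ t, 1 ≤ t → |w t| ≤ C * (t ^ 2)⁻¹

theorem IsQuadWeight.nonneg {w : ℝ → ℝ} {C : ℝ} (hw : IsQuadWeight w C) : 0 ≤ C := by
  simpa using (abs_nonneg _).trans (hw.bound 1 le_rfl)

theorem IsWeight.isQuadWeight {ψ : ℝ → ℝ} {A₀ A₁ : ℝ} (hψ : IsWeight ψ A₀ A₁) :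
    IsQuadWeight ψ A₀ where
  aestronglyMeasurable := by simpa using (hψ.integrable 0).aestronglyMeasurable
  bound t ht := by rw [← div_eq_mul_inv]; exact hψ.bound₀ t ht

theorem IsWeight.isQuadWeight_mul {ψ : ℝ → ℝ} {A₀ A₁ : ℝ} (hψ : IsWeight ψ A₀ A₁) :
    IsQuadWeight (fun t => t * ψ t) A₁ where
  aestronglyMeasurable := by simpa using (hψ.integrable 1).aestronglyMeasurable
  bound t ht := by
    have h0 : 0 < t := by linarith
    rw [abs_mul, abs_of_pos h0]
    calc t * |ψ t| ≤ t * (A₁ / t ^ 3) := by gcongr; exact hψ.bound₁ t ht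
      _ = A₁ * (t ^ 2)⁻¹ := by field_simp

/-- The weighted average of `f` over the half-line above `x`, starting at `x + g(x) ν`. -/
noncomputable def lineAvg (ν : Rn n) (g : Rn n → ℝ) (w : ℝ → ℝ) (f : Rn n → ℝ) (x : Rn n) : ℝ :=
  ∫ t in Ioi 1, f (x + (t * g x) • ν) * w t

theorem enorm_mul_weight_le {w : ℝ → ℝ} {C : ℝ} (hw : IsQuadWeight w C) (a : ℝ) {t : ℝ}
    (ht : 1 < t) : ‖a * w t‖ₑ ≤ ENNReal.ofReal C * (‖a‖ₑ * ENNReal.ofReal ((t ^ 2)⁻¹)) := by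
  rw [enorm_mul, mul_left_comm, ← ENNReal.ofReal_mul hw.nonneg, Real.enorm_eq_ofReal_abs (w t)]
  gcongr
  exact hw.bound t ht.le

theorem lintegral_enorm_mul_weight_le {w : ℝ → ℝ} {C : ℝ} (hw : IsQuadWeight w C) (ν : Rn n)
    (g : Rn n → ℝ) (f : Rn n → ℝ) (x : Rn n) :
    ∫⁻ t in Ioi 1, ‖f (x + (t * g x) • ν) * w t‖ₑ ≤
      ENNReal.ofReal C * vertAvg ν g (fun z => ‖f z‖ₑ) x := by
  rw [vertAvg, ← lintegral_const_mul' _ _ ENNReal.ofReal_ne_top]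
  refine lintegral_mono_ae ((ae_restrict_iff' measurableSet_Ioi).2 (.of_forall fun t ht => ?_))
  exact enorm_mul_weight_le hw _ ht

theorem enorm_lineAvg_le {w : ℝ → ℝ} {C : ℝ} (hw : IsQuadWeight w C) (ν : Rn n)
    (g : Rn n → ℝ) (f : Rn n → ℝ) (x : Rn n) :
    ‖lineAvg ν g w f x‖ₑ ≤ ENNReal.ofReal C * vertAvg ν g (fun z => ‖f z‖ₑ) x :=
  (enorm_integral_le_lintegral_enorm _).trans (lintegral_enorm_mul_weight_le hw ν g f x)

section

variable {S : Set (Rn n)} {ν : Rn n} {L : ℝ} {ht : Rn n → ℝ} {τ c β : ℝ} {g : Rn n → ℝ}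

theorem IsShift.add_mem (hS : IsSpecial S ν L ht) (hg : IsShift S ht τ c β g) (hτ : 0 < τ)
    {x : Rn n} (hx : ht x < 0) {t : ℝ} (h1 : 1 ≤ t) : x + (t * g x) • ν ∈ S := by
  rw [hS.mem_iff, hS.ht_add]
  have h2 := hg.lower x hx
  have h3 : 0 < τ * (-ht x) := mul_pos hτ (by linarith)
  nlinarith

/-- Modification of `f` on a null set does not affect its values along almost every half-line. -/
theorem IsShift.ae_eq_comp (hS : IsSpecial S ν L ht) (hg : IsShift S ht τ c β g) (hτ : 0 < τ)
    {f f' : Rn n → ℝ} (hf : f =ᵐ[volume.restrict S] f') :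
    ∀ᵐ x ∂volume.restrict (closure S)ᶜ, ∀ᵐ t ∂volume.restrict (Ioi (1 : ℝ)),
      f (x + (t * g x) • ν) = f' (x + (t * g x) • ν) := by
  obtain ⟨K, hK⟩ := hg.lipschitz
  have hgc : Continuous g := hK.continuous
  rw [Filter.EventuallyEq, ae_restrict_iff' hS.isOpen.measurableSet] at hf
  obtain ⟨N, hN, hNm, hN0⟩ := exists_measurable_superset_of_null (ae_iff.1 hf)
  have hind : Measurable (N.indicator (1 : Rn n → ℝ≥0∞)) := measurable_one.indicator hNm
  have h := hS.lintegral_vertAvg_le (q := 2) one_lt_two hτ hg.lower hg.upper hind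
  have hz : ∫⁻ x in S, N.indicator (1 : Rn n → ℝ≥0∞) x ^ (2 : ℝ) = 0 := by
    have e : ∀ x, N.indicator (1 : Rn n → ℝ≥0∞) x ^ (2 : ℝ) = N.indicator 1 x := by
      intro x; by_cases hx : x ∈ N <;> simp [hx]
    simp only [e]
    rw [lintegral_indicator_one hNm]
    exact le_antisymm ((Measure.restrict_apply_le S N).trans_eq hN0) zero_le
  rw [hz, mul_zero, nonpos_iff_eq_zero] at h
  have hm : Measurable (vertAvg ν g (N.indicator (1 : Rn n → ℝ≥0∞))) := by
    refine Measurable.lintegral_prod_right ?_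
    fun_prop
  rw [lintegral_eq_zero_iff (by fun_prop)] at h
  filter_upwards [h, ae_restrict_mem isClosed_closure.measurableSet.compl] with x hx hxO
  have hx0 : vertAvg ν g (N.indicator (1 : Rn n → ℝ≥0∞)) x = 0 := by simpa using hx
  rw [vertAvg, lintegral_eq_zero_iff (by fun_prop)] at hx0
  filter_upwards [hx0, ae_restrict_mem measurableSet_Ioi] with t ht ht1
  rw [hS.notMem_closure_iff] at hxO
  have ht0 : (0 : ℝ) < t := zero_lt_one.trans ht1
  have hnot : x + (t * g x) • ν ∉ N := by
    intro hmem
    have : ENNReal.ofReal ((t ^ 2)⁻¹) = 0 := by simpa [hmem] using ht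
    rw [ENNReal.ofReal_eq_zero] at this
    have h3 : 0 < (t ^ 2)⁻¹ := by positivity
    linarith
  by_contra hne
  exact hnot (hN fun h' => hne (h' (hg.add_mem hS hτ hxO (le_of_lt ht1))))

theorem IsShift.lineAvg_ae_eq (hS : IsSpecial S ν L ht) (hg : IsShift S ht τ c β g) (hτ : 0 < τ)
    {f f' : Rn n → ℝ} (hf : f =ᵐ[volume.restrict S] f') (w : ℝ → ℝ) :
    lineAvg ν g w f =ᵐ[volume.restrict (closure S)ᶜ] lineAvg ν g w f' := by
  filter_upwards [hg.ae_eq_comp hS hτ hf] with x hx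
  exact integral_congr_ae (hx.mono fun t ht => by simp only [ht])

theorem IsShift.aestronglyMeasurable_lineAvg (hS : IsSpecial S ν L ht)
    (hg : IsShift S ht τ c β g) (hτ : 0 < τ) {f : Rn n → ℝ}
    (hf : AEStronglyMeasurable f (volume.restrict S)) {w : ℝ → ℝ} {C : ℝ}
    (hw : IsQuadWeight w C) :
    AEStronglyMeasurable (lineAvg ν g w f) (volume.restrict (closure S)ᶜ) := by
  obtain ⟨K, hK⟩ := hg.lipschitz
  have hgc : Continuous g := hK.continuous
  refine AEStronglyMeasurable.congr ?_ (hg.lineAvg_ae_eq hS hτ hf.ae_eq_mk w).symm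
  have hm : Measurable (hf.mk f) := hf.stronglyMeasurable_mk.measurable
  have h1 : Measurable fun p : Rn n × ℝ => hf.mk f (p.1 + (p.2 * g p.1) • ν) := by fun_prop
  exact (h1.aestronglyMeasurable.mul (hw.aestronglyMeasurable.comp_snd)).integral_prod_right'

/-- The averaging operators are bounded from `L^q(S)` to `L^q` of the exterior of `S`. -/
theorem IsShift.normLq_lineAvg_le (hS : IsSpecial S ν L ht) (hg : IsShift S ht τ c β g)
    (hτ : 0 < τ) (hq : 1 < q) {f : Rn n → ℝ}
    (hf : AEStronglyMeasurable f (volume.restrict S)) {w : ℝ → ℝ} {C : ℝ}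
    (hw : IsQuadWeight w C) :
    normLq (closure S)ᶜ q (lineAvg ν g w f) ≤
      ENNReal.ofReal (C * (c * hardyConst q τ)) * normLq S q f := by
  have hq0 : 0 < q := by linarith
  have hm : Measurable (hf.mk f) := hf.stronglyMeasurable_mk.measurable
  have e1 : normLq (closure S)ᶜ q (lineAvg ν g w f) =
      normLq (closure S)ᶜ q (lineAvg ν g w (hf.mk f)) :=
    eLpNorm_congr_ae (hg.lineAvg_ae_eq hS hτ hf.ae_eq_mk w)
  have e2 : normLq S q f = normLq S q (hf.mk f) := eLpNorm_congr_ae hf.ae_eq_mk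
  rw [e1, e2, ← ENNReal.rpow_le_rpow_iff hq0, normLq_rpow hq0, ENNReal.mul_rpow_of_nonneg _ _ hq0.le,
    normLq_rpow hq0, ENNReal.ofReal_mul hw.nonneg, ENNReal.mul_rpow_of_nonneg _ _ hq0.le, mul_assoc]
  refine le_trans ?_ (mul_le_mul_right (hS.lintegral_vertAvg_le hq hτ hg.lower hg.upper
    hm.enorm) (ENNReal.ofReal C ^ q))
  rw [← lintegral_const_mul' _ _ (by finiteness)]
  refine lintegral_mono fun x => ?_
  rw [← ENNReal.mul_rpow_of_nonneg _ _ hq0.le]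
  exact ENNReal.rpow_le_rpow (enorm_lineAvg_le hw ν g _ x) hq0.le

theorem IsShift.ae_integrable (hS : IsSpecial S ν L ht) (hg : IsShift S ht τ c β g)
    (hτ : 0 < τ) (hq : 1 < q) {f : Rn n → ℝ}
    (hf : MemLp f (ENNReal.ofReal q) (volume.restrict S)) {w : ℝ → ℝ} {C : ℝ}
    (hw : IsQuadWeight w C) :
    ∀ᵐ x ∂volume.restrict (closure S)ᶜ,
      IntegrableOn (fun t => f (x + (t * g x) • ν) * w t) (Ioi 1) := by
  have hq0 : 0 < q := by linarith
  obtain ⟨K, hK⟩ := hg.lipschitz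
  have hgc : Continuous g := hK.continuous
  set f' := hf.aestronglyMeasurable.mk f
  have hm : Measurable f' := hf.aestronglyMeasurable.stronglyMeasurable_mk.measurable
  have hvm : Measurable (vertAvg ν g fun z => ‖f' z‖ₑ) := by
    refine Measurable.lintegral_prod_right ?_
    fun_prop
  have hfin : ∫⁻ x in (closure S)ᶜ, vertAvg ν g (fun z => ‖f' z‖ₑ) x ^ q ≠ ⊤ := by
    refine ne_top_of_le_ne_top ?_ (hS.lintegral_vertAvg_le hq hτ hg.lower hg.upper hm.enorm)
    refine ENNReal.mul_ne_top (by finiteness) ?_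
    rw [← normLq_rpow hq0]
    refine ENNReal.rpow_ne_top_of_nonneg hq0.le ?_
    rw [normLq, ← eLpNorm_congr_ae hf.aestronglyMeasurable.ae_eq_mk]
    exact hf.eLpNorm_ne_top
  filter_upwards [ae_lt_top (by fun_prop) hfin,
    hg.ae_eq_comp hS hτ hf.aestronglyMeasurable.ae_eq_mk] with x hx hx'
  have hlt : vertAvg ν g (fun z => ‖f' z‖ₑ) x < ⊤ := by
    by_contra h
    rw [not_lt, top_le_iff] at h
    rw [h, ENNReal.top_rpow_of_pos hq0] at hx
    exact lt_irrefl _ hx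
  have hi : Integrable (fun t => f' (x + (t * g x) • ν) * w t) (volume.restrict (Ioi 1)) := by
    refine ⟨((by fun_prop : Measurable fun t : ℝ => f' (x + (t * g x) • ν)).aestronglyMeasurable).mul
      hw.aestronglyMeasurable, ?_⟩
    exact (lintegral_enorm_mul_weight_le hw ν g f' x).trans_lt
      (ENNReal.mul_lt_top ENNReal.ofReal_lt_top hlt)
  exact hi.congr (hx'.mono fun t ht => by simp only [f', ht])

theorem IsShift.lineAvg_sub_ae_eq (hS : IsSpecial S ν L ht) (hg : IsShift S ht τ c β g)
    (hτ : 0 < τ) (hq : 1 < q) {f f' : Rn n → ℝ}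
    (hf : MemLp f (ENNReal.ofReal q) (volume.restrict S))
    (hf' : MemLp f' (ENNReal.ofReal q) (volume.restrict S)) {w : ℝ → ℝ} {C : ℝ}
    (hw : IsQuadWeight w C) :
    ∀ᵐ x ∂volume.restrict (closure S)ᶜ,
      lineAvg ν g w f x - lineAvg ν g w f' x = lineAvg ν g w (f - f') x := by
  filter_upwards [hg.ae_integrable hS hτ hq hf hw, hg.ae_integrable hS hτ hq hf' hw] with x h1 h2
  rw [lineAvg, lineAvg, lineAvg, ← integral_sub h1 h2]
  congr 1 with t
  simp only [Pi.sub_apply]; ring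

end

/-! ### The extension theorem on special Lipschitz domains -/

open Classical in
/-- The function which is `f` on the closure of `S` and `h` elsewhere. -/
noncomputable def glue (S : Set (Rn n)) (f h : Rn n → ℝ) (x : Rn n) : ℝ :=
  if x ∈ closure S then f x else h x

theorem extension_eq_glue (S : Set (Rn n)) (ν : Rn n) (g : Rn n → ℝ) (ψ : ℝ → ℝ) (u : Rn n → ℝ) :
    extension S ν g ψ u = glue S u (lineAvg ν g ψ u) := rfl

/-- The derivative in the direction `ν`, computed from the gradient. -/
noncomputable def dirDeriv (ν : Rn n) (G : Fin n → Rn n → ℝ) (x : Rn n) : ℝ := ∑ l, ν l * G l x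

/-- The gradient of the extension, by differentiation under the integral sign. -/
noncomputable def gradExt (S : Set (Rn n)) (ν : Rn n) (g : Rn n → ℝ) (ψ : ℝ → ℝ)
    (G : Fin n → Rn n → ℝ) (j : Fin n) : Rn n → ℝ :=
  glue S (G j) fun x => lineAvg ν g ψ (G j) x +
    fderiv ℝ g x (stdVec j) * lineAvg ν g (fun t => t * ψ t) (dirDeriv ν G) x

theorem sum_smul_stdVec (v : Rn n) : ∑ l, v l • stdVec l = v := by
  ext k
  simp [stdVec, Finset.sum_apply, Pi.single_apply]

theorem clm_apply_eq_sum (A : Rn n →L[ℝ] ℝ) (v : Rn n) : A v = ∑ l, v l * A (stdVec l) := by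
  conv_lhs => rw [← sum_smul_stdVec v]
  simp only [map_sum, map_smul, smul_eq_mul]

section

variable {S : Set (Rn n)} {ν : Rn n} {L : ℝ} {ht : Rn n → ℝ} {τ c β : ℝ} {g : Rn n → ℝ}
  {ψ : ℝ → ℝ} {A₀ A₁ : ℝ}

theorem glue_ae_eq (hS : IsSpecial S ν L ht) {f f' h h' : Rn n → ℝ}
    (h1 : f =ᵐ[volume.restrict S] f') (h2 : h =ᵐ[volume.restrict (closure S)ᶜ] h') :
    glue S f h =ᵐ[volume] glue S f' h' := by
  have h3 : f =ᵐ[volume.restrict (closure S)] f' := by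
    rwa [Measure.restrict_congr_set hS.closure_ae_eq]
  rw [Filter.EventuallyEq, ae_restrict_iff' isClosed_closure.measurableSet] at h3
  rw [Filter.EventuallyEq, ae_restrict_iff' isClosed_closure.measurableSet.compl] at h2
  filter_upwards [h2, h3] with x h2 h3
  by_cases hx : x ∈ closure S
  · simp only [glue, if_pos hx, h3 hx]
  · simp only [glue, if_neg hx, h2 hx]

theorem aestronglyMeasurable_glue (hS : IsSpecial S ν L ht) {f h : Rn n → ℝ}
    (hf : AEStronglyMeasurable f (volume.restrict S))
    (hh : AEStronglyMeasurable h (volume.restrict (closure S)ᶜ)) :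
    AEStronglyMeasurable (glue S f h) volume := by
  classical
  rw [← Measure.restrict_congr_set hS.closure_ae_eq] at hf
  have e : glue S f h = (closure S).piecewise f h := by
    funext x
    by_cases hx : x ∈ closure S <;> simp [glue, hx]
  rw [e]
  exact hf.piecewise isClosed_closure.measurableSet hh

theorem normLq_glue_rpow (hS : IsSpecial S ν L ht) (hq : 0 < q) (f h : Rn n → ℝ) :
    normLq univ q (glue S f h) ^ q = normLq S q f ^ q + normLq (closure S)ᶜ q h ^ q := by
  have hm := isClosed_closure (s := S).measurableSet
  rw [normLq_rpow hq, normLq_rpow hq, normLq_rpow hq, Measure.restrict_univ,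
    ← lintegral_add_compl _ hm, ← setLIntegral_congr hS.closure_ae_eq]
  congr 1
  · refine setLIntegral_congr_fun hm fun x hx => ?_
    simp only [glue, if_pos hx]
  · refine setLIntegral_congr_fun hm.compl fun x hx => ?_
    simp only [glue, if_neg hx]

theorem normLq_glue_le (hS : IsSpecial S ν L ht) (hq : 1 < q) (f h : Rn n → ℝ) :
    normLq univ q (glue S f h) ≤ normLq S q f + normLq (closure S)ᶜ q h := by
  have hq0 : 0 < q := by linarith
  rw [← ENNReal.rpow_le_rpow_iff hq0, normLq_glue_rpow hS hq0]
  exact ENNReal.add_rpow_le_rpow_add _ _ hq.le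

theorem aestronglyMeasurable_dirDeriv {Ω : Set (Rn n)} {G : Fin n → Rn n → ℝ}
    (hG : ∀ j, AEStronglyMeasurable (G j) (volume.restrict Ω)) :
    AEStronglyMeasurable (dirDeriv ν G) (volume.restrict Ω) := by
  unfold dirDeriv
  exact Finset.aestronglyMeasurable_fun_sum _ fun l _ => (hG l).const_mul _

theorem memLp_dirDeriv {Ω : Set (Rn n)} {G : Fin n → Rn n → ℝ}
    (hG : ∀ j, MemLp (G j) (ENNReal.ofReal q) (volume.restrict Ω)) :
    MemLp (dirDeriv ν G) (ENNReal.ofReal q) (volume.restrict Ω) := by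
  unfold dirDeriv
  exact memLp_finsetSum _ fun l _ => (hG l).const_mul _

/-- The bound off the closure of `S` for the components of the gradient of the extension. -/
theorem IsShift.normLq_gradExt_compl_le (hS : IsSpecial S ν L ht) (hg : IsShift S ht τ c β g)
    (hτ : 0 < τ) (hq : 1 < q) (hψ : IsWeight ψ A₀ A₁) {G : Fin n → Rn n → ℝ}
    (hG : ∀ j, AEStronglyMeasurable (G j) (volume.restrict S)) (j : Fin n) :
    normLq (closure S)ᶜ q (fun x => lineAvg ν g ψ (G j) x +
      fderiv ℝ g x (stdVec j) * lineAvg ν g (fun t => t * ψ t) (dirDeriv ν G) x) ≤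
      ENNReal.ofReal (A₀ * (c * hardyConst q τ)) * normLq S q (G j) +
      ENNReal.ofReal (β * (A₁ * (c * hardyConst q τ))) * normLq S q (dirDeriv ν G) := by
  have hβ : 0 ≤ β := by
    obtain ⟨x, hx⟩ := hS.compl_closure_nonempty
    exact (abs_nonneg _).trans (hg.fderiv_le x (hS.notMem_closure_iff.1 hx) j)
  have hD := aestronglyMeasurable_dirDeriv (ν := ν) hG
  have m1 := hg.aestronglyMeasurable_lineAvg hS hτ (hG j) hψ.isQuadWeight
  have m2 := hg.aestronglyMeasurable_lineAvg hS hτ hD hψ.isQuadWeight_mul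
  refine (eLpNorm_add_le m1 ((measurable_fderiv_apply_const ℝ g
    (stdVec j)).aestronglyMeasurable.mul m2) (one_le_ofReal hq)).trans ?_
  refine add_le_add (hg.normLq_lineAvg_le hS hτ hq (hG j) hψ.isQuadWeight) ?_
  rw [ENNReal.ofReal_mul hβ, mul_assoc]
  refine le_trans ?_ (mul_le_mul_right (hg.normLq_lineAvg_le hS hτ hq hD hψ.isQuadWeight_mul)
    (ENNReal.ofReal β))
  have e := normLq_const_mul (q := q) β (closure S)ᶜ (lineAvg ν g (fun t => t * ψ t) (dirDeriv ν G))
  rw [abs_of_nonneg hβ] at e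
  rw [← e]
  refine normLq_mono isClosed_closure.measurableSet.compl fun x hx => ?_
  rw [Pi.mul_apply, abs_mul, abs_mul]
  exact mul_le_mul_of_nonneg_right
    ((hg.fderiv_le x (hS.notMem_closure_iff.1 hx) j).trans (le_abs_self β)) (abs_nonneg _)

theorem IsShift.aestronglyMeasurable_gradExt (hS : IsSpecial S ν L ht)
    (hg : IsShift S ht τ c β g) (hτ : 0 < τ) (hψ : IsWeight ψ A₀ A₁) {G : Fin n → Rn n → ℝ}
    (hG : ∀ j, AEStronglyMeasurable (G j) (volume.restrict S)) (j : Fin n) :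
    AEStronglyMeasurable (gradExt S ν g ψ G j) volume :=
  aestronglyMeasurable_glue hS (hG j)
    ((hg.aestronglyMeasurable_lineAvg hS hτ (hG j) hψ.isQuadWeight).add
      ((measurable_fderiv_apply_const ℝ g (stdVec j)).aestronglyMeasurable.mul
        (hg.aestronglyMeasurable_lineAvg hS hτ (aestronglyMeasurable_dirDeriv hG)
          hψ.isQuadWeight_mul)))

theorem IsShift.normLq_gradExt_le (hS : IsSpecial S ν L ht) (hg : IsShift S ht τ c β g)
    (hτ : 0 < τ) (hq : 1 < q) (hψ : IsWeight ψ A₀ A₁) {G : Fin n → Rn n → ℝ}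
    (hG : ∀ j, AEStronglyMeasurable (G j) (volume.restrict S)) (j : Fin n) :
    normLq univ q (gradExt S ν g ψ G j) ≤ normLq S q (G j) +
      (ENNReal.ofReal (A₀ * (c * hardyConst q τ)) * normLq S q (G j) +
      ENNReal.ofReal (β * (A₁ * (c * hardyConst q τ))) * normLq S q (dirDeriv ν G)) :=
  (normLq_glue_le hS hq _ _).trans
    (add_le_add_right (hg.normLq_gradExt_compl_le hS hτ hq hψ hG j) _)

theorem IsShift.memLp_gradExt (hS : IsSpecial S ν L ht) (hg : IsShift S ht τ c β g)
    (hτ : 0 < τ) (hq : 1 < q) (hψ : IsWeight ψ A₀ A₁) {G : Fin n → Rn n → ℝ}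
    (hG : ∀ j, MemLp (G j) (ENNReal.ofReal q) (volume.restrict S)) (j : Fin n) :
    MemLp (gradExt S ν g ψ G j) (ENNReal.ofReal q) (volume.restrict univ) := by
  rw [Measure.restrict_univ]
  refine ⟨hg.aestronglyMeasurable_gradExt hS hτ hψ (fun j => (hG j).aestronglyMeasurable) j, ?_⟩
  have h := hg.normLq_gradExt_le hS hτ hq hψ (fun j => (hG j).aestronglyMeasurable) j
  rw [normLq, Measure.restrict_univ] at h
  refine h.trans_lt ?_
  have h1 : normLq S q (G j) < ⊤ := (hG j).eLpNorm_lt_top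
  have h2 : normLq S q (dirDeriv ν G) < ⊤ := (memLp_dirDeriv hG).eLpNorm_lt_top
  finiteness

theorem IsShift.normLq_extension_le (hS : IsSpecial S ν L ht) (hg : IsShift S ht τ c β g)
    (hτ : 0 < τ) (hq : 1 < q) (hψ : IsWeight ψ A₀ A₁) {u : Rn n → ℝ}
    (hu : AEStronglyMeasurable u (volume.restrict S)) :
    normLq univ q (extension S ν g ψ u) ≤ normLq S q u +
      ENNReal.ofReal (A₀ * (c * hardyConst q τ)) * normLq S q u :=
  (normLq_glue_le hS hq _ _).trans
    (add_le_add_right (hg.normLq_lineAvg_le hS hτ hq hu hψ.isQuadWeight) _)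

theorem IsShift.memLp_extension (hS : IsSpecial S ν L ht) (hg : IsShift S ht τ c β g)
    (hτ : 0 < τ) (hq : 1 < q) (hψ : IsWeight ψ A₀ A₁) {u : Rn n → ℝ}
    (hu : MemLp u (ENNReal.ofReal q) (volume.restrict S)) :
    MemLp (extension S ν g ψ u) (ENNReal.ofReal q) (volume.restrict univ) := by
  rw [Measure.restrict_univ]
  refine ⟨aestronglyMeasurable_glue hS hu.aestronglyMeasurable
    (hg.aestronglyMeasurable_lineAvg hS hτ hu.aestronglyMeasurable hψ.isQuadWeight), ?_⟩
  have h := hg.normLq_extension_le hS hτ hq hψ hu.aestronglyMeasurable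
  rw [normLq, Measure.restrict_univ] at h
  refine h.trans_lt ?_
  have h1 : normLq S q u < ⊤ := hu.eLpNorm_lt_top
  finiteness

theorem IsWeight.integrableOn (hψ : IsWeight ψ A₀ A₁) : IntegrableOn ψ (Ioi 1) := by
  simpa using hψ.integrable 0

theorem IsWeight.integrableOn_mul (hψ : IsWeight ψ A₀ A₁) :
    IntegrableOn (fun t => t * ψ t) (Ioi 1) := by
  simpa using hψ.integrable 1

theorem IsWeight.integrableOn_comp (hψ : IsWeight ψ A₀ A₁) {u : Rn n → ℝ} {K : ℝ≥0}
    (hu : LipschitzWith K u) (x v : Rn n) :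
    IntegrableOn (fun t : ℝ => u (x + t • v) * ψ t) (Ioi 1) := by
  have hc : Continuous u := hu.continuous
  refine Integrable.mono' (g := fun t => |u x| * |ψ t| + K * ‖v‖ * |t * ψ t|)
    ((hψ.integrableOn.abs.const_mul _).add (hψ.integrableOn_mul.abs.const_mul _))
    ((by fun_prop : Continuous fun t : ℝ => u (x + t • v)).aestronglyMeasurable.mul
      hψ.integrableOn.aestronglyMeasurable) (.of_forall fun t => ?_)
  have h1 : |u (x + t • v) - u x| ≤ K * (|t| * ‖v‖) := by
    have := hu.dist_le_mul (x + t • v) x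
    rwa [Real.dist_eq, dist_self_add_left, norm_smul, Real.norm_eq_abs] at this
  rw [norm_mul, Real.norm_eq_abs, Real.norm_eq_abs, abs_mul t]
  have h2 : |u (x + t • v)| ≤ |u x| + K * (|t| * ‖v‖) := by
    have := abs_sub_abs_le_abs_sub (u (x + t • v)) (u x)
    linarith
  calc |u (x + t • v)| * |ψ t| ≤ (|u x| + K * (|t| * ‖v‖)) * |ψ t| := by gcongr
    _ = _ := by ring

/-- Since `∫ ψ = 1`, the formula for the extension off the closure of `S` also holds on it, when the
shift is zero there. -/
theorem IsShift.extension_eq_lineAvg (hg : IsShift S ht τ c β g) (hψ : IsWeight ψ A₀ A₁)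
    (u : Rn n → ℝ) : extension S ν g ψ u = lineAvg ν g ψ u := by
  ext x
  by_cases hx : x ∈ closure S
  · simp only [extension, if_pos hx, lineAvg, hg.eq_zero x hx, mul_zero, zero_smul, add_zero]
    rw [integral_const_mul, hψ.integral_eq_one, mul_one]
  · simp only [extension, if_neg hx, lineAvg]

theorem abs_sub_le_of_lipschitzWith {u : Rn n → ℝ} {K K' : ℝ≥0} (hu : LipschitzWith K u)
    (hg : LipschitzWith K' g) (hν : ‖ν‖ = 1) (x y : Rn n) (t : ℝ) :
    |u (x + (t * g x) • ν) - u (y + (t * g y) • ν)| ≤ K * (1 + |t| * K') * ‖x - y‖ := by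
  have h1 := hu.dist_le_mul (x + (t * g x) • ν) (y + (t * g y) • ν)
  rw [Real.dist_eq, dist_eq_norm] at h1
  refine h1.trans ?_
  rw [mul_assoc]
  gcongr
  have h2 := hg.dist_le_mul x y
  rw [Real.dist_eq, dist_eq_norm] at h2
  calc ‖x + (t * g x) • ν - (y + (t * g y) • ν)‖ = ‖(x - y) + (t * (g x - g y)) • ν‖ := by
        congr 1; module
    _ ≤ ‖x - y‖ + |t| * |g x - g y| := by
        refine (norm_add_le _ _).trans_eq ?_
        rw [norm_smul, hν, mul_one, norm_mul, Real.norm_eq_abs, Real.norm_eq_abs]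
    _ ≤ ‖x - y‖ + |t| * (K' * ‖x - y‖) := by gcongr
    _ = (1 + |t| * K') * ‖x - y‖ := by ring

theorem IsShift.exists_lipschitzWith_extension (hS : IsSpecial S ν L ht)
    (hg : IsShift S ht τ c β g) (hψ : IsWeight ψ A₀ A₁) {u : Rn n → ℝ} {K : ℝ≥0}
    (hu : LipschitzWith K u) : ∃ C, LipschitzWith C (extension S ν g ψ u) := by
  obtain ⟨K', hK'⟩ := hg.lipschitz
  have hi : IntegrableOn (fun t => K * |ψ t| + K * K' * |t * ψ t|) (Ioi 1) :=
    (hψ.integrableOn.abs.const_mul _).add (hψ.integrableOn_mul.abs.const_mul _)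
  set C := ∫ t in Ioi 1, (K * |ψ t| + K * K' * |t * ψ t|)
  have hC : 0 ≤ C := integral_nonneg fun t => by positivity
  refine ⟨C.toNNReal, LipschitzWith.of_dist_le_mul fun x y => ?_⟩
  rw [Real.coe_toNNReal _ hC, Real.dist_eq, dist_eq_norm, hg.extension_eq_lineAvg hψ, lineAvg,
    lineAvg]
  have h1 := hψ.integrableOn_comp hu x (g x • ν)
  have h2 := hψ.integrableOn_comp hu y (g y • ν)
  simp only [smul_smul] at h1 h2
  rw [← integral_sub h1 h2, ← integral_mul_const, ← Real.norm_eq_abs]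
  refine norm_integral_le_of_norm_le (hi.mul_const _) (.of_forall fun t => ?_)
  rw [← sub_mul, norm_mul, Real.norm_eq_abs, Real.norm_eq_abs]
  calc _ ≤ K * (1 + |t| * K') * ‖x - y‖ * |ψ t| := by
        gcongr; exact abs_sub_le_of_lipschitzWith hu hK' hS.norm_dir x y t
    _ = _ := by rw [abs_mul]; ring

theorem IsShift.hasLineDerivAt_extension (hS : IsSpecial S ν L ht)
    (hg : IsShift S ht τ c β g) (hτ : 0 < τ) (hψ : IsWeight ψ A₀ A₁) {u : Rn n → ℝ} {K : ℝ≥0}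
    (hu : LipschitzWith K u) (hud : ContDiff ℝ 1 u) {G : Fin n → Rn n → ℝ}
    (hG : ∀ x ∈ closure S, ∀ j, fderiv ℝ u x (stdVec j) = G j x) {x : Rn n} (hx : ht x < 0)
    (j : Fin n) :
    HasLineDerivAt ℝ (extension S ν g ψ u) (gradExt S ν g ψ G j x) x (stdVec j) := by
  obtain ⟨K', hK'⟩ := hg.lipschitz
  have hgc : Continuous g := hK'.continuous
  have huc : Continuous u := hu.continuous
  have hDc : Continuous (fderiv ℝ u) := hud.continuous_fderiv (by simp)
  set e : Rn n := stdVec j with he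
  set F' : ℝ → ℝ := fun t => fderiv ℝ u (x + (t * g x) • ν) (e + (t * fderiv ℝ g x e) • ν) * ψ t
    with hF'
  have hmain := hasDerivAt_integral_of_dominated_loc_of_lip (μ := volume.restrict (Ioi (1 : ℝ)))
    (F := fun s t => u ((x + s • e) + (t * g (x + s • e)) • ν) * ψ t) (F' := F')
    (x₀ := (0 : ℝ)) (s := univ) (bound := fun t => (K * |ψ t| + K * K' * |t * ψ t|) * ‖e‖)
    Filter.univ_mem
    (.of_forall fun s => ((by fun_prop : Continuous fun t : ℝ =>
      u ((x + s • e) + (t * g (x + s • e)) • ν)).aestronglyMeasurable.mul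
      hψ.integrableOn.aestronglyMeasurable))
    (by
      have := hψ.integrableOn_comp hu x (g x • ν)
      simpa only [smul_smul, zero_smul, add_zero, IntegrableOn] using this)
    ((by fun_prop : Continuous fun t : ℝ => fderiv ℝ u (x + (t * g x) • ν)
        (e + (t * fderiv ℝ g x e) • ν)).aestronglyMeasurable.mul
      hψ.integrableOn.aestronglyMeasurable)
    (.of_forall fun t => by
      rw [lipschitzOnWith_univ]
      refine LipschitzWith.of_dist_le_mul fun s s' => ?_
      rw [Real.coe_nnabs, abs_of_nonneg (by positivity), Real.dist_eq, ← sub_mul, abs_mul,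
        Real.dist_eq]
      have h := abs_sub_le_of_lipschitzWith hu hK' hS.norm_dir (x + s • e) (x + s' • e) t
      have h2 : ‖x + s • e - (x + s' • e)‖ = |s - s'| * ‖e‖ := by
        rw [← Real.norm_eq_abs, ← norm_smul]; congr 1; module
      rw [h2] at h
      calc _ ≤ K * (1 + |t| * K') * (|s - s'| * ‖e‖) * |ψ t| := by gcongr
        _ = _ := by rw [abs_mul]; ring)
    (((hψ.integrableOn.abs.const_mul _).add (hψ.integrableOn_mul.abs.const_mul _)).mul_const _)
    (.of_forall fun t => by
      refine HasDerivAt.mul_const ?_ (ψ t)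
      have hl : HasDerivAt (fun s : ℝ => x + s • e) e 0 := by
        simpa using ((hasDerivAt_id (0 : ℝ)).smul_const e).const_add x
      have hgd : HasDerivAt (fun s : ℝ => g (x + s • e)) (fderiv ℝ g x e) 0 := by
        have h0 : HasFDerivAt g (fderiv ℝ g x) (x + (0 : ℝ) • e) := by
          simpa using (hg.differentiableAt x hx).hasFDerivAt
        exact h0.comp_hasDerivAt 0 hl
      have hin : HasDerivAt (fun s : ℝ => (x + s • e) + (t * g (x + s • e)) • ν)
          (e + (t * fderiv ℝ g x e) • ν) 0 :=
        hl.add ((hgd.const_mul t).smul_const ν)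
      have h1 : HasFDerivAt u (fderiv ℝ u (x + (t * g x) • ν))
          ((x + (0 : ℝ) • e) + (t * g (x + (0 : ℝ) • e)) • ν) := by
        simpa using ((hud.differentiable (by simp)) (x + (t * g x) • ν)).hasFDerivAt
      exact h1.comp_hasDerivAt 0 hin)
  have hval : ∫ t in Ioi 1, F' t = gradExt S ν g ψ G j x := by
    have hmem : ∀ t ∈ Ioi (1 : ℝ), x + (t * g x) • ν ∈ closure S := fun t h1 =>
      subset_closure (hg.add_mem hS hτ hx (le_of_lt h1))
    have hbd : ∀ (v : Rn n) (w : ℝ → ℝ), IntegrableOn w (Ioi 1) →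
        IntegrableOn (fun t => fderiv ℝ u (x + (t * g x) • ν) v * w t) (Ioi 1) := by
      intro v w hw
      refine Integrable.bdd_mul (c := K * ‖v‖) hw
        (by fun_prop : Continuous fun t : ℝ =>
          fderiv ℝ u (x + (t * g x) • ν) v).aestronglyMeasurable (.of_forall fun t => ?_)
      refine ((fderiv ℝ u _).le_opNorm v).trans ?_
      gcongr
      exact norm_fderiv_le_of_lipschitz ℝ hu
    have e1 : lineAvg ν g ψ (G j) x = ∫ t in Ioi 1, fderiv ℝ u (x + (t * g x) • ν) e * ψ t :=
      setIntegral_congr_fun measurableSet_Ioi fun t h1 => by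
        simp only [he, hG _ (hmem t h1)]
    have e2 : lineAvg ν g (fun t => t * ψ t) (dirDeriv ν G) x =
        ∫ t in Ioi 1, fderiv ℝ u (x + (t * g x) • ν) ν * (t * ψ t) :=
      setIntegral_congr_fun measurableSet_Ioi fun t h1 => by
        simp only [dirDeriv, clm_apply_eq_sum (fderiv ℝ u (x + (t * g x) • ν)) ν,
          hG _ (hmem t h1)]
    have hnot : x ∉ closure S := hS.notMem_closure_iff.2 hx
    rw [gradExt, glue, if_neg hnot, e1, e2, ← integral_const_mul, ← integral_add
      (hbd e ψ hψ.integrableOn) ((hbd ν _ hψ.integrableOn_mul).const_mul _)]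
    congr 1 with t
    simp only [hF', map_add, map_smul, smul_eq_mul, ← he]
    ring
  rw [hg.extension_eq_lineAvg hψ, ← hval]
  exact hmain.2

/-- For smooth Lipschitz `u` the extension is Lipschitz, and its derivatives exist off the boundary
of `S`, which is a null set. -/
theorem IsShift.hasWeakGradient_extension_of_smooth (hS : IsSpecial S ν L ht)
    (hg : IsShift S ht τ c β g) (hτ : 0 < τ) (hψ : IsWeight ψ A₀ A₁) {u : Rn n → ℝ} {K : ℝ≥0}
    (hu : LipschitzWith K u) (hud : ContDiff ℝ 1 u) {G : Fin n → Rn n → ℝ}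
    (hG : ∀ x ∈ closure S, ∀ j, fderiv ℝ u x (stdVec j) = G j x) :
    HasWeakGradient univ (extension S ν g ψ u) (gradExt S ν g ψ G) := by
  obtain ⟨C, hC⟩ := hg.exists_lipschitzWith_extension hS hψ hu
  refine hasWeakGradient_of_lipschitzWith hC fun j => ?_
  have hnull : ∀ᵐ x, x ∉ closure S \ S := measure_eq_zero_iff_ae_notMem.1 hS.closure_diff_null
  filter_upwards [hnull] with x hx
  by_cases hxc : x ∈ closure S
  · have hxS : x ∈ S := by by_contra h; exact hx ⟨hxc, h⟩
    have h1 : HasLineDerivAt ℝ u (gradExt S ν g ψ G j x) x (stdVec j) := by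
      rw [gradExt, glue, if_pos hxc, ← hG x hxc j]
      exact ((hud.differentiable (by simp)) x).hasFDerivAt.hasLineDerivAt _
    refine h1.congr_of_eventuallyEq ?_
    filter_upwards [hS.isOpen.mem_nhds hxS] with y hy
    simp only [extension, if_pos (subset_closure hy)]
  · exact hg.hasLineDerivAt_extension hS hτ hψ hu hud hG (hS.notMem_closure_iff.1 hxc) j

/-- Mollifiers that are supported so far below the origin that they only see the interior of `S`
from points of its closure. -/
theorem IsSpecial.exists_mollifiers (hS : IsSpecial S ν L ht) :
    ∃ (w : ℕ → Rn n → ℝ) (r : ℕ → ℝ), (∀ k, ContDiff ℝ ∞ (w k)) ∧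
      (∀ k, HasCompactSupport (w k)) ∧ (∀ k t, 0 ≤ w k t) ∧ (∀ k, ∫ t, w k t = 1) ∧
      Filter.Tendsto r Filter.atTop (nhds 0) ∧ (∀ k t, w k t ≠ 0 → ‖t‖ ≤ r k) ∧
      ∀ k, ∀ x ∈ closure S, tsupport (fun t => w k (x - t)) ⊆ S := by
  have hL : 0 < L := zero_lt_one.trans_le hS.one_le
  set δ : ℕ → ℝ := fun k => 1 / ((k : ℝ) + 1) with hδ
  have hδ0 : ∀ k, 0 < δ k := fun k => by positivity
  let B : ∀ k, ContDiffBump (-(δ k • ν)) := fun k =>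
    ⟨δ k / (4 * L), δ k / (2 * L), by have := hδ0 k; positivity, by
      have := hδ0 k
      gcongr
      norm_num⟩
  have hts : ∀ k, tsupport ((B k).normed volume) = closedBall (-(δ k • ν)) (δ k / (2 * L)) :=
    fun k => (B k).tsupport_normed_eq
  refine ⟨fun k => (B k).normed volume, fun k => δ k + δ k / (2 * L), fun k => (B k).contDiff_normed,
    fun k => (B k).hasCompactSupport_normed, fun k t => (B k).nonneg_normed t,
    fun k => (B k).integral_normed, ?_, ?_, ?_⟩
  · have h : Filter.Tendsto δ Filter.atTop (nhds 0) := tendsto_one_div_add_atTop_nhds_zero_nat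
    simpa using h.add (h.div_const (2 * L))
  · intro k t hkt
    have h1 : t ∈ closedBall (-(δ k • ν)) (δ k / (2 * L)) := by
      rw [← hts k]; exact subset_tsupport _ hkt
    rw [mem_closedBall, dist_eq_norm] at h1
    calc ‖t‖ = ‖-(δ k • ν) + (t - -(δ k • ν))‖ := by congr 1; abel
      _ ≤ ‖-(δ k • ν)‖ + ‖t - -(δ k • ν)‖ := norm_add_le _ _
      _ ≤ δ k + δ k / (2 * L) := by
        rw [norm_neg, norm_smul, hS.norm_dir, mul_one, Real.norm_of_nonneg (hδ0 k).le]
        gcongr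
  · intro k x hx
    have hsub : tsupport (fun t => (B k).normed volume (x - t)) ⊆
        (fun t => x - t) ⁻¹' closedBall (-(δ k • ν)) (δ k / (2 * L)) := by
      refine closure_minimal (fun t ht' => ?_)
        (isClosed_closedBall.preimage (continuous_const.sub continuous_id))
      rw [mem_preimage, ← hts k]
      exact subset_tsupport _ ht'
    intro t ht'
    have h1 := hsub ht'
    rw [mem_preimage, mem_closedBall, dist_eq_norm] at h1
    rw [hS.mem_iff]
    have h2 := hS.abs_sub_le (x + δ k • ν) t
    rw [hS.ht_add] at h2
    have h3 : ‖x + δ k • ν - t‖ ≤ δ k / (2 * L) := by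
      rwa [show x + δ k • ν - t = x - t - -(δ k • ν) by abel]
    have h4 : L * ‖x + δ k • ν - t‖ ≤ δ k / 2 := by
      calc _ ≤ L * (δ k / (2 * L)) := by gcongr
        _ = δ k / 2 := by field_simp
    have h5 := hS.mem_closure_iff.1 hx
    have h6 := le_abs_self (ht x + δ k - ht t)
    have := hδ0 k
    linarith

/-- The extension operator maps `W^{1,q}(S)` to `W^{1,q}(ℝⁿ)`. -/
theorem IsShift.memW1_extension (hS : IsSpecial S ν L ht) (hg : IsShift S ht τ c β g)
    (hτ : 0 < τ) (hq : 1 < q) (hψ : IsWeight ψ A₀ A₁) {u : Rn n → ℝ} {G : Fin n → Rn n → ℝ}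
    (hu : MemW1 S q u G) : MemW1 univ q (extension S ν g ψ u) (gradExt S ν g ψ G) := by
  have hSm := hS.isOpen.measurableSet
  obtain ⟨w, r, hw, hwc, hw0, hw1, hr, hwr, hwS⟩ := hS.exists_mollifiers
  have huL : MemLp (S.indicator u) (ENNReal.ofReal q) :=
    (memLp_indicator_iff_restrict hSm).2 hu.memLp
  have hGL : ∀ j, MemLp (S.indicator (G j)) (ENNReal.ofReal q) := fun j =>
    (memLp_indicator_iff_restrict hSm).2 (hu.memLp_grad j)
  set U : ℕ → Rn n → ℝ := fun k => mollify (S.indicator u) (w k) with hU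
  set V : ℕ → Fin n → Rn n → ℝ := fun k j => mollify (S.indicator (G j)) (w k) with hV
  -- mollification converges in `L^q(S)`
  have hconv : ∀ f : Rn n → ℝ, MemLp (S.indicator f) (ENNReal.ofReal q) →
      Filter.Tendsto (fun k => normLq S q (mollify (S.indicator f) (w k) - f))
        Filter.atTop (nhds 0) := by
    intro f hf
    refine tendsto_of_tendsto_of_tendsto_of_le_of_le tendsto_const_nhds
      (tendsto_eLpNorm_mollify_sub hq hf (fun k => (hw k).continuous) hwc hw0 hw1 hr hwr)
      (fun _ => zero_le) fun k => ?_
    have hle : eLpNorm (mollify (S.indicator f) (w k) - S.indicator f) (ENNReal.ofReal q)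
        (volume.restrict S) ≤ _ := eLpNorm_mono_measure _ Measure.restrict_le_self
    refine le_trans (le_of_eq ?_) hle
    refine eLpNorm_congr_ae ((ae_restrict_iff' hSm).2 (.of_forall fun x hx => ?_))
    simp [hx]
  have hmem : ∀ f : Rn n → ℝ, MemLp (S.indicator f) (ENNReal.ofReal q) → ∀ k,
      MemLp (mollify (S.indicator f) (w k)) (ENNReal.ofReal q) (volume.restrict S) := by
    intro f hf k
    have hcont := (contDiff_mollify (hf.locallyIntegrable (one_le_ofReal hq)) (hw k)
      (hwc k)).continuous
    have hb : eLpNorm (mollify (S.indicator f) (w k) - S.indicator f) (ENNReal.ofReal q) volume ≤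
        eLpNorm (S.indicator f) (ENNReal.ofReal q) volume +
          eLpNorm (S.indicator f) (ENNReal.ofReal q) volume := by
      refine eLpNorm_mollify_sub_le hq hf (hw k).continuous (hwc k) (hw0 k) (hw1 k) fun t _ => ?_
      have hmp := measurePreserving_sub_right volume t
      refine (eLpNorm_sub_le (hf.aestronglyMeasurable.comp_measurePreserving hmp)
        hf.aestronglyMeasurable (one_le_ofReal hq)).trans_eq ?_
      congr 1
      exact eLpNorm_comp_measurePreserving hf.aestronglyMeasurable hmp
    have h1 : MemLp (mollify (S.indicator f) (w k) - S.indicator f) (ENNReal.ofReal q) volume :=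
      ⟨hcont.aestronglyMeasurable.sub hf.aestronglyMeasurable,
        hb.trans_lt (ENNReal.add_lt_top.2 ⟨hf.eLpNorm_lt_top, hf.eLpNorm_lt_top⟩)⟩
    have h2 := h1.add hf
    rw [sub_add_cancel] at h2
    exact h2.restrict S
  have hUm := hmem u huL
  have hVm : ∀ k j, MemLp (V k j) (ENNReal.ofReal q) (volume.restrict S) :=
    fun k j => hmem (G j) (hGL j) k
  have hk : ∀ k, MemW1 univ q (extension S ν g ψ (U k)) (gradExt S ν g ψ (V k)) := by
    intro k
    obtain ⟨K, hK⟩ := exists_lipschitzWith_mollify hq huL (hw k) (hwc k)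
    have hsm := contDiff_mollify (huL.locallyIntegrable (one_le_ofReal hq)) (hw k) (hwc k)
    exact ⟨hg.memLp_extension hS hτ hq hψ (hUm k), hg.memLp_gradExt hS hτ hq hψ (hVm k),
      hg.hasWeakGradient_extension_of_smooth hS hτ hψ hK (hsm.of_le (by simp))
        fun x hx j => fderiv_mollify_indicator hq hSm hu (hw k) (hwc k) (hwS k x hx) j⟩
  have hEu := hg.memLp_extension hS hτ hq hψ hu.memLp
  have hEG := hg.memLp_gradExt hS hτ hq hψ hu.memLp_grad
  refine ⟨hEu, hEG, HasWeakGradient.of_tendsto hq hEu hEG hk ?_ fun j => ?_⟩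
  · have hle : ∀ k, normLq univ q (extension S ν g ψ (U k) - extension S ν g ψ u) ≤
        normLq S q (U k - u) + ENNReal.ofReal (A₀ * (c * hardyConst q τ)) *
          normLq S q (U k - u) := by
      intro k
      refine le_trans (le_of_eq ?_) (hg.normLq_extension_le hS hτ hq hψ
        ((hUm k).sub hu.memLp).aestronglyMeasurable)
      rw [normLq, normLq, Measure.restrict_univ]
      refine eLpNorm_congr_ae ?_
      have e : extension S ν g ψ (U k) - extension S ν g ψ u =
          glue S (U k - u) (lineAvg ν g ψ (U k) - lineAvg ν g ψ u) := by
        funext x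
        by_cases hx : x ∈ closure S <;> simp [extension, glue, hx, lineAvg]
      rw [e, extension_eq_glue]
      exact glue_ae_eq hS (ae_eq_refl _)
        (hg.lineAvg_sub_ae_eq hS hτ hq (hUm k) hu.memLp hψ.isQuadWeight)
    refine tendsto_of_tendsto_of_tendsto_of_le_of_le tendsto_const_nhds ?_ (fun _ => zero_le) hle
    have h := hconv u huL
    simpa using h.add (ENNReal.Tendsto.const_mul h (Or.inr ENNReal.ofReal_ne_top))
  · have hDm := memLp_dirDeriv (ν := ν) hu.memLp_grad
    have hDsub : ∀ k, dirDeriv ν (V k) - dirDeriv ν G = dirDeriv ν fun j => V k j - G j := by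
      intro k
      funext x
      simp [dirDeriv, mul_sub]
    have hle : ∀ k, normLq univ q (gradExt S ν g ψ (V k) j - gradExt S ν g ψ G j) ≤
        normLq S q (V k j - G j) + (ENNReal.ofReal (A₀ * (c * hardyConst q τ)) *
          normLq S q (V k j - G j) + ENNReal.ofReal (β * (A₁ * (c * hardyConst q τ))) *
          ∑ l, ENNReal.ofReal |ν l| * normLq S q (V k l - G l)) := by
      intro k
      have hbd := hg.normLq_gradExt_le hS hτ hq hψ (G := fun j => V k j - G j)
        (fun j => ((hVm k j).sub (hu.memLp_grad j)).aestronglyMeasurable) j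
      have hD : normLq S q (dirDeriv ν fun j => V k j - G j) ≤
          ∑ l, ENNReal.ofReal |ν l| * normLq S q (V k l - G l) := by
        simp only [← normLq_const_mul]
        have := eLpNorm_sum_le (s := Finset.univ) (μ := volume.restrict S)
          (f := fun l x => ν l * (V k l - G l) x) (fun l _ =>
          (((hVm k l).sub (hu.memLp_grad l)).aestronglyMeasurable.const_mul (ν l)))
          (one_le_ofReal hq)
        refine le_trans (le_of_eq ?_) this
        rw [normLq]
        congr 1 with x
        simp [dirDeriv]
      refine le_trans (le_of_eq ?_) (hbd.trans (by gcongr))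
      rw [normLq, normLq, Measure.restrict_univ]
      refine eLpNorm_congr_ae ?_
      have e : gradExt S ν g ψ (V k) j - gradExt S ν g ψ G j =
          glue S (V k j - G j) fun x => (lineAvg ν g ψ (V k j) x - lineAvg ν g ψ (G j) x) +
            fderiv ℝ g x (stdVec j) * (lineAvg ν g (fun t => t * ψ t) (dirDeriv ν (V k)) x -
              lineAvg ν g (fun t => t * ψ t) (dirDeriv ν G) x) := by
        funext x
        by_cases hx : x ∈ closure S
        · simp [gradExt, glue, hx]
        · simp only [gradExt, glue, Pi.sub_apply, if_neg hx]; ring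
      rw [e]
      refine glue_ae_eq hS (ae_eq_refl _) ?_
      filter_upwards [hg.lineAvg_sub_ae_eq hS hτ hq (hVm k j) (hu.memLp_grad j) hψ.isQuadWeight,
        hg.lineAvg_sub_ae_eq hS hτ hq (memLp_dirDeriv (ν := ν) (hVm k)) hDm
          hψ.isQuadWeight_mul] with x h1 h2
      rw [h1, h2, hDsub]
    refine tendsto_of_tendsto_of_tendsto_of_le_of_le tendsto_const_nhds ?_ (fun _ => zero_le) hle
    have h := fun l => hconv (G l) (hGL l)
    have hsum : Filter.Tendsto (fun k => ∑ l, ENNReal.ofReal |ν l| * normLq S q (V k l - G l))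
        Filter.atTop (nhds (∑ l : Fin n, ENNReal.ofReal |ν l| * 0)) :=
      tendsto_finsetSum _ fun l _ => ENNReal.Tendsto.const_mul (h l) (Or.inr ENNReal.ofReal_ne_top)
    simpa using (h j).add ((ENNReal.Tendsto.const_mul (h j) (Or.inr ENNReal.ofReal_ne_top)).add
      (ENNReal.Tendsto.const_mul hsum (Or.inr ENNReal.ofReal_ne_top)))

end

/-! ### Regularized distances and the explicit bounds -/

theorem IsRegularizedDistance.abs_fderiv_le {S : Set (Rn n)} {ξ : ℝ} {P : (Fin n → ℕ) → ℝ}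
    {RD : Rn n → ℝ} (h : IsRegularizedDistance S ξ P RD) {x : Rn n} (hx : x ∈ Sᶜ) (j : Fin n) :
    |fderiv ℝ RD x (stdVec j)| ≤ P (Pi.single j 1) := by
  have h1 := h.deriv_le x hx 1 le_rfl fun _ => j
  have e : (fun m => (Finset.univ.filter fun _ : Fin 1 => j = m).card) = Pi.single j 1 := by
    funext m
    by_cases hm : j = m
    · subst hm; simp
    · rw [Pi.single_eq_of_ne (Ne.symm hm)]; simp [hm]
  rw [e] at h1
  simpa [iteratedFDeriv_one_apply] using h1

/-- A nonnegative function which vanishes on the closed set `C`, is at most a multiple of the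
distance to `C`, and has bounded derivative off `C`, is Lipschitz. -/
theorem exists_lipschitzWith_of_le_infDist {C : Set (Rn n)} {g : Rn n → ℝ}
    {a b : ℝ} (hb : 0 ≤ b) (h0 : ∀ x, 0 ≤ g x) (hle : ∀ x, g x ≤ a * infDist x C) (ha : 0 ≤ a)
    (hd : ∀ x ∉ C, DifferentiableAt ℝ g x) (hD : ∀ x ∉ C, ‖fderiv ℝ g x‖ ≤ b) :
    ∃ K, LipschitzWith K g := by
  refine ⟨(a + b).toNNReal, LipschitzWith.of_dist_le_mul fun x y => ?_⟩
  rw [Real.coe_toNNReal _ (by positivity), Real.dist_eq, add_mul]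
  have hpa : 0 ≤ a * dist x y := by positivity
  have hpb : 0 ≤ b * dist x y := by positivity
  by_cases hz : ∃ z ∈ segment ℝ x y, z ∈ C
  · obtain ⟨z, hzs, hzC⟩ := hz
    have hsum := dist_add_dist_of_mem_segment hzs
    have h1 : g x ≤ a * dist x y := (hle x).trans (by
      gcongr
      exact (infDist_le_dist_of_mem hzC).trans (by linarith [dist_nonneg (x := z) (y := y)]))
    have h2 : g y ≤ a * dist x y := (hle y).trans (by
      gcongr
      refine (infDist_le_dist_of_mem hzC).trans ?_
      rw [dist_comm y z]
      linarith [dist_nonneg (x := x) (y := z)])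
    rw [abs_le]
    constructor <;> linarith [h0 x, h0 y]
  · push Not at hz
    have h := (convex_segment x y).norm_image_sub_le_of_norm_fderiv_le (𝕜 := ℝ)
      (fun z hzs => hd z (hz z hzs)) (fun z hzs => hD z (hz z hzs)) (right_mem_segment ℝ x y)
      (left_mem_segment ℝ x y)
    rw [Real.norm_eq_abs, ← dist_eq_norm] at h
    linarith

theorem norm_clm_le_of_abs_le {A : Rn n →L[ℝ] ℝ} {b : ℝ} (h : ∀ j, |A (stdVec j)| ≤ b)
    (hb : 0 ≤ b) : ‖A‖ ≤ n * b := by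
  refine ContinuousLinearMap.opNorm_le_bound _ (by positivity) fun v => ?_
  rw [clm_apply_eq_sum]
  calc ‖∑ l, v l * A (stdVec l)‖ ≤ ∑ l : Fin n, ‖v‖ * b := by
        refine (norm_sum_le _ _).trans (Finset.sum_le_sum fun l _ => ?_)
        rw [norm_mul]
        gcongr
        · exact PiLp.norm_apply_le v l
        · exact h l
    _ = n * b * ‖v‖ := by simp; ring

/-- The factor of the extension operator, extended by zero, is an admissible shift. -/
theorem IsRegularizedDistance.isShift {S : Set (Rn n)} {ν : Rn n} {M : ℝ} {ht : Rn n → ℝ}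
    (hS : IsSpecial S ν (√(1 + M ^ 2)) ht) {τ ξ : ℝ} (hτ : 0 < τ) (hξ : ξ ∈ Ioo (0 : ℝ) 1)
    {P : (Fin n → ℕ) → ℝ} {RD : Rn n → ℝ} (h : IsRegularizedDistance (closure S) ξ P RD) {P₁ : ℝ}
    (hP : ∀ j, P (Pi.single j 1) ≤ P₁) :
    IsShift S ht τ ((1 + τ) * (1 + ξ) ^ 2 * √(1 + M ^ 2) / (1 - ξ) ^ 2)
      ((1 + τ) * (1 + ξ) ^ 2 * √(1 + M ^ 2) * P₁)
      ((closure S)ᶜ.indicator (gStar τ ξ M RD)) := by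
  set a := (1 + τ) * (1 + ξ) ^ 2 * √(1 + M ^ 2) with ha
  have hL := hS.one_le
  have hξ0 := hξ.1
  have hξ1 : 0 < 1 - ξ := by linarith [hξ.2]
  have ha0 : 0 < a := by positivity
  have hOpen : IsOpen (closure S)ᶜ := isClosed_closure.isOpen_compl
  have hgs : ∀ x, gStar τ ξ M RD x = a * RD x := fun x => by rw [gStar, ha]; ring
  have hgd : ∀ x ∈ (closure S)ᶜ, HasFDerivAt ((closure S)ᶜ.indicator (gStar τ ξ M RD))
      (a • fderiv ℝ RD x) x := by
    intro x hx
    have h1 : HasFDerivAt RD (fderiv ℝ RD x) x :=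
      ((h.contDiffOn.contDiffAt (hOpen.mem_nhds hx)).differentiableAt (by simp)).hasFDerivAt
    refine (h1.const_mul a).congr_of_eventuallyEq ?_
    filter_upwards [hOpen.mem_nhds hx] with y hy
    rw [indicator_of_mem hy, hgs]
  have hgb : ∀ x ∈ (closure S)ᶜ, ∀ j,
      |fderiv ℝ ((closure S)ᶜ.indicator (gStar τ ξ M RD)) x (stdVec j)| ≤ a * P₁ := by
    intro x hx j
    rw [(hgd x hx).fderiv]
    simp only [smul_apply, smul_eq_mul]
    rw [abs_mul, abs_of_pos ha0]
    gcongr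
    exact (h.abs_fderiv_le hx j).trans (hP j)
  have hup : ∀ x ∈ (closure S)ᶜ, gStar τ ξ M RD x ≤ a / (1 - ξ) ^ 2 * infDist x (closure S) := by
    intro x hx
    rw [hgs]
    calc a * RD x ≤ a * (((1 - ξ) ^ 2)⁻¹ * infDist x (closure S)) := by
          gcongr; exact h.upper x hx
      _ = _ := by ring
  have hlow : ∀ x ∈ (closure S)ᶜ, (1 + τ) * √(1 + M ^ 2) * infDist x (closure S) ≤
      gStar τ ξ M RD x := by
    intro x hx
    rw [hgs]
    calc _ = a * (((1 + ξ) ^ 2)⁻¹ * infDist x (closure S)) := by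
          rw [ha]; field_simp
      _ ≤ a * RD x := by gcongr; exact h.lower x hx
  refine ⟨?_, ?_, ?_, ?_, ?_, ?_⟩
  · have hbn : 0 ≤ max (a * P₁) 0 := le_max_right _ _
    refine exists_lipschitzWith_of_le_infDist (C := closure S) (a := a / (1 - ξ) ^ 2)
      (b := n * max (a * P₁) 0) (by positivity) ?_ ?_ (by positivity)
      (fun x hx => (hgd x hx).differentiableAt) ?_
    · intro x
      refine indicator_nonneg (fun x hx => le_trans ?_ (hlow x hx)) x
      have := infDist_nonneg (x := x) (s := closure S)
      positivity
    · intro x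
      by_cases hx : x ∈ (closure S)ᶜ
      · rw [indicator_of_mem hx]; exact hup x hx
      · rw [indicator_of_notMem hx]
        have := infDist_nonneg (x := x) (s := closure S)
        positivity
    · intro x hx
      exact norm_clm_le_of_abs_le (fun j => (hgb x hx j).trans (le_max_left _ _)) hbn
  · intro x hx
    exact indicator_of_notMem (not_not.2 hx) _
  · intro x hx
    have hx' := hS.notMem_closure_iff.2 hx
    rw [indicator_of_mem hx']
    refine le_trans ?_ (hlow x hx')
    rw [mul_assoc]
    gcongr
    exact hS.neg_le_mul_infDist x
  · intro x hx
    have hx' := hS.notMem_closure_iff.2 hx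
    rw [indicator_of_mem hx']
    refine (hup x hx').trans ?_
    gcongr
    exact hS.infDist_le_neg hx
  · intro x hx
    exact (hgd x (hS.notMem_closure_iff.2 hx)).differentiableAt
  · intro x hx j
    exact hgb x (hS.notMem_closure_iff.2 hx) j

theorem extension_indicator (S : Set (Rn n)) (ν : Rn n) (g : Rn n → ℝ) (ψ : ℝ → ℝ) (u : Rn n → ℝ) :
    extension S ν ((closure S)ᶜ.indicator g) ψ u = extension S ν g ψ u := by
  funext x
  by_cases hx : x ∈ closure S
  · simp only [extension, if_pos hx]
  · simp only [extension, if_neg hx, indicator_of_mem (show x ∈ (closure S)ᶜ from hx)]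

theorem mul_hardyConst_eq_constQ (q τ ξ M : ℝ) :
    (1 + τ) * (1 + ξ) ^ 2 * √(1 + M ^ 2) / (1 - ξ) ^ 2 * hardyConst q τ = constQ q τ ξ M := by
  rw [hardyConst, constQ, div_mul_div_comm, div_mul_eq_mul_div]
  congr 1 <;> ring

theorem constQ_nonneg {q τ ξ : ℝ} (hq : 0 < q) (hτ : 0 < τ) (hξ : ξ ∈ Ioo (0 : ℝ) 1) (M : ℝ) :
    0 ≤ constQ q τ ξ M := by
  have := hξ.1
  rw [constQ]; positivity

theorem le_of_ennreal_rpow_le {a b : ℝ≥0∞} (hq : 0 < q) (h : a ^ q ≤ b ^ q) : a ≤ b :=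
  (ENNReal.rpow_le_rpow_iff hq).1 h

section

variable {S : Set (Rn n)} {ν : Rn n} {L : ℝ} {ht : Rn n → ℝ} {τ c β : ℝ} {g : Rn n → ℝ}
  {ψ : ℝ → ℝ} {A₀ A₁ : ℝ}

theorem IsShift.normLq_extension_le_specialA (hS : IsSpecial S ν L ht) (hg : IsShift S ht τ c β g)
    (hτ : 0 < τ) (hq : 1 < q) (hψ : IsWeight ψ A₀ A₁) {u : Rn n → ℝ}
    (hu : AEStronglyMeasurable u (volume.restrict S)) {Q : ℝ} (hQ : c * hardyConst q τ = Q)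
    (hQ0 : 0 ≤ Q) :
    normLq univ q (extension S ν g ψ u) ≤
      ENNReal.ofReal (((A₀ * Q) ^ q + 1) ^ (1 / q)) * normLq S q u := by
  have hq0 : 0 < q := by linarith
  have hX : 0 ≤ A₀ * Q := mul_nonneg hψ.isQuadWeight.nonneg hQ0
  have h := hg.normLq_lineAvg_le hS hτ hq hu hψ.isQuadWeight
  rw [hQ] at h
  refine le_of_ennreal_rpow_le hq0 ?_
  rw [extension_eq_glue, normLq_glue_rpow hS hq0, ENNReal.mul_rpow_of_nonneg _ _ hq0.le,
    ENNReal.ofReal_rpow_of_nonneg (by positivity) hq0.le, ← Real.rpow_mul (by positivity),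
    one_div_mul_cancel hq0.ne', Real.rpow_one, ENNReal.ofReal_add (by positivity) zero_le_one,
    ENNReal.ofReal_one, add_mul, one_mul, add_comm, ← ENNReal.ofReal_rpow_of_nonneg hX hq0.le,
    ← ENNReal.mul_rpow_of_nonneg _ _ hq0.le]
  gcongr

/-- The inequality between power sums behind the explicit bound for the gradient. -/
theorem sum_rpow_le (hq : 1 < q) (a : Fin n → ℝ≥0∞) (k : Fin n) {X Y K : ℝ≥0∞}
    (h1 : (2 : ℝ≥0∞) ^ (q - 1) * X ^ q + 1 ≤ K)
    (h2 : ((n - 1 : ℕ) : ℝ≥0∞) * (2 ^ (q - 1) * Y ^ q) + (X + Y) ^ q + 1 ≤ K) :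
    ∑ j, (a j ^ q + (X * a j + Y * a k) ^ q) ≤ K * ∑ j, a j ^ q := by
  have hq0 : 0 < q := by linarith
  rw [← Finset.add_sum_erase _ _ (Finset.mem_univ k),
    ← Finset.add_sum_erase _ (fun j => a j ^ q) (Finset.mem_univ k)]
  have hk : (X * a k + Y * a k) ^ q = (X + Y) ^ q * a k ^ q := by
    rw [← add_mul, ENNReal.mul_rpow_of_nonneg _ _ hq0.le]
  have hj : ∀ j, a j ^ q + (X * a j + Y * a k) ^ q ≤
      (2 ^ (q - 1) * X ^ q + 1) * a j ^ q + 2 ^ (q - 1) * Y ^ q * a k ^ q := by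
    intro j
    have := ENNReal.rpow_add_le_mul_rpow_add_rpow (X * a j) (Y * a k) hq.le
    rw [ENNReal.mul_rpow_of_nonneg _ _ hq0.le, ENNReal.mul_rpow_of_nonneg _ _ hq0.le] at this
    calc _ ≤ a j ^ q + 2 ^ (q - 1) * (X ^ q * a j ^ q + Y ^ q * a k ^ q) := by gcongr
      _ = _ := by ring
  calc _ ≤ a k ^ q + (X + Y) ^ q * a k ^ q + ∑ j ∈ Finset.univ.erase k,
        ((2 ^ (q - 1) * X ^ q + 1) * a j ^ q + 2 ^ (q - 1) * Y ^ q * a k ^ q) := by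
        rw [hk]; exact add_le_add le_rfl (Finset.sum_le_sum fun j _ => hj j)
    _ = (((n - 1 : ℕ) : ℝ≥0∞) * (2 ^ (q - 1) * Y ^ q) + (X + Y) ^ q + 1) * a k ^ q +
        (2 ^ (q - 1) * X ^ q + 1) * ∑ j ∈ Finset.univ.erase k, a j ^ q := by
        rw [Finset.sum_add_distrib, ← Finset.mul_sum, Finset.sum_const,
          Finset.card_erase_of_mem (Finset.mem_univ k), Finset.card_univ, Fintype.card_fin,
          nsmul_eq_mul]
        ring
    _ ≤ K * a k ^ q + K * ∑ j ∈ Finset.univ.erase k, a j ^ q := by gcongr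
    _ = _ := by ring

/-- When `ν` is a signed basis vector `± e_k`, the directional derivative in the components of the
gradient is a single partial derivative. The `k`-th component then differs from the others, whence the
two kinds of terms in the bound. -/
theorem IsShift.normGrad_gradExt_le (hS : IsSpecial S ν L ht) (hg : IsShift S ht τ c β g)
    (hτ : 0 < τ) (hq : 1 < q) (hψ : IsWeight ψ A₀ A₁) {G : Fin n → Rn n → ℝ}
    (hG : ∀ j, AEStronglyMeasurable (G j) (volume.restrict S)) {k : Fin n}
    (hν : ν = stdVec k ∨ ν = -stdVec k) {Q B : ℝ} (hQ : c * hardyConst q τ = Q) (hQ0 : 0 ≤ Q)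
    (hB : β * A₁ = B) :
    normGrad univ q (gradExt S ν g ψ G) ≤ ENNReal.ofReal
      (max ((2 : ℝ) ^ (q - 1) * (A₀ * Q) ^ q + 1)
        ((((n : ℝ) - 1) * (2 : ℝ) ^ (q - 1) * (B * Q) ^ q + ((A₀ + B) * Q) ^ q + 1) ^ (1 / q))) *
      normGrad S q G := by
  have hq0 : 0 < q := by linarith
  have hβ : 0 ≤ β := by
    obtain ⟨x, hx⟩ := hS.compl_closure_nonempty
    exact (abs_nonneg _).trans (hg.fderiv_le x (hS.notMem_closure_iff.1 hx) k)
  have hn : 1 ≤ n := by have := k.2; omega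
  have hn' : (1 : ℝ) ≤ n := by exact_mod_cast hn
  have hX : 0 ≤ A₀ * Q := mul_nonneg hψ.isQuadWeight.nonneg hQ0
  have hB0 : 0 ≤ B := by rw [← hB]; exact mul_nonneg hβ hψ.isQuadWeight_mul.nonneg
  have hY : 0 ≤ B * Q := mul_nonneg hB0 hQ0
  have hAB : (A₀ + B) * Q = A₀ * Q + B * Q := by ring
  rw [hAB]
  set X := A₀ * Q
  set Y := B * Q
  set A' := max ((2 : ℝ) ^ (q - 1) * X ^ q + 1)
    ((((n : ℝ) - 1) * (2 : ℝ) ^ (q - 1) * Y ^ q + (X + Y) ^ q + 1) ^ (1 / q)) with hA'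
  have h2q : (0 : ℝ) < (2 : ℝ) ^ (q - 1) := by positivity
  have hm1 : 1 ≤ (2 : ℝ) ^ (q - 1) * X ^ q + 1 := by
    have : 0 ≤ (2 : ℝ) ^ (q - 1) * X ^ q := by positivity
    linarith
  have hn0 : 0 ≤ (n : ℝ) - 1 := by linarith
  have hA1 : 1 ≤ A' := hm1.trans (le_max_left _ _)
  have hK1 : (2 : ℝ) ^ (q - 1) * X ^ q + 1 ≤ A' ^ q :=
    (le_max_left _ _).trans (Real.self_le_rpow_of_one_le hA1 hq.le)
  have hK2 : ((n : ℝ) - 1) * (2 : ℝ) ^ (q - 1) * Y ^ q + (X + Y) ^ q + 1 ≤ A' ^ q := by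
    have h1 := Real.rpow_le_rpow (by positivity) (le_max_right ((2 : ℝ) ^ (q - 1) * X ^ q + 1)
      ((((n : ℝ) - 1) * (2 : ℝ) ^ (q - 1) * Y ^ q + (X + Y) ^ q + 1) ^ (1 / q))) hq0.le
    rw [← Real.rpow_mul (by positivity), one_div_mul_cancel hq0.ne', Real.rpow_one] at h1
    exact h1
  have hdir : normLq S q (dirDeriv ν G) = normLq S q (G k) := by
    rcases hν with rfl | rfl
    · congr 1; funext x; simp [dirDeriv, stdVec]
    · have e : dirDeriv (-stdVec k) G = -(G k) := by
        funext x; simp [dirDeriv, stdVec]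
      rw [e]; exact eLpNorm_neg _ _ _
  refine le_of_ennreal_rpow_le hq0 ?_
  rw [normGrad_rpow hq0, ENNReal.mul_rpow_of_nonneg _ _ hq0.le, normGrad_rpow hq0,
    ENNReal.ofReal_rpow_of_nonneg (by linarith) hq0.le]
  have h2e : (2 : ℝ≥0∞) ^ (q - 1) = ENNReal.ofReal ((2 : ℝ) ^ (q - 1)) := by
    rw [← ENNReal.ofReal_rpow_of_pos two_pos]; simp
  refine le_trans (Finset.sum_le_sum fun j _ => ?_) (sum_rpow_le hq (fun j => normLq S q (G j)) k
    (X := ENNReal.ofReal X) (Y := ENNReal.ofReal Y) ?_ ?_)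
  · rw [gradExt, normLq_glue_rpow hS hq0]
    have h := hg.normLq_gradExt_compl_le hS hτ hq hψ hG j
    rw [hQ, ← mul_assoc β, hB, hdir] at h
    gcongr
  · rw [h2e, ENNReal.ofReal_rpow_of_nonneg hX hq0.le, ← ENNReal.ofReal_mul h2q.le,
      ← ENNReal.ofReal_one, ← ENNReal.ofReal_add (by positivity) zero_le_one]
    exact ENNReal.ofReal_le_ofReal hK1
  · rw [h2e, ENNReal.ofReal_rpow_of_nonneg hY hq0.le, ← ENNReal.ofReal_add hX hY,
      ENNReal.ofReal_rpow_of_nonneg (by positivity) hq0.le, ← ENNReal.ofReal_mul h2q.le,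
      ← ENNReal.ofReal_natCast, ← ENNReal.ofReal_mul (by positivity),
      ← ENNReal.ofReal_add (by positivity) (by positivity), ← ENNReal.ofReal_one,
      ← ENNReal.ofReal_add (by positivity) zero_le_one]
    refine ENNReal.ofReal_le_ofReal (le_trans (le_of_eq ?_) hK2)
    rw [Nat.cast_sub hn, Nat.cast_one]; ring

end

end

/-! ### Smooth step functions -/

/-- Smooth step functions whose slope is as close to the optimal one as desired. -/
theorem exists_smoothStep {a b l : ℝ} (hab : a < b) (hl : 1 < l * (b - a)) :
    ∃ f : ℝ → ℝ, ContDiff ℝ ∞ f ∧ (∀ s ≤ a, f s = 0) ∧ (∀ s, b ≤ s → f s = 1) ∧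
      (∀ s, 0 ≤ deriv f s ∧ deriv f s ≤ l) ∧ ∀ s, 0 ≤ f s ∧ f s ≤ 1 := by
  have hl0 : 0 < l := by
    by_contra h; push Not at h; nlinarith
  let B : ContDiffBump ((a + b) / 2) :=
    ⟨1 / (2 * l), (b - a) / 2, by positivity, by
      rw [div_lt_div_iff₀ (by positivity) two_pos]; nlinarith⟩
  set φ : ℝ → ℝ := B.normed volume with hφ
  have hφc : ContDiff ℝ ∞ φ := B.contDiff_normed
  have hφ0 : ∀ s, 0 ≤ φ s := B.nonneg_normed
  have hφl : ∀ s, φ s ≤ l := by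
    intro s
    refine (B.normed_le_div_measure_closedBall_rIn (μ := volume) s).trans_eq ?_
    have e : volume.real (closedBall ((a + b) / 2) B.rIn) = 1 / l := by
      rw [Real.volume_real_closedBall B.rIn_pos.le]
      change 2 * (1 / (2 * l)) = 1 / l
      field_simp
    rw [e, one_div_one_div]
  have hsupp : Function.support φ = Ioo a b := by
    rw [hφ, B.support_normed_eq, Real.ball_eq_Ioo]
    change Ioo ((a + b) / 2 - (b - a) / 2) ((a + b) / 2 + (b - a) / 2) = _
    congr 1 <;> ring
  have hd : ∀ s, HasDerivAt (fun s => ∫ t in a..s, φ t) (φ s) s := fun s =>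
    intervalIntegral.integral_hasDerivAt_right (hφc.continuous.intervalIntegrable _ _)
      hφc.continuous.stronglyMeasurable.stronglyMeasurableAtFilter hφc.continuous.continuousAt
  have hderiv : deriv (fun s => ∫ t in a..s, φ t) = φ := funext fun s => (hd s).deriv
  have hlo : ∀ s ≤ a, ∫ t in a..s, φ t = 0 := by
    intro s hs
    rw [intervalIntegral.integral_symm, neg_eq_zero]
    refine intervalIntegral.integral_zero_ae (.of_forall fun t ht => ?_)
    rw [uIoc_of_le hs] at ht
    by_contra h
    have : t ∈ Ioo a b := by rw [← hsupp]; exact h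
    linarith [this.1, ht.2]
  have hhi : ∀ s, b ≤ s → ∫ t in a..s, φ t = 1 := by
    intro s hs
    rw [intervalIntegral.integral_eq_integral_of_support_subset, hφ, B.integral_normed]
    rw [hsupp]
    exact fun t ht => ⟨ht.1, ht.2.le.trans hs⟩
  have hmono : Monotone fun s => ∫ t in a..s, φ t :=
    monotone_of_deriv_nonneg (fun s => (hd s).differentiableAt) fun s => by
      rw [hderiv]; exact hφ0 s
  refine ⟨fun s => ∫ t in a..s, φ t, ?_, hlo, hhi, fun s => ?_, fun s => ⟨?_, ?_⟩⟩
  · rw [contDiff_infty_iff_deriv, hderiv]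
    exact ⟨fun s => (hd s).differentiableAt, hφc⟩
  · rw [hderiv]; exact ⟨hφ0 s, hφl s⟩
  · have := hmono (min_le_left s a)
    simp only [hlo _ (min_le_right s a)] at this
    exact this
  · have := hmono (le_max_left s b)
    simp only [hhi _ (le_max_right s b)] at this
    exact this

/-- A smooth lower approximation of the positive part. -/
theorem exists_smoothPosPart {δ : ℝ} (hδ : 0 < δ) :
    ∃ h : ℝ → ℝ, ContDiff ℝ ∞ h ∧ (∀ s ≤ 0, h s = 0) ∧ (∀ s, 0 ≤ h s) ∧ (∀ s, s - δ ≤ h s) ∧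
      ∀ s, 0 ≤ deriv h s ∧ deriv h s ≤ 1 := by
  obtain ⟨f, hf, hf0, hf1, -, hf01⟩ := exists_smoothStep (a := 0) (b := δ) (l := 2 / δ) hδ
    (by rw [sub_zero, div_mul_cancel₀ _ hδ.ne']; norm_num)
  have hd : ∀ s, HasDerivAt (fun s => ∫ t in (0 : ℝ)..s, f t) (f s) s := fun s =>
    intervalIntegral.integral_hasDerivAt_right (hf.continuous.intervalIntegrable _ _)
      hf.continuous.stronglyMeasurable.stronglyMeasurableAtFilter hf.continuous.continuousAt
  have hderiv : deriv (fun s => ∫ t in (0 : ℝ)..s, f t) = f := funext fun s => (hd s).deriv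
  have hmono : Monotone fun s => ∫ t in (0 : ℝ)..s, f t :=
    monotone_of_deriv_nonneg (fun s => (hd s).differentiableAt) fun s => by
      rw [hderiv]; exact (hf01 s).1
  have hlo : ∀ s ≤ 0, ∫ t in (0 : ℝ)..s, f t = 0 := by
    intro s hs
    rw [intervalIntegral.integral_symm, neg_eq_zero]
    refine intervalIntegral.integral_zero_ae (.of_forall fun t ht => ?_)
    rw [uIoc_of_le hs] at ht
    exact hf0 t ht.2
  have hnn : ∀ s, 0 ≤ ∫ t in (0 : ℝ)..s, f t := by
    intro s
    have := hmono (min_le_left s 0)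
    simp only [hlo _ (min_le_right s 0)] at this
    exact this
  refine ⟨fun s => ∫ t in (0 : ℝ)..s, f t, ?_, hlo, hnn, fun s => ?_, fun s => ?_⟩
  · rw [contDiff_infty_iff_deriv, hderiv]
    exact ⟨fun s => (hd s).differentiableAt, hf⟩
  · rcases le_total s δ with hs | hs
    · exact (sub_nonpos.2 hs).trans (hnn s)
    · have hi : ∀ x y : ℝ, IntervalIntegrable f volume x y := fun x y =>
        hf.continuous.intervalIntegrable _ _
      have e : ∫ t in δ..s, f t = s - δ := by
        rw [intervalIntegral.integral_congr (g := fun _ => 1), intervalIntegral.integral_const,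
          smul_eq_mul, mul_one]
        intro t ht
        rw [uIcc_of_le hs] at ht
        exact hf1 t ht.1
      have h1 := hnn δ
      have h2 := intervalIntegral.integral_add_adjacent_intervals (hi 0 δ) (hi δ s)
      simp only
      linarith
  · rw [hderiv]; exact hf01 s

section

/-! ### The cutoff functions -/

variable {n : ℕ}

theorem contDiff_scaled {ρ : Rn n → ℝ} (hρ : IsMollifier ρ) (δ : ℝ) :
    ContDiff ℝ ∞ (scaled ρ δ) := by
  unfold scaled
  exact contDiff_const.mul (hρ.contDiff.comp (contDiff_const_smul _))

theorem norm_lt_of_scaled_ne_zero {ρ : Rn n → ℝ} (hρ : IsMollifier ρ) {δ : ℝ} (hδ : 0 < δ)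
    {x : Rn n} (hx : scaled ρ δ x ≠ 0) : ‖x‖ < δ := by
  by_contra h
  push Not at h
  refine hx ?_
  rw [scaled, hρ.eq_zero, mul_zero]
  rw [norm_smul, norm_inv, Real.norm_of_nonneg hδ.le, ← div_eq_inv_mul]
  rwa [one_le_div hδ]

theorem hasCompactSupport_scaled {ρ : Rn n → ℝ} (hρ : IsMollifier ρ) {δ : ℝ} (hδ : 0 < δ) :
    HasCompactSupport (scaled ρ δ) :=
  HasCompactSupport.intro (isCompact_closedBall 0 δ) fun x hx => by
    by_contra h
    exact hx (by simpa using (norm_lt_of_scaled_ne_zero hρ hδ h).le)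

theorem integral_scaled {ρ : Rn n → ℝ} (hρ : IsMollifier ρ) {δ : ℝ} (hδ : 0 < δ) :
    ∫ x, scaled ρ δ x = 1 := by
  unfold scaled
  rw [integral_const_mul, Measure.integral_comp_inv_smul_of_nonneg _ _ hδ.le, hρ.integral_eq,
    finrank_euclideanSpace, Fintype.card_fin, smul_eq_mul, mul_one]
  exact inv_mul_cancel₀ (by positivity)

/-- Since the derivative of a mollifier has mean zero, mollifying an indicator function gains a
factor `1 / 2` over the `L^1` norm of this derivative. -/
theorem abs_fderiv_mollify_indicator_le {w : Rn n → ℝ} (hw : ContDiff ℝ ∞ w)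
    (hc : HasCompactSupport w) (h1 : ∫ x, w x = 1) {V : Set (Rn n)} (hV : MeasurableSet V)
    {b : ℝ} (e : Rn n) (hb : ∫ x, |fderiv ℝ w x e| ≤ b) (x : Rn n) :
    |fderiv ℝ (mollify (V.indicator 1) w) x e| ≤ b / 2 := by
  have hone : LocallyIntegrable (1 : Rn n → ℝ) := locallyIntegrable_const 1
  have hVl : LocallyIntegrable (V.indicator (1 : Rn n → ℝ)) := hone.indicator hV
  have hφc := continuous_fderiv_apply hw e
  have hφs := hasCompactSupport_fderiv_apply hc e
  have hz : ∫ t, fderiv ℝ w (x - t) e = 0 := by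
    have e1 : mollify (1 : Rn n → ℝ) w = fun _ => 1 := by
      funext y
      rw [mollify_apply]
      simp only [Pi.one_apply, one_mul]
      rw [integral_sub_left_eq_self w volume y, h1]
    have h2 := fderiv_mollify_apply hone hw hc x e
    rw [e1] at h2
    simpa using h2.symm
  have hi1 := integrable_mul_comp_sub hVl hφc hφs x
  have hi2 := integrable_mul_comp_sub hone hφc hφs x
  simp only [Pi.one_apply, one_mul] at hi2
  have h3 : 2 * ∫ t, V.indicator 1 t * fderiv ℝ w (x - t) e =
      ∫ t, (2 * (V.indicator 1 t * fderiv ℝ w (x - t) e) - fderiv ℝ w (x - t) e) := by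
    rw [integral_sub (hi1.const_mul 2) hi2, hz, sub_zero, integral_const_mul]
  have h4 : |2 * ∫ t, V.indicator 1 t * fderiv ℝ w (x - t) e| ≤ b := by
    rw [h3]
    refine (abs_integral_le_integral_abs).trans (le_trans (le_of_eq ?_) hb)
    rw [← integral_sub_left_eq_self (fun t => |fderiv ℝ w t e|) volume x]
    congr 1 with t
    by_cases ht : t ∈ V
    · simp only [indicator_of_mem ht, Pi.one_apply, one_mul]; congr 1; ring
    · simp only [indicator_of_notMem ht, zero_mul, mul_zero, zero_sub, abs_neg]
  rw [fderiv_mollify_apply hVl hw hc]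
  rw [abs_mul, abs_two] at h4
  linarith

/-- The cutoff functions: mollified indicator functions of slightly shrunk sets. -/
theorem exists_cutoff {ρ : Rn n → ℝ} (hρ : IsMollifier ρ) {ε b : ℝ} (hε : 0 < ε)
    (hb : ∀ j, ∫ x, |fderiv ℝ (scaled ρ (ε / 4)) x (stdVec j)| ≤ b) (U : Set (Rn n)) :
    ∃ lam : Rn n → ℝ, ContDiff ℝ ∞ lam ∧ (∀ x, ball x (ε / 2) ⊆ U → lam x = 1) ∧
      (∀ x, lam x ≠ 0 → ∃ y, ball y (ε / 2) ⊆ U ∧ dist x y < ε / 2) ∧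
      ∀ j x, |fderiv ℝ lam x (stdVec j)| ≤ b / 2 := by
  have hδ : 0 < ε / 4 := by positivity
  set w := scaled ρ (ε / 4) with hw
  have hwd : ContDiff ℝ ∞ w := contDiff_scaled hρ _
  have hwc : HasCompactSupport w := hasCompactSupport_scaled hρ hδ
  have hw1 : ∫ x, w x = 1 := integral_scaled hρ hδ
  set V := thickening (ε / 4) {x | ball x (ε / 2) ⊆ U} with hV
  have hVm : MeasurableSet V := isOpen_thickening.measurableSet
  have hVl : LocallyIntegrable (V.indicator (1 : Rn n → ℝ)) :=
    (locallyIntegrable_const (1 : ℝ)).indicator hVm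
  refine ⟨mollify (V.indicator 1) w, contDiff_mollify hVl hwd hwc, ?_, ?_, fun j x =>
    abs_fderiv_mollify_indicator_le hwd hwc hw1 hVm (stdVec j) (hb j) x⟩
  · intro x hx
    rw [mollify_apply, ← hw1, ← integral_sub_left_eq_self w volume x]
    congr 1 with t
    by_cases ht : w (x - t) = 0
    · rw [ht, mul_zero]
    · have h1 := norm_lt_of_scaled_ne_zero hρ hδ ht
      have hmem : t ∈ V := mem_thickening_iff.2 ⟨x, hx, by rwa [dist_comm, dist_eq_norm]⟩
      rw [indicator_of_mem hmem, Pi.one_apply, one_mul]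
  · intro x hx
    rw [mollify_apply] at hx
    have : ∃ t, V.indicator (1 : Rn n → ℝ) t * w (x - t) ≠ 0 := by
      by_contra h
      push Not at h
      exact hx (by simp [h])
    obtain ⟨t, ht⟩ := this
    have htV : t ∈ V := mem_of_indicator_ne_zero (left_ne_zero_of_mul ht)
    obtain ⟨y, hy, hty⟩ := mem_thickening_iff.1 htV
    have h1 := norm_lt_of_scaled_ne_zero hρ hδ (right_ne_zero_of_mul ht)
    rw [← dist_eq_norm] at h1
    exact ⟨y, hy, by linarith [dist_triangle x t y]⟩

/-! ### The partition of unity -/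

theorem fderiv_comp_apply {f : ℝ → ℝ} {v : Rn n → ℝ} (hf : ContDiff ℝ ∞ f) (hv : ContDiff ℝ ∞ v)
    (x e : Rn n) : fderiv ℝ (fun y => f (v y)) x e = deriv f (v x) * fderiv ℝ v x e := by
  have h1 : HasDerivAt f (deriv f (v x)) (v x) :=
    ((hf.differentiable (by simp)) (v x)).hasDerivAt
  have h2 : HasFDerivAt v (fderiv ℝ v x) x := ((hv.differentiable (by simp)) x).hasFDerivAt
  have h3 : HasFDerivAt (fun y => f (v y)) (deriv f (v x) • fderiv ℝ v x) x :=
    h1.comp_hasFDerivAt x h2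
  rw [h3.fderiv]
  rfl

/-- Smooth running maximum of `s` and the `lam i`: `F 0 = s` and `F (i + 1) = F i + h (lam i - F i)`.
For `h` the positive part this is the maximum itself. -/
noncomputable def iterMax (h : ℝ → ℝ) (s : ℝ) (lam : ℕ → Rn n → ℝ) : ℕ → Rn n → ℝ
  | 0, _ => s
  | i + 1, x => iterMax h s lam i x + h (lam i x - iterMax h s lam i x)

section

variable {h : ℝ → ℝ} {s : ℝ} {lam : ℕ → Rn n → ℝ}

theorem contDiff_iterMax (hh : ContDiff ℝ ∞ h) (hl : ∀ i, ContDiff ℝ ∞ (lam i)) (i : ℕ) :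
    ContDiff ℝ ∞ (iterMax h s lam i) := by
  induction i with
  | zero => exact contDiff_const
  | succ i ih => exact ih.add (hh.comp ((hl i).sub ih))

/-- The derivative of `iterMax` is a convex combination of those of the `lam i`, since the slope of
`h` lies between `0` and `1`. -/
theorem abs_fderiv_iterMax_le (hh : ContDiff ℝ ∞ h) (hl : ∀ i, ContDiff ℝ ∞ (lam i))
    (hh' : ∀ s, 0 ≤ deriv h s ∧ deriv h s ≤ 1) {c : ℝ} (hc : 0 ≤ c) {e : Rn n}
    (hb : ∀ i x, |fderiv ℝ (lam i) x e| ≤ c) (i : ℕ) (x : Rn n) :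
    |fderiv ℝ (iterMax h s lam i) x e| ≤ c := by
  induction i with
  | zero =>
    have : iterMax h s lam 0 = fun _ => s := rfl
    rw [this]; simpa using hc
  | succ i ih =>
    have hF := contDiff_iterMax (s := s) hh hl i
    have e1 : iterMax h s lam (i + 1) =
        fun x => iterMax h s lam i x + h (lam i x - iterMax h s lam i x) := rfl
    have hsub : ContDiff ℝ ∞ fun y => lam i y - iterMax h s lam i y := (hl i).sub hF
    have hdF := (hF.differentiable (by simp)) x
    have hdl := ((hl i).differentiable (by simp)) x
    have hcd : DifferentiableAt ℝ (fun y => h (lam i y - iterMax h s lam i y)) x :=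
      ((hh.comp hsub).differentiable (by simp)) x
    rw [e1, fderiv_fun_add hdF hcd, add_apply, fderiv_comp_apply hh hsub,
      fderiv_fun_sub hdl hdF, sub_apply]
    obtain ⟨h0, h1⟩ := hh' (lam i x - iterMax h s lam i x)
    set a := deriv h (lam i x - iterMax h s lam i x)
    obtain ⟨p1, p2⟩ := abs_le.1 ih
    obtain ⟨p3, p4⟩ := abs_le.1 (hb i x)
    rw [abs_le]
    constructor <;> nlinarith

theorem iterMax_le_succ (hh0 : ∀ s, 0 ≤ h s) (i : ℕ) (x : Rn n) :
    iterMax h s lam i x ≤ iterMax h s lam (i + 1) x :=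
  le_add_of_nonneg_right (hh0 _)

theorem iterMax_mono (hh0 : ∀ s, 0 ≤ h s) (x : Rn n) : Monotone fun i => iterMax h s lam i x :=
  monotone_nat_of_le_succ fun i => iterMax_le_succ hh0 i x

end

/-- Only finitely many of the sets `U i` contain a ball of radius `ε / 2` that is close to a given
bounded set, since the centers of these balls are close to a finite set, and the overlap of the sets
`U i` is finite. -/
theorem MinimallySmooth.exists_index_bound {d : ℕ} {Ω : Set (Rn (d + 1))} (D : MinimallySmooth Ω)
    {ε : ℝ} (hε : 0 < ε) (R : ℝ) :
    ∃ m : ℕ, ∀ i, m ≤ i → ∀ x y, ‖x‖ ≤ R → dist x y < ε / 2 → ¬ ball y (ε / 2) ⊆ D.U i := by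
  obtain ⟨t, -, htf, ht⟩ := (isCompact_closedBall (0 : Rn (d + 1)) (R + ε / 2)).finite_cover_balls
    (half_pos hε)
  have hfin : (⋃ c ∈ t, {i | c ∈ D.U i}).Finite := htf.biUnion fun c _ =>
    finite_of_encard_le_coe (D.overlap c)
  obtain ⟨m, hm⟩ := hfin.bddAbove
  refine ⟨m + 1, fun i hi x y hx hxy hsub => ?_⟩
  have hy : y ∈ closedBall (0 : Rn (d + 1)) (R + ε / 2) := by
    rw [mem_closedBall, dist_zero_right]
    have h1 := norm_le_norm_add_norm_sub' y x
    rw [← dist_eq_norm, dist_comm] at h1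
    linarith
  obtain ⟨c, hc, hyc⟩ := mem_iUnion₂.1 (ht hy)
  have hcU : c ∈ D.U i := hsub (by rwa [mem_ball, dist_comm])
  have := hm (mem_iUnion₂.2 ⟨c, hc, hcU⟩)
  omega

/-- The data which glue the extensions from the special Lipschitz domains: the cutoffs `κ i`, the
weights `θ i` with `κ i = 1` where `θ i ≠ 0`, and the weight `Λ` of the interior, with
`Λ + ∑ i, θ i = 1` on `Ω`. -/
structure GluingData {d : ℕ} (Ω : Set (Rn (d + 1))) (U : ℕ → Set (Rn (d + 1))) (b : ℝ)
    (κ θ : ℕ → Rn (d + 1) → ℝ) (Λ : Rn (d + 1) → ℝ) : Prop where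
  contDiff_κ : ∀ i, ContDiff ℝ ∞ (κ i)
  abs_κ_le : ∀ i x, |κ i x| ≤ 1
  fderiv_κ_le : ∀ i j x, |fderiv ℝ (κ i) x (stdVec j)| ≤ b
  tsupport_κ : ∀ i, tsupport (κ i) ⊆ U i
  contDiff_θ : ∀ i, ContDiff ℝ ∞ (θ i)
  abs_θ_le : ∀ i x, |θ i x| ≤ 1
  fderiv_θ_le : ∀ i j x, |fderiv ℝ (θ i) x (stdVec j)| ≤ 6 * b
  support_θ : ∀ i x, x ∈ tsupport (θ i) → x ∈ U i
  κ_eq_one : ∀ i x, θ i x ≠ 0 → κ i x = 1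
  locallyFinite : ∀ R : ℝ, ∃ m : ℕ, ∀ i, m ≤ i → ∀ x, ‖x‖ < R → θ i x = 0
  contDiff_Λ : ContDiff ℝ ∞ Λ
  abs_Λ_le : ∀ x, |Λ x| ≤ 1
  fderiv_Λ_le : ∀ j x, |fderiv ℝ Λ x (stdVec j)| ≤ 3 * b
  tsupport_Λ : tsupport Λ ⊆ Ω
  add_tsum_eq_one : ∀ x ∈ Ω, Λ x + ∑' i, θ i x = 1

/-- The weights are differences of consecutive step functions of the running maxima of the cutoffs
`lam i`, so that they telescope. Near the boundary of `Ω` some `lam i` equals `1`, hence the sum of the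
weights is `1` there and the interior weight vanishes. -/
theorem MinimallySmooth.exists_gluingData {d : ℕ} {Ω : Set (Rn (d + 1))} (D : MinimallySmooth Ω)
    {ε : ℝ} (hε : 0 < ε) (hcov : D.Covers ε) {ρ : Rn (d + 1) → ℝ} (hρ : IsMollifier ρ) {b : ℝ}
    (hb : 0 < b) (hbρ : ∀ j, ∫ x, |fderiv ℝ (scaled ρ (ε / 4)) x (stdVec j)| ≤ b) :
    ∃ κ θ Λ, GluingData Ω D.U b κ θ Λ := by
  classical
  choose lam hlc hl1 hl0 hlb using fun i => exists_cutoff hρ hε hbρ (D.U i)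
  -- `κ = k ∘ lam` rises from `0` to `1` on `[1/10, 13/20]`, and `θ` lives on `{13/20 < lam}`
  obtain ⟨k, hk, hk0, hk1, hkd, hk01⟩ := exists_smoothStep (a := 1 / 10) (b := 13 / 20) (l := 2)
    (by norm_num) (by norm_num)
  obtain ⟨p, hp, hp0, hp1, hpd, hp01⟩ := exists_smoothStep (a := 13 / 20) (b := 19 / 20) (l := 6)
    (by norm_num) (by norm_num)
  obtain ⟨h, hh, hh0, hhn, hhδ, hhd⟩ := exists_smoothPosPart (δ := 1 / 20) (by norm_num)
  set F := iterMax h (13 / 20) lam with hF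
  have hFc : ∀ i, ContDiff ℝ ∞ (F i) := contDiff_iterMax hh hlc
  have hFd : ∀ i j x, |fderiv ℝ (F i) x (stdVec j)| ≤ b / 2 := fun i j x =>
    abs_fderiv_iterMax_le hh hlc hhd (by positivity) (fun i x => hlb i j x) i x
  have hFm : ∀ x, Monotone fun i => F i x := iterMax_mono hhn
  have hF0 : ∀ i x, 13 / 20 ≤ F i x := fun i x => hFm x (Nat.zero_le i)
  have hFs : ∀ i x, F (i + 1) x = F i x + h (lam i x - F i x) := fun i x => rfl
  set χ : ℕ → Rn (d + 1) → ℝ := fun i x => p (F i x) with hχ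
  have hχc : ∀ i, ContDiff ℝ ∞ (χ i) := fun i => hp.comp (hFc i)
  have hχ0 : ∀ x, χ 0 x = 0 := fun x => hp0 _ le_rfl
  have hχd : ∀ i j x, |fderiv ℝ (χ i) x (stdVec j)| ≤ 3 * b := by
    intro i j x
    rw [hχ, fderiv_comp_apply hp (hFc i), abs_mul, abs_of_nonneg (hpd _).1]
    calc _ ≤ 6 * (b / 2) := by gcongr; exacts [(hpd _).2, hFd i j x]
      _ = 3 * b := by ring
  have hpm : Monotone p := monotone_of_deriv_nonneg (hp.differentiable (by simp)) fun s => (hpd s).1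
  have hχ1 : ∀ i x, lam i x = 1 → ∀ m, i < m → χ m x = 1 := by
    intro i x hx m hm
    refine hp1 _ ?_
    have h1 : F (i + 1) x ≤ F m x := hFm x hm
    have h2 := hhδ (lam i x - F i x)
    rw [hFs] at h1
    rw [hx] at h1 h2
    linarith
  set θ : ℕ → Rn (d + 1) → ℝ := fun i x => χ (i + 1) x - χ i x with hθ
  have hθ0 : ∀ i x, 0 ≤ θ i x := fun i x => sub_nonneg.2 (hpm (hFm x (Nat.le_succ i)))
  have hθlam : ∀ i x, lam i x ≤ 13 / 20 → θ i x = 0 := by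
    intro i x hx
    have : F (i + 1) x = F i x := by
      rw [hFs, hh0 _ (by linarith [hF0 i x]), add_zero]
    simp only [hθ, hχ, this, sub_self]
  have hlf : ∀ R : ℝ, ∃ m : ℕ, ∀ i, m ≤ i → ∀ x, ‖x‖ < R → lam i x = 0 := by
    intro R
    obtain ⟨m, hm⟩ := D.exists_index_bound hε R
    refine ⟨m, fun i hi x hx => ?_⟩
    by_contra hne
    obtain ⟨y, hy, hxy⟩ := hl0 i x hne
    exact hm i hi x y hx.le hxy hy
  have hlU : ∀ i x, 1 / 10 ≤ lam i x → x ∈ D.U i := by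
    intro i x hx
    obtain ⟨y, hy, hxy⟩ := hl0 i x (by linarith)
    exact hy hxy
  have hθts : ∀ i x, x ∈ tsupport (θ i) → x ∈ D.U i := by
    intro i x hx
    refine hlU i x (le_trans (by norm_num) (?_ : (13 / 20 : ℝ) ≤ lam i x))
    have hcl : IsClosed {x | (13 / 20 : ℝ) ≤ lam i x} :=
      isClosed_le continuous_const (hlc i).continuous
    refine closure_minimal (fun y hy => ?_) hcl hx
    by_contra hlt
    exact hy (hθlam i y (le_of_lt (not_le.1 hlt)))
  have hsum : ∀ m x, (∀ i, m ≤ i → θ i x = 0) → ∑' i, θ i x = χ m x := by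
    intro m x hm
    rw [tsum_eq_sum (s := Finset.range m) fun i hi => hm i (by simpa using hi)]
    simp only [hθ]
    rw [Finset.sum_range_sub (fun i => χ i x), hχ0, sub_zero]
  have hθlf : ∀ R : ℝ, ∃ m : ℕ, ∀ i, m ≤ i → ∀ x, ‖x‖ < R → θ i x = 0 := by
    intro R
    obtain ⟨m, hm⟩ := hlf R
    exact ⟨m, fun i hi x hx => hθlam i x (by rw [hm i hi x hx]; norm_num)⟩
  set Λ : Rn (d + 1) → ℝ := Ω.indicator fun x => 1 - ∑' i, θ i x with hΛ
  have hχ01 : ∀ i x, 0 ≤ χ i x ∧ χ i x ≤ 1 := fun i x => hp01 _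
  have hsum01 : ∀ x, 0 ≤ ∑' i, θ i x ∧ ∑' i, θ i x ≤ 1 := by
    intro x
    obtain ⟨m, hm⟩ := hθlf (‖x‖ + 1)
    rw [hsum m x fun i hi => hm i hi x (by linarith)]
    exact hχ01 m x
  -- near a point of `Ω`, the function `Λ` is one minus a partial sum; near other points, it is zero
  have hloc1 : ∀ x ∈ Ω, ∃ m, Λ =ᶠ[nhds x] fun y => 1 - χ m y := by
    intro x hx
    obtain ⟨m, hm⟩ := hθlf (‖x‖ + 1)
    refine ⟨m, ?_⟩
    have h1 : ∀ᶠ y in nhds x, ‖y‖ < ‖x‖ + 1 :=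
      continuous_norm.continuousAt.eventually_lt continuousAt_const (by linarith)
    filter_upwards [D.isOpen.mem_nhds hx, h1] with y hy hyn
    rw [hΛ, indicator_of_mem hy, hsum m y fun i hi => hm i hi y hyn]
  have hloc0 : ∀ x ∉ Ω, Λ =ᶠ[nhds x] fun _ => 0 := by
    intro x hx
    by_cases hxc : x ∈ closure Ω
    · have hxf : x ∈ frontier Ω := by
        rw [frontier, D.isOpen.interior_eq]; exact ⟨hxc, hx⟩
      have hnear : ∀ᶠ y in nhds x, dist y x < ε / 2 := by
        filter_upwards [ball_mem_nhds x (half_pos hε)] with y hy using hy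
      filter_upwards [hnear] with y hy
      by_cases hyΩ : y ∈ Ω
      · obtain ⟨i, hi⟩ := hcov y ((infEDist_le_edist_of_mem hxf).trans (by
          rw [edist_dist]; exact ENNReal.ofReal_le_ofReal hy.le))
        obtain ⟨m, hm⟩ := hθlf (‖y‖ + 1)
        rw [hΛ, indicator_of_mem hyΩ, hsum (max m (i + 1)) y fun i' hi' =>
          hm i' ((le_max_left _ _).trans hi') y (by linarith),
          hχ1 i y (hl1 i y hi) _ (lt_of_lt_of_le (Nat.lt_succ_self i) (le_max_right _ _)), sub_self]
      · rw [hΛ, indicator_of_notMem hyΩ]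
    · filter_upwards [isClosed_closure.isOpen_compl.mem_nhds hxc] with y hy
      rw [hΛ, indicator_of_notMem fun hyΩ => hy (subset_closure hyΩ)]
  refine ⟨fun i x => k (lam i x), θ, Λ, ?_⟩
  refine
    { contDiff_κ := fun i => hk.comp (hlc i)
      abs_κ_le := fun i x => by rw [abs_of_nonneg (hk01 _).1]; exact (hk01 _).2
      fderiv_κ_le := fun i j x => ?_
      tsupport_κ := fun i x hx => ?_
      contDiff_θ := fun i => (hχc (i + 1)).sub (hχc i)
      abs_θ_le := fun i x => ?_
      fderiv_θ_le := fun i j x => ?_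
      support_θ := hθts
      κ_eq_one := fun i x hx => ?_
      locallyFinite := hθlf
      contDiff_Λ := ?_
      abs_Λ_le := fun x => ?_
      fderiv_Λ_le := fun j x => ?_
      tsupport_Λ := fun x hx => ?_
      add_tsum_eq_one := fun x hx => ?_ }
  · rw [fderiv_comp_apply hk (hlc i), abs_mul, abs_of_nonneg (hkd _).1]
    calc _ ≤ 2 * (b / 2) := by gcongr; exacts [(hkd _).2, hlb i j x]
      _ = b := by ring
  · refine hlU i x ?_
    have hcl : IsClosed {x | (1 / 10 : ℝ) ≤ lam i x} :=
      isClosed_le continuous_const (hlc i).continuous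
    refine closure_minimal (fun y hy => ?_) hcl hx
    by_contra hlt
    exact hy (hk0 _ (le_of_lt (not_le.1 hlt)))
  · rw [abs_of_nonneg (hθ0 i x)]
    simp only [hθ]
    linarith [(hχ01 (i + 1) x).2, (hχ01 i x).1]
  · simp only [hθ]
    rw [fderiv_fun_sub (((hχc (i + 1)).differentiable (by simp)) x)
      (((hχc i).differentiable (by simp)) x), sub_apply]
    refine (abs_sub _ _).trans ?_
    linarith [hχd (i + 1) j x, hχd i j x]
  · refine hk1 _ ?_
    by_contra hlt
    exact hx (hθlam i x (le_of_lt (not_le.1 hlt)))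
  · refine contDiff_iff_contDiffAt.2 fun x => ?_
    by_cases hx : x ∈ Ω
    · obtain ⟨m, hm⟩ := hloc1 x hx
      exact (contDiff_const.sub (hχc m)).contDiffAt.congr_of_eventuallyEq hm
    · exact contDiffAt_const.congr_of_eventuallyEq (hloc0 x hx)
  · by_cases hx : x ∈ Ω
    · rw [hΛ, indicator_of_mem hx, abs_le]
      constructor <;> linarith [(hsum01 x).1, (hsum01 x).2]
    · rw [hΛ, indicator_of_notMem hx]; simp
  · by_cases hx : x ∈ Ω
    · obtain ⟨m, hm⟩ := hloc1 x hx
      rw [hm.fderiv_eq, fderiv_const_sub, neg_apply, abs_neg]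
      exact hχd m j x
    · rw [(hloc0 x hx).fderiv_eq]
      simp only [fderiv_fun_const, Pi.zero_apply, zero_apply, abs_zero]
      positivity
  · by_contra hxΩ
    exact (notMem_tsupport_iff_eventuallyEq.2 (hloc0 x hxΩ)) hx
  · rw [hΛ, indicator_of_mem hx]; ring

end

section

/-! ### Locally finite sums -/

variable {n : ℕ} {q : ℝ}

theorem normGrad_le_of_le (hq : 0 < q) {Ω : Set (Rn n)} {G : Fin n → Rn n → ℝ} {a : ℝ≥0∞}
    (h : ∀ j, normLq Ω q (G j) ≤ a) : normGrad Ω q G ≤ (n : ℝ≥0∞) ^ (1 / q) * a := by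
  have h1 : ∑ j, normLq Ω q (G j) ^ q ≤ n * a ^ q := by
    calc _ ≤ ∑ _j : Fin n, a ^ q := Finset.sum_le_sum fun j _ => by gcongr; exact h j
      _ = n * a ^ q := by simp
  calc normGrad Ω q G ≤ (n * a ^ q) ^ (1 / q) := ENNReal.rpow_le_rpow h1 (by positivity)
    _ = _ := by
      rw [ENNReal.mul_rpow_of_nonneg _ _ (by positivity), ← ENNReal.rpow_mul,
        mul_one_div_cancel hq.ne', ENNReal.rpow_one]

theorem normLq_univ_eq {Ω : Set (Rn n)} (hΩ : MeasurableSet Ω) {f : Rn n → ℝ}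
    (h : ∀ x ∉ Ω, f x = 0) : normLq univ q f = normLq Ω q f := by
  rw [normLq, normLq, Measure.restrict_univ, ← eLpNorm_indicator_eq_eLpNorm_restrict hΩ]
  congr 1
  exact (indicator_eq_self.2 fun x hx => by_contra fun h' => hx (h x h')).symm

theorem summable_mul_of_overlap {U : ℕ → Set (Rn n)} {N : ℕ}
    (hU : ∀ x, {i | x ∈ U i}.encard ≤ N) {Θ f : ℕ → Rn n → ℝ}
    (hΘ : ∀ i x, Θ i x ≠ 0 → x ∈ U i) (x : Rn n) : Summable fun i => Θ i x * f i x :=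
  summable_of_hasFiniteSupport ((finite_of_encard_le_coe (hU x)).subset fun i hi =>
    hΘ i x (left_ne_zero_of_mul hi))

theorem aestronglyMeasurable_tsum_mul {U : ℕ → Set (Rn n)} {N : ℕ}
    (hU : ∀ x, {i | x ∈ U i}.encard ≤ N) {Θ f : ℕ → Rn n → ℝ} (hΘ : ∀ i x, Θ i x ≠ 0 → x ∈ U i)
    (hΘc : ∀ i, Continuous (Θ i)) (hf : ∀ i, AEStronglyMeasurable (f i) volume) :
    AEStronglyMeasurable (fun x => ∑' i, Θ i x * f i x) volume :=
  aestronglyMeasurable_of_tendsto_ae Filter.atTop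
    (f := fun m x => ∑ i ∈ Finset.range m, Θ i x * f i x)
    (fun _ => Finset.aestronglyMeasurable_fun_sum _ fun i _ =>
      (hΘc i).aestronglyMeasurable.mul (hf i))
    (.of_forall fun x => (summable_mul_of_overlap hU hΘ x).hasSum.tendsto_sum_nat)

/-- At each point at most `N` terms are nonzero, and Hölder's inequality for `N` terms gives the factor
`N ^ (q - 1)`. -/
theorem normLq_tsum_mul_rpow_le (hq : 1 < q) {U : ℕ → Set (Rn n)} {N : ℕ}
    (hU : ∀ x, {i | x ∈ U i}.encard ≤ N) {Θ f : ℕ → Rn n → ℝ} (hΘ : ∀ i x, Θ i x ≠ 0 → x ∈ U i)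
    {c : ℝ} (hc : ∀ i x, |Θ i x| ≤ c) (hf : ∀ i, AEStronglyMeasurable (f i) volume) :
    normLq univ q (fun x => ∑' i, Θ i x * f i x) ^ q ≤
      ENNReal.ofReal c ^ q * (N : ℝ≥0∞) ^ (q - 1) * ∑' i, normLq univ q (f i) ^ q := by
  have hq0 : 0 < q := by linarith
  have hpt : ∀ x, ‖∑' i, Θ i x * f i x‖ₑ ^ q ≤
      ENNReal.ofReal c ^ q * (N : ℝ≥0∞) ^ (q - 1) * ∑' i, ‖f i x‖ₑ ^ q := by
    intro x
    have hfin := finite_of_encard_le_coe (hU x)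
    set s := hfin.toFinset with hs
    have hcard : s.card ≤ N := by
      have := hU x
      rw [hfin.encard_eq_coe_toFinset_card] at this
      exact_mod_cast this
    have e1 : ∑' i, Θ i x * f i x = ∑ i ∈ s, Θ i x * f i x := by
      refine tsum_eq_sum fun i hi => ?_
      by_contra h
      exact hi (by rw [hs, hfin.mem_toFinset]; exact hΘ i x (left_ne_zero_of_mul h))
    rw [e1]
    calc ‖∑ i ∈ s, Θ i x * f i x‖ₑ ^ q ≤ (∑ i ∈ s, ENNReal.ofReal c * ‖f i x‖ₑ) ^ q := by
          refine ENNReal.rpow_le_rpow ((enorm_sum_le _ _).trans (Finset.sum_le_sum fun i _ => ?_))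
            hq0.le
          rw [enorm_mul, Real.enorm_eq_ofReal_abs]
          gcongr
          exact hc i x
      _ ≤ (s.card : ℝ≥0∞) ^ (q - 1) * ∑ i ∈ s, (ENNReal.ofReal c * ‖f i x‖ₑ) ^ q :=
          ENNReal.rpow_sum_le_const_mul_sum_rpow _ _ hq.le
      _ = ENNReal.ofReal c ^ q * (s.card : ℝ≥0∞) ^ (q - 1) * ∑ i ∈ s, ‖f i x‖ₑ ^ q := by
          simp only [ENNReal.mul_rpow_of_nonneg _ _ hq0.le, ← Finset.mul_sum]
          ring
      _ ≤ _ := by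
          gcongr
          exact ENNReal.sum_le_tsum s
  rw [normLq_rpow hq0]
  refine (lintegral_mono hpt).trans_eq ?_
  rw [Measure.restrict_univ, lintegral_const_mul' _ _ (by
    have : 0 ≤ q - 1 := by linarith
    finiteness), lintegral_tsum fun i => ((hf i).enorm.pow_const q)]
  congr 2 with i
  rw [normLq_rpow hq0, Measure.restrict_univ]

/-- If the functions `f i` are dominated by `F` and localized in the sets `U i`, then the sum of
their norms is controlled by the overlap number. -/
theorem tsum_normLq_rpow_le (hq : 1 < q) {U : ℕ → Set (Rn n)} {N : ℕ}
    (hU : ∀ x, {i | x ∈ U i}.encard ≤ N) (hUo : ∀ i, IsOpen (U i)) {Ω : Set (Rn n)}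
    {S : ℕ → Set (Rn n)} (hUS : ∀ i, U i ∩ Ω = U i ∩ S i) {f : ℕ → Rn n → ℝ} {F : Rn n → ℝ}
    (hF : AEStronglyMeasurable F (volume.restrict Ω)) (h1 : ∀ i x, x ∈ U i → |f i x| ≤ |F x|)
    (h0 : ∀ i x, x ∉ U i → f i x = 0) :
    ∑' i, normLq (S i) q (f i) ^ q ≤ N * normLq Ω q F ^ q := by
  have hq0 : 0 < q := by linarith
  have e1 : ∀ i, normLq (S i) q (f i) ^ q ≤ ∫⁻ x in Ω, (U i).indicator (fun x => ‖F x‖ₑ ^ q) x := by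
    intro i
    rw [normLq_rpow hq0, setLIntegral_indicator (hUo i).measurableSet, hUS,
      ← setLIntegral_indicator (hUo i).measurableSet]
    refine lintegral_mono fun x => ?_
    by_cases hx : x ∈ U i
    · rw [indicator_of_mem hx]
      refine ENNReal.rpow_le_rpow ?_ hq0.le
      rw [Real.enorm_eq_ofReal_abs, Real.enorm_eq_ofReal_abs]
      exact ENNReal.ofReal_le_ofReal (h1 i x hx)
    · simp [h0 i x hx, hq0]
  calc ∑' i, normLq (S i) q (f i) ^ q
      ≤ ∑' i, ∫⁻ x in Ω, (U i).indicator (fun x => ‖F x‖ₑ ^ q) x := ENNReal.tsum_le_tsum e1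
    _ = ∫⁻ x in Ω, ∑' i, (U i).indicator (fun x => ‖F x‖ₑ ^ q) x :=
        (lintegral_tsum fun i => (hF.enorm.pow_const q).indicator (hUo i).measurableSet).symm
    _ ≤ ∫⁻ x in Ω, N * ‖F x‖ₑ ^ q := by
        refine lintegral_mono fun x => ?_
        have hfin := finite_of_encard_le_coe (hU x)
        have hcard : hfin.toFinset.card ≤ N := by
          have := hU x
          rw [hfin.encard_eq_coe_toFinset_card] at this
          exact_mod_cast this
        rw [tsum_eq_sum (s := hfin.toFinset) fun i hi => by
          rw [indicator_of_notMem]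
          intro h
          exact hi (by rwa [hfin.mem_toFinset])]
        calc ∑ i ∈ hfin.toFinset, (U i).indicator (fun x => ‖F x‖ₑ ^ q) x
            ≤ ∑ _i ∈ hfin.toFinset, ‖F x‖ₑ ^ q :=
              Finset.sum_le_sum fun i _ => indicator_le_self _ _ _
          _ = hfin.toFinset.card * ‖F x‖ₑ ^ q := by rw [Finset.sum_const, nsmul_eq_mul]
          _ ≤ N * ‖F x‖ₑ ^ q := by gcongr
    _ = N * normLq Ω q F ^ q := by
        rw [lintegral_const_mul' _ _ (ENNReal.natCast_ne_top N), normLq_rpow hq0]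

theorem MemW1.add (hq : 1 < q) {Ω : Set (Rn n)} {u v : Rn n → ℝ} {G H : Fin n → Rn n → ℝ}
    (hu : MemW1 Ω q u G) (hv : MemW1 Ω q v H) :
    MemW1 Ω q (fun x => u x + v x) (fun j x => G j x + H j x) where
  memLp := hu.memLp.add hv.memLp
  memLp_grad j := (hu.memLp_grad j).add (hv.memLp_grad j)
  weakGradient := by
    intro j η hη hc hs
    have c1 := continuous_fderiv_apply hη (stdVec j)
    have c2 := hasCompactSupport_fderiv_apply hc (stdVec j)
    simp only [add_mul]
    rw [integral_add (integrable_mul_of_hasCompactSupport hq hu.memLp c1 c2)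
      (integrable_mul_of_hasCompactSupport hq hv.memLp c1 c2),
      integral_add (integrable_mul_of_hasCompactSupport hq (hu.memLp_grad j) hη.continuous hc)
      (integrable_mul_of_hasCompactSupport hq (hv.memLp_grad j) hη.continuous hc),
      hu.weakGradient j η hη hc hs, hv.weakGradient j η hη hc hs]
    ring

theorem MemW1.sum (hq : 1 < q) {Ω : Set (Rn n)} {v : ℕ → Rn n → ℝ} {H : ℕ → Fin n → Rn n → ℝ}
    (hv : ∀ i, MemW1 Ω q (v i) (H i)) (m : ℕ) :
    MemW1 Ω q (fun x => ∑ i ∈ Finset.range m, v i x)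
      (fun j x => ∑ i ∈ Finset.range m, H i j x) := by
  induction m with
  | zero =>
    simp only [Finset.range_zero, Finset.sum_empty]
    exact ⟨MemLp.zero', fun j => MemLp.zero', fun j η _ _ _ => by simp⟩
  | succ m ih =>
    simp only [Finset.sum_range_succ]
    exact ih.add hq (hv m)

/-- Having a weak gradient on `ℝⁿ` is a local property. -/
theorem HasWeakGradient.of_local {u : Rn n → ℝ} {G : Fin n → Rn n → ℝ}
    (h : ∀ R : ℝ, ∃ v H, HasWeakGradient univ v H ∧ (∀ x, ‖x‖ < R → v x = u x) ∧
      ∀ j x, ‖x‖ < R → H j x = G j x) : HasWeakGradient univ u G := by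
  intro j η hη hc hs
  obtain ⟨R, hR⟩ := hc.isCompact.isBounded.subset_ball (0 : Rn n)
  obtain ⟨v, H, hw, hv, hH⟩ := h R
  have hlt : ∀ x, x ∈ tsupport η → ‖x‖ < R := fun x hx => by simpa using hR hx
  have key := hw j η hη hc hs
  have e1 : ∀ x, v x * fderiv ℝ η x (stdVec j) = u x * fderiv ℝ η x (stdVec j) := by
    intro x
    by_cases hx : x ∈ tsupport η
    · rw [hv x (hlt x hx)]
    · simp [fderiv_of_notMem_tsupport (𝕜 := ℝ) hx]
  have e2 : ∀ x, H j x * η x = G j x * η x := by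
    intro x
    by_cases hx : x ∈ tsupport η
    · rw [hH j x (hlt x hx)]
    · simp [image_eq_zero_of_notMem_tsupport hx]
  simpa only [e1, e2] using key

end

/-! ### Gluing the extensions -/

/-- The extension is `Λ u + ∑ θ i * E i (κ i * u)`. It is equal to `u` on `Ω`, since `θ i ≠ 0` at a point
of `Ω` implies that the point is in `U i`, hence in the `i`-th special Lipschitz domain, and that
`κ i = 1` there. The leading term `N A' + 1` comes from `θ i * ∇ E i (κ i * u)` and `Λ * ∇ u`. -/
theorem exists_extension_of_gluingData {d : ℕ} {q : ℝ} (hq : 1 < q) {Ω : Set (Rn (d + 1))}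
    (D : MinimallySmooth Ω) {b : ℝ} (hb : 0 < b) {κ θ : ℕ → Rn (d + 1) → ℝ} {Λ : Rn (d + 1) → ℝ}
    (hD : GluingData Ω D.U b κ θ Λ) (hSo : ∀ i, IsOpen (D.special i))
    {E : ℕ → (Rn (d + 1) → ℝ) → Rn (d + 1) → ℝ}
    (hE : ∀ i v, ∀ x ∈ D.special i, E i v x = v x) {A A' : ℝ} (hA : 0 ≤ A) (hA' : 0 ≤ A')
    (hEW : ∀ i v Gv, MemW1 (D.special i) q v Gv → ∃ H, MemW1 univ q (E i v) H ∧
      normLq univ q (E i v) ≤ ENNReal.ofReal A * normLq (D.special i) q v ∧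
      normGrad univ q H ≤ ENNReal.ofReal A' * normGrad (D.special i) q Gv)
    {u : Rn (d + 1) → ℝ} {G : Fin (d + 1) → Rn (d + 1) → ℝ} (hu : MemW1 Ω q u G) :
    ∃ W H, MemW1 univ q W H ∧ (∀ x ∈ Ω, W x = u x) ∧
      normGrad univ q H ≤ ENNReal.ofReal (D.N * A' + 1) * normGrad Ω q G +
        ENNReal.ofReal (lowerOrder (d + 1) D.N q b A A') * normLq Ω q u := by
  have hq0 : 0 < q := by linarith
  have hΩm : MeasurableSet Ω := D.isOpen.measurableSet
  have hSm : ∀ i, MeasurableSet (D.special i) := fun i => (hSo i).measurableSet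
  have hUS : ∀ i, D.U i ∩ Ω = D.U i ∩ D.special i := D.inter_eq
  have hb0 : (0 : ℝ) ≤ 6 * b := by positivity
  -- the localized functions and their extensions
  set v : ℕ → Rn (d + 1) → ℝ := fun i x => κ i x * u x with hv
  set Gv : ℕ → Fin (d + 1) → Rn (d + 1) → ℝ := fun i j x =>
    κ i x * G j x + fderiv ℝ (κ i) x (stdVec j) * u x with hGv
  have hvW : ∀ i, MemW1 (D.special i) q (v i) (Gv i) := fun i =>
    hu.mul_smooth hq hΩm (hSm i) (hD.contDiff_κ i) (hD.abs_κ_le i) (hD.fderiv_κ_le i)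
      (fun x hx => ((hUS i).ge ⟨hD.tsupport_κ i hx.1, hx.2⟩).2)
      (fun x hx => ((hUS i).le ⟨hD.tsupport_κ i hx.1, hx.2⟩).2)
  choose H hHW hHA hHA' using fun i => hEW i (v i) (Gv i) (hvW i)
  set e : ℕ → Rn (d + 1) → ℝ := fun i => E i (v i) with he
  have hκ0 : ∀ i x, x ∉ D.U i → κ i x = 0 := fun i x hx =>
    image_eq_zero_of_notMem_tsupport fun h => hx (hD.tsupport_κ i h)
  have hκ0' : ∀ i x, x ∉ D.U i → fderiv ℝ (κ i) x = 0 := fun i x hx =>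
    fderiv_of_notMem_tsupport (𝕜 := ℝ) fun h => hx (hD.tsupport_κ i h)
  have hθU : ∀ i x, θ i x ≠ 0 → x ∈ D.U i := fun i x hx =>
    hD.support_θ i x (subset_tsupport _ hx)
  have hθU' : ∀ i j x, fderiv ℝ (θ i) x (stdVec j) ≠ 0 → x ∈ D.U i := by
    intro i j x hx
    refine hD.support_θ i x ?_
    by_contra h
    exact hx (by simp [fderiv_of_notMem_tsupport (𝕜 := ℝ) h])
  have heM : ∀ i, AEStronglyMeasurable (e i) volume := fun i => by
    simpa using (hHW i).memLp.aestronglyMeasurable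
  have hHM : ∀ i j, AEStronglyMeasurable (H i j) volume := fun i j => by
    simpa using ((hHW i).memLp_grad j).aestronglyMeasurable
  -- sums over the localized pieces
  set F : Fin (d + 1) → Rn (d + 1) → ℝ := fun j x => |G j x| + b * |u x| with hF
  have hGm : ∀ j, AEStronglyMeasurable (G j) (volume.restrict Ω) := fun j =>
    (hu.memLp_grad j).aestronglyMeasurable
  have hum : AEStronglyMeasurable u (volume.restrict Ω) := hu.memLp.aestronglyMeasurable
  have hFm : ∀ j, AEStronglyMeasurable (F j) (volume.restrict Ω) := fun j =>
    (hGm j).norm.add (hum.norm.const_mul b)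
  have hsumv : ∑' i, normLq (D.special i) q (v i) ^ q ≤ D.N * normLq Ω q u ^ q := by
    refine tsum_normLq_rpow_le hq D.overlap D.isOpen_U hUS hum (fun i x _ => ?_)
      (fun i x hx => by simp [hv, hκ0 i x hx])
    rw [hv, abs_mul]
    exact mul_le_of_le_one_left (abs_nonneg _) (hD.abs_κ_le i x)
  have hsumG : ∀ j, ∑' i, normLq (D.special i) q (Gv i j) ^ q ≤ D.N * normLq Ω q (F j) ^ q := by
    intro j
    refine tsum_normLq_rpow_le hq D.overlap D.isOpen_U hUS (hFm j) (fun i x _ => ?_)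
      (fun i x hx => by simp [hGv, hκ0 i x hx, hκ0' i x hx])
    have hF0 : 0 ≤ F j x := by simp only [hF]; positivity
    rw [abs_of_nonneg hF0]
    refine (abs_add_le _ _).trans (add_le_add ?_ ?_)
    · rw [abs_mul]
      exact mul_le_of_le_one_left (abs_nonneg _) (hD.abs_κ_le i x)
    · rw [abs_mul]
      exact mul_le_mul_of_nonneg_right (hD.fderiv_κ_le i j x) (abs_nonneg _)
  have hFn : normGrad Ω q F ≤ normGrad Ω q G + ENNReal.ofReal b *
      (((d + 1 : ℕ) : ℝ≥0∞) ^ (1 / q) * normLq Ω q u) := by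
    refine (normGrad_add_le hq (G := fun j x => |G j x|) (H := fun _ x => b * |u x|)
      (fun j => (hGm j).norm) (fun _ => hum.norm.const_mul b)).trans (add_le_add ?_ ?_)
    · exact normGrad_mono hq0 fun j => normLq_mono hΩm fun x _ => by rw [abs_abs]
    · rw [normGrad_const hq0, normLq_const_mul, abs_of_pos hb, mul_left_comm]
      gcongr
      exact normLq_mono hΩm fun x _ => by rw [abs_abs]
  -- the sums of the extended functions
  have hNpow : (D.N : ℝ≥0∞) ^ (q - 1) * D.N = (D.N : ℝ≥0∞) ^ q := by
    have hN0 : (D.N : ℝ≥0∞) ≠ 0 := by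
      have := D.one_le_N
      simp only [ne_eq, Nat.cast_eq_zero]; omega
    conv_lhs => rw [← ENNReal.rpow_one (D.N : ℝ≥0∞), ← ENNReal.rpow_mul, one_mul]
    rw [← ENNReal.rpow_add _ _ hN0 (ENNReal.natCast_ne_top _), sub_add_cancel]
  have hsumE : ∀ (Θ : ℕ → Rn (d + 1) → ℝ) (c : ℝ), (∀ i x, Θ i x ≠ 0 → x ∈ D.U i) →
      (∀ i x, |Θ i x| ≤ c) → normLq univ q (fun x => ∑' i, Θ i x * e i x) ≤
        ENNReal.ofReal c * (D.N * (ENNReal.ofReal A * normLq Ω q u)) := by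
    intro Θ c h1 h2
    refine le_of_ennreal_rpow_le hq0 ((normLq_tsum_mul_rpow_le hq D.overlap h1 h2 heM).trans ?_)
    calc _ ≤ ENNReal.ofReal c ^ q * (D.N : ℝ≥0∞) ^ (q - 1) *
          (ENNReal.ofReal A ^ q * (D.N * normLq Ω q u ^ q)) := by
          gcongr
          refine le_trans ?_ (mul_le_mul_right hsumv _)
          rw [← ENNReal.tsum_mul_left]
          refine ENNReal.tsum_le_tsum fun i => ?_
          rw [← ENNReal.mul_rpow_of_nonneg _ _ hq0.le]
          exact ENNReal.rpow_le_rpow (hHA i) hq0.le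
      _ = ENNReal.ofReal c ^ q * (((D.N : ℝ≥0∞) ^ (q - 1) * D.N) *
          (ENNReal.ofReal A ^ q * normLq Ω q u ^ q)) := by ring
      _ = _ := by
          rw [hNpow]
          simp only [ENNReal.mul_rpow_of_nonneg _ _ hq0.le]
  have hsumH : normGrad univ q (fun j x => ∑' i, θ i x * H i j x) ≤
      D.N * (ENNReal.ofReal A' * normGrad Ω q F) := by
    refine le_of_ennreal_rpow_le hq0 ?_
    rw [normGrad_rpow hq0]
    calc _ ≤ ∑ j, (D.N : ℝ≥0∞) ^ (q - 1) * ∑' i, normLq univ q (H i j) ^ q := by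
          refine Finset.sum_le_sum fun j _ => ?_
          have := normLq_tsum_mul_rpow_le hq D.overlap (f := fun i => H i j) hθU hD.abs_θ_le
            fun i => hHM i j
          rwa [ENNReal.ofReal_one, ENNReal.one_rpow, one_mul] at this
      _ = (D.N : ℝ≥0∞) ^ (q - 1) * ∑' i, normGrad univ q (H i) ^ q := by
          rw [← Finset.mul_sum, ← Summable.tsum_finsetSum fun _ _ => ENNReal.summable]
          simp only [normGrad_rpow hq0]
      _ ≤ (D.N : ℝ≥0∞) ^ (q - 1) *
          ∑' i, ENNReal.ofReal A' ^ q * normGrad (D.special i) q (Gv i) ^ q := by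
          gcongr with i
          rw [← ENNReal.mul_rpow_of_nonneg _ _ hq0.le]
          exact ENNReal.rpow_le_rpow (hHA' i) hq0.le
      _ = (D.N : ℝ≥0∞) ^ (q - 1) * (ENNReal.ofReal A' ^ q *
          ∑ j, ∑' i, normLq (D.special i) q (Gv i j) ^ q) := by
          rw [ENNReal.tsum_mul_left, ← Summable.tsum_finsetSum fun _ _ => ENNReal.summable]
          simp only [normGrad_rpow hq0]
      _ ≤ (D.N : ℝ≥0∞) ^ (q - 1) * (ENNReal.ofReal A' ^ q * ∑ j, D.N * normLq Ω q (F j) ^ q) := by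
          gcongr with j
          exact hsumG j
      _ = ((D.N : ℝ≥0∞) ^ (q - 1) * D.N) * (ENNReal.ofReal A' ^ q * normGrad Ω q F ^ q) := by
          rw [← Finset.mul_sum, normGrad_rpow hq0]; ring
      _ = _ := by
          rw [hNpow]
          simp only [ENNReal.mul_rpow_of_nonneg _ _ hq0.le]
  -- the global function and its gradient
  have hΛW := hu.mul_smooth hq hΩm MeasurableSet.univ hD.contDiff_Λ hD.abs_Λ_le hD.fderiv_Λ_le
    (fun x hx => hD.tsupport_Λ hx.1) (fun x _ => mem_univ x)
  have hΛ0 : ∀ x ∉ Ω, Λ x = 0 := fun x hx =>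
    image_eq_zero_of_notMem_tsupport fun h => hx (hD.tsupport_Λ h)
  have hΛ0' : ∀ x ∉ Ω, fderiv ℝ Λ x = 0 := fun x hx =>
    fderiv_of_notMem_tsupport (𝕜 := ℝ) fun h => hx (hD.tsupport_Λ h)
  set T1 : Fin (d + 1) → Rn (d + 1) → ℝ := fun j x => Λ x * G j x with hT1
  set T2 : Fin (d + 1) → Rn (d + 1) → ℝ := fun j x => fderiv ℝ Λ x (stdVec j) * u x with hT2
  set T3 : Fin (d + 1) → Rn (d + 1) → ℝ := fun j x => ∑' i, θ i x * H i j x with hT3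
  set T4 : Fin (d + 1) → Rn (d + 1) → ℝ := fun j x =>
    ∑' i, fderiv ℝ (θ i) x (stdVec j) * e i x with hT4
  set T0 : Rn (d + 1) → ℝ := fun x => ∑' i, θ i x * e i x with hT0
  have hT3m : ∀ j, AEStronglyMeasurable (T3 j) volume := fun j =>
    aestronglyMeasurable_tsum_mul D.overlap hθU (fun i => (hD.contDiff_θ i).continuous)
      fun i => hHM i j
  have hT4m : ∀ j, AEStronglyMeasurable (T4 j) volume := fun j =>
    aestronglyMeasurable_tsum_mul D.overlap (fun i x => hθU' i j x)
      (fun i => continuous_fderiv_apply (hD.contDiff_θ i) _) heM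
  have hT0m : AEStronglyMeasurable T0 volume :=
    aestronglyMeasurable_tsum_mul D.overlap hθU (fun i => (hD.contDiff_θ i).continuous) heM
  have hT12m : ∀ j, AEStronglyMeasurable (T1 j) volume ∧ AEStronglyMeasurable (T2 j) volume := by
    intro j
    have h1 := memLp_mul_of_agree hΩm MeasurableSet.univ (hu.memLp_grad j)
      hD.contDiff_Λ.continuous hD.abs_Λ_le (fun x hx => hD.tsupport_Λ hx.1) (fun x _ => mem_univ x)
    have h2 := (hΛW.memLp_grad j).sub h1
    refine ⟨by simpa using h1.aestronglyMeasurable, ?_⟩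
    have h3 : T2 j = (fun x => Λ x * G j x + fderiv ℝ Λ x (stdVec j) * u x) -
        fun x => Λ x * G j x := by funext x; simp [hT2]
    rw [h3]
    simpa using h2.aestronglyMeasurable
  have hn : ((d + 1 : ℕ) : ℝ≥0∞) ^ (1 / q) ≠ ⊤ := by finiteness
  have huf : normLq Ω q u ≠ ⊤ := hu.memLp.eLpNorm_ne_top
  have hGf : normGrad Ω q G ≠ ⊤ := by
    have : ∀ j, normLq Ω q (G j) ≠ ⊤ := fun j => (hu.memLp_grad j).eLpNorm_ne_top
    unfold normGrad
    refine ENNReal.rpow_ne_top_of_nonneg (by positivity) ?_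
    exact ENNReal.sum_ne_top.2 fun j _ => ENNReal.rpow_ne_top_of_nonneg hq0.le (this j)
  have hT1n : normGrad univ q T1 ≤ normGrad Ω q G := by
    refine normGrad_mono hq0 fun j => ?_
    rw [normLq_univ_eq hΩm fun x hx => by simp [hT1, hΛ0 x hx]]
    refine normLq_mono hΩm fun x _ => ?_
    rw [abs_mul]
    exact mul_le_of_le_one_left (abs_nonneg _) (hD.abs_Λ_le x)
  have hT2n : normGrad univ q T2 ≤ ((d + 1 : ℕ) : ℝ≥0∞) ^ (1 / q) *
      (ENNReal.ofReal (3 * b) * normLq Ω q u) := by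
    refine normGrad_le_of_le hq0 fun j => ?_
    rw [normLq_univ_eq hΩm fun x hx => by simp [hT2, hΛ0' x hx]]
    have h3b : (0 : ℝ) ≤ 3 * b := by positivity
    have := normLq_const_mul (q := q) (3 * b) Ω u
    rw [abs_of_nonneg h3b] at this
    rw [← this]
    refine normLq_mono hΩm fun x _ => ?_
    rw [abs_mul, abs_mul, abs_of_nonneg h3b]
    exact mul_le_mul_of_nonneg_right (hD.fderiv_Λ_le j x) (abs_nonneg _)
  have hT4n : normGrad univ q T4 ≤ ((d + 1 : ℕ) : ℝ≥0∞) ^ (1 / q) *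
      (ENNReal.ofReal (6 * b) * (D.N * (ENNReal.ofReal A * normLq Ω q u))) :=
    normGrad_le_of_le hq0 fun j => hsumE _ _ (fun i x => hθU' i j x) fun i x =>
      hD.fderiv_θ_le i j x
  have hT0n : normLq univ q T0 < ⊤ := by
    refine (hsumE θ 1 hθU hD.abs_θ_le).trans_lt ?_
    finiteness
  refine ⟨fun x => Λ x * u x + T0 x, fun j x => (T1 j x + T2 j x) + (T3 j x + T4 j x), ?_, ?_, ?_⟩
  · have hTL : ∀ j, MemLp (fun x => T3 j x + T4 j x) (ENNReal.ofReal q) (volume.restrict univ) := by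
      have hle : ∀ (K : Fin (d + 1) → Rn (d + 1) → ℝ) j, normGrad univ q K ≠ ⊤ →
          normLq univ q (K j) < ⊤ := by
        intro K j hK
        have h1 : normLq univ q (K j) ^ q ≤ normGrad univ q K ^ q := by
          rw [normGrad_rpow hq0]
          exact Finset.single_le_sum (f := fun j => normLq univ q (K j) ^ q)
            (fun _ _ => zero_le) (Finset.mem_univ j)
        exact (le_of_ennreal_rpow_le hq0 h1).trans_lt (lt_top_iff_ne_top.2 hK)
      intro j
      have hFt : normGrad Ω q F ≠ ⊤ := ne_top_of_le_ne_top (by finiteness) hFn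
      have h3 : normLq univ q (T3 j) < ⊤ :=
        hle T3 j (ne_top_of_le_ne_top (by finiteness) hsumH)
      have h4 : normLq univ q (T4 j) < ⊤ :=
        hle T4 j (ne_top_of_le_ne_top (by finiteness) hT4n)
      exact MemLp.add ⟨by simpa using hT3m j, h3⟩ ⟨by simpa using hT4m j, h4⟩
    have hpiece : ∀ i, MemW1 univ q (fun x => θ i x * e i x)
        (fun j x => θ i x * H i j x + fderiv ℝ (θ i) x (stdVec j) * e i x) := fun i =>
      (hHW i).mul_smooth hq MeasurableSet.univ MeasurableSet.univ (hD.contDiff_θ i)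
        (hD.abs_θ_le i) (hD.fderiv_θ_le i) (fun x _ => mem_univ x) (fun x _ => mem_univ x)
    refine ⟨hΛW.memLp.add ⟨by simpa using hT0m, hT0n⟩, fun j => (hΛW.memLp_grad j).add (hTL j), ?_⟩
    refine HasWeakGradient.of_local fun R => ?_
    obtain ⟨m, hm⟩ := hD.locallyFinite R
    have hm' : ∀ i, m ≤ i → ∀ x, ‖x‖ < R → fderiv ℝ (θ i) x = 0 := by
      intro i hi x hx
      have hev : θ i =ᶠ[nhds x] fun _ => 0 := by
        filter_upwards [continuous_norm.continuousAt.eventually_lt continuousAt_const hx]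
          with y hy using hm i hi y hy
      rw [hev.fderiv_eq]; simp
    refine ⟨_, _, (hΛW.add hq (MemW1.sum hq hpiece m)).weakGradient, fun x hx => ?_,
      fun j x hx => ?_⟩
    · simp only [hT0]
      rw [tsum_eq_sum (s := Finset.range m) fun i hi => by
        rw [hm i (by simpa using hi) x hx, zero_mul]]
    · simp only [hT1, hT2, hT3, hT4]
      rw [tsum_eq_sum (s := Finset.range m) fun i hi => by
        rw [hm i (by simpa using hi) x hx, zero_mul],
        tsum_eq_sum (s := Finset.range m) fun i hi => by
        rw [hm' i (by simpa using hi) x hx, zero_apply, zero_mul], Finset.sum_add_distrib]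
  · intro x hx
    have h1 : ∀ i, θ i x * e i x = θ i x * u x := by
      intro i
      by_cases hθ0 : θ i x = 0
      · rw [hθ0, zero_mul, zero_mul]
      · have hxS : x ∈ D.special i := ((hUS i).le ⟨hθU i x hθ0, hx⟩).2
        have h2 : e i x = v i x := hE i (v i) x hxS
        rw [h2]
        simp only [hv, hD.κ_eq_one i x hθ0, one_mul]
    simp only [hT0, h1, tsum_mul_right]
    rw [← add_mul, hD.add_tsum_eq_one x hx, one_mul]
  · have hbig : normGrad univ q (fun j x => (T1 j x + T2 j x) + (T3 j x + T4 j x)) ≤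
        (normGrad univ q T1 + normGrad univ q T2) + (normGrad univ q T3 + normGrad univ q T4) := by
      refine (normGrad_add_le hq (G := fun j x => T1 j x + T2 j x)
        (H := fun j x => T3 j x + T4 j x)
        (fun j => (by simpa using (hT12m j).1 : AEStronglyMeasurable (T1 j) _).add
          (by simpa using (hT12m j).2 : AEStronglyMeasurable (T2 j) _))
        (fun j => (by simpa using hT3m j : AEStronglyMeasurable (T3 j) _).add
          (by simpa using hT4m j : AEStronglyMeasurable (T4 j) _))).trans (add_le_add ?_ ?_)
      · exact normGrad_add_le hq (fun j => by simpa using (hT12m j).1)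
          fun j => by simpa using (hT12m j).2
      · exact normGrad_add_le hq (fun j => by simpa using hT3m j) fun j => by simpa using hT4m j
    refine hbig.trans ?_
    have eN : ENNReal.ofReal (D.N * A' + 1) = D.N * ENNReal.ofReal A' + 1 := by
      rw [ENNReal.ofReal_add (by positivity) zero_le_one, ENNReal.ofReal_mul (by positivity),
        ENNReal.ofReal_natCast, ENNReal.ofReal_one]
    have eL : ENNReal.ofReal (lowerOrder (d + 1) D.N q b A A') =
        ENNReal.ofReal b * (6 * D.N * ENNReal.ofReal A + D.N * ENNReal.ofReal A' + 3) *
          ((d + 1 : ℕ) : ℝ≥0∞) ^ (1 / q) := by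
      rw [lowerOrder, ENNReal.ofReal_mul (by positivity), ENNReal.ofReal_mul hb.le,
        ENNReal.ofReal_add (by positivity) (by norm_num),
        ENNReal.ofReal_add (by positivity) (by positivity), ENNReal.ofReal_mul (by positivity),
        ENNReal.ofReal_mul (by norm_num), ENNReal.ofReal_mul (by positivity),
        ENNReal.ofReal_natCast, ← ENNReal.ofReal_rpow_of_nonneg (by positivity) (by positivity),
        ENNReal.ofReal_natCast]
      norm_num
    have e6 : ENNReal.ofReal (6 * b) = 6 * ENNReal.ofReal b := by
      rw [ENNReal.ofReal_mul (by norm_num)]; norm_num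
    have e3 : ENNReal.ofReal (3 * b) = 3 * ENNReal.ofReal b := by
      rw [ENNReal.ofReal_mul (by norm_num)]; norm_num
    rw [e6] at hT4n
    rw [e3] at hT2n
    rw [eN, eL]
    calc _ ≤ (normGrad Ω q G + ((d + 1 : ℕ) : ℝ≥0∞) ^ (1 / q) *
          (3 * ENNReal.ofReal b * normLq Ω q u)) +
          (D.N * (ENNReal.ofReal A' * (normGrad Ω q G + ENNReal.ofReal b *
            (((d + 1 : ℕ) : ℝ≥0∞) ^ (1 / q) * normLq Ω q u))) +
          ((d + 1 : ℕ) : ℝ≥0∞) ^ (1 / q) *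
            (6 * ENNReal.ofReal b * (D.N * (ENNReal.ofReal A * normLq Ω q u)))) := by
          refine add_le_add (add_le_add hT1n hT2n) (add_le_add (hsumH.trans ?_) hT4n)
          gcongr
      _ = _ := by ring

/-! ### The constants -/

/-- The two-term gradient bound is absorbed into the weighted Sobolev norm; the factor
`2 ^ ((q - 1) / q)` comes from the comparison of the `ℓ¹` and `ℓ^q` norms on `ℝ²`. -/
theorem ofReal_mul_add_le_weighted {q σ α β : ℝ} (hq : 1 < q) (hσ : 0 < σ) (hα : 0 < α)
    (x y : ℝ≥0∞) :
    ENNReal.ofReal α * x + ENNReal.ofReal β * y ≤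
      ENNReal.ofReal ((2 : ℝ) ^ ((q - 1) / q) *
        (if β / α ≤ σ ^ (1 / q) then α else β / σ ^ (1 / q))) *
      (x ^ q + ENNReal.ofReal σ * y ^ q) ^ (1 / q) := by
  have hq0 : 0 < q := by linarith
  set γ := σ ^ (1 / q) with hγ
  have hγ0 : 0 < γ := Real.rpow_pos_of_pos hσ _
  set K := if β / α ≤ γ then α else β / γ with hK
  have h1 : α ≤ K := by
    rw [hK]
    split_ifs with h
    · exact le_rfl
    · rw [not_le, lt_div_iff₀ hα] at h
      rw [le_div_iff₀ hγ0]
      linarith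
  have h2 : β ≤ K * γ := by
    rw [hK]
    split_ifs with h
    · rw [div_le_iff₀ hα] at h
      linarith
    · rw [div_mul_cancel₀ _ hγ0.ne']
  have hK0 : 0 ≤ K := hα.le.trans h1
  have hγq : ENNReal.ofReal γ ^ q = ENNReal.ofReal σ := by
    rw [ENNReal.ofReal_rpow_of_nonneg hγ0.le hq0.le, hγ, ← Real.rpow_mul hσ.le,
      one_div_mul_cancel hq0.ne', Real.rpow_one]
  have h3 : x + ENNReal.ofReal γ * y ≤ ENNReal.ofReal ((2 : ℝ) ^ ((q - 1) / q)) *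
      (x ^ q + ENNReal.ofReal σ * y ^ q) ^ (1 / q) := by
    refine le_of_ennreal_rpow_le hq0 ((ENNReal.rpow_add_le_mul_rpow_add_rpow _ _ hq.le).trans ?_)
    rw [ENNReal.mul_rpow_of_nonneg _ _ hq0.le, ENNReal.mul_rpow_of_nonneg _ _ hq0.le,
      ← ENNReal.rpow_mul, one_div_mul_cancel hq0.ne', ENNReal.rpow_one, hγq,
      ENNReal.ofReal_rpow_of_nonneg (by positivity) hq0.le, ← Real.rpow_mul (by norm_num),
      div_mul_cancel₀ _ hq0.ne', ← ENNReal.ofReal_rpow_of_pos (by norm_num), ENNReal.ofReal_ofNat]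
  calc ENNReal.ofReal α * x + ENNReal.ofReal β * y
      ≤ ENNReal.ofReal K * x + ENNReal.ofReal (K * γ) * y := by gcongr
    _ = ENNReal.ofReal K * (x + ENNReal.ofReal γ * y) := by
        rw [ENNReal.ofReal_mul hK0]; ring
    _ ≤ ENNReal.ofReal K * (ENNReal.ofReal ((2 : ℝ) ^ ((q - 1) / q)) *
        (x ^ q + ENNReal.ofReal σ * y ^ q) ^ (1 / q)) := by gcongr
    _ = _ := by rw [mul_comm ((2 : ℝ) ^ ((q - 1) / q)), ENNReal.ofReal_mul hK0, mul_assoc]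

theorem constQ_mono {q τ ξ M M' : ℝ} (hq : 0 < q) (hτ : 0 < τ) (hξ : ξ ∈ Ioo (0 : ℝ) 1)
    (hM : 0 ≤ M) (hMM : M ≤ M') : constQ q τ ξ M ≤ constQ q τ ξ M' := by
  have := hξ.1
  unfold constQ
  gcongr

theorem constB_nonneg {A₁ P τ ξ : ℝ} (hA : 0 ≤ A₁) (hP : 0 ≤ P) (hτ : 0 < τ) (M : ℝ) :
    0 ≤ constB A₁ P τ ξ M := by
  unfold constB
  positivity

theorem constB_mono {A₁ P τ ξ M M' : ℝ} (hA : 0 ≤ A₁) (hP : 0 ≤ P) (hτ : 0 < τ)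
    (hM : 0 ≤ M) (hMM : M ≤ M') : constB A₁ P τ ξ M ≤ constB A₁ P τ ξ M' := by
  unfold constB
  gcongr

theorem specialA_nonneg {q τ ξ A₀ : ℝ} (hq : 0 < q) (hτ : 0 < τ) (hξ : ξ ∈ Ioo (0 : ℝ) 1)
    (hA : 0 ≤ A₀) (M : ℝ) : 0 ≤ specialA q τ ξ A₀ M := by
  have := constQ_nonneg hq hτ hξ M
  unfold specialA
  positivity

theorem specialA_mono {q τ ξ A₀ M M' : ℝ} (hq : 0 < q) (hτ : 0 < τ) (hξ : ξ ∈ Ioo (0 : ℝ) 1)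
    (hA : 0 ≤ A₀) (hM : 0 ≤ M) (hMM : M ≤ M') :
    specialA q τ ξ A₀ M ≤ specialA q τ ξ A₀ M' := by
  have h0 := constQ_nonneg hq hτ hξ M
  have h1 := constQ_mono hq hτ hξ hM hMM
  unfold specialA
  gcongr

theorem specialA'_nonneg {n : ℕ} {q τ ξ A₀ A₁ P : ℝ} (hq : 0 < q) (hτ : 0 < τ)
    (hξ : ξ ∈ Ioo (0 : ℝ) 1) (hA : 0 ≤ A₀) (M : ℝ) : 0 ≤ specialA' n q τ ξ A₀ A₁ P M := by
  have := constQ_nonneg hq hτ hξ M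
  unfold specialA'
  exact le_max_of_le_left (by positivity)

theorem specialA'_mono {n : ℕ} (hn : 1 ≤ n) {q τ ξ A₀ A₁ P M M' : ℝ} (hq : 0 < q) (hτ : 0 < τ)
    (hξ : ξ ∈ Ioo (0 : ℝ) 1) (hA₀ : 0 ≤ A₀) (hA₁ : 0 ≤ A₁) (hP : 0 ≤ P) (hM : 0 ≤ M)
    (hMM : M ≤ M') : specialA' n q τ ξ A₀ A₁ P M ≤ specialA' n q τ ξ A₀ A₁ P M' := by
  have h0 := constQ_nonneg hq hτ hξ M
  have h1 := constQ_mono hq hτ hξ hM hMM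
  have h2 := constB_nonneg (ξ := ξ) hA₁ hP hτ M
  have h3 := constB_mono (ξ := ξ) hA₁ hP hτ hM hMM
  have h5 := h2.trans h3
  have h6 : 0 ≤ A₀ + constB A₁ P τ ξ M' := add_nonneg hA₀ h5
  have h4 : (0 : ℝ) ≤ (n : ℝ) - 1 := by
    have : (1 : ℝ) ≤ n := by exact_mod_cast hn
    linarith
  unfold specialA'
  gcongr

theorem IsWeight.nonneg₀ {ψ : ℝ → ℝ} {A₀ A₁ : ℝ} (h : IsWeight ψ A₀ A₁) : 0 ≤ A₀ := by
  simpa using (abs_nonneg _).trans (h.bound₀ 1 le_rfl)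

theorem IsWeight.nonneg₁ {ψ : ℝ → ℝ} {A₀ A₁ : ℝ} (h : IsWeight ψ A₀ A₁) : 0 ≤ A₁ := by
  simpa using (abs_nonneg _).trans (h.bound₁ 1 le_rfl)

/-! ### The embedding -/

/-- On a nonempty open set there are Sobolev functions that do not vanish almost everywhere. -/
theorem exists_memW1_ne_zero {n : ℕ} {q : ℝ} {S : Set (Rn n)} (hS : IsOpen S)
    (hne : S.Nonempty) : ∃ v G, MemW1 S q v G ∧ ¬ v =ᵐ[volume.restrict S] 0 := by
  obtain ⟨x₀, hx₀⟩ := hne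
  let f : ContDiffBump x₀ := ⟨1, 2, one_pos, one_lt_two⟩
  have hf : ContDiff ℝ ∞ f := f.contDiff
  have hfc : HasCompactSupport f := f.hasCompactSupport
  obtain ⟨C, hC⟩ := (hf.of_le (m := 1) (by simp)).lipschitzWith_of_hasCompactSupport hfc (by simp)
  refine ⟨f, fun j x => fderiv ℝ f x (stdVec j),
    ⟨(hf.continuous.memLp_of_hasCompactSupport hfc).restrict _, fun j =>
      ((continuous_fderiv_apply hf _).memLp_of_hasCompactSupport
        (hasCompactSupport_fderiv_apply hfc _)).restrict _, ?_⟩, ?_⟩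
  · intro j η hη hc hs
    have h1 := hasWeakGradient_of_lipschitzWith hC
      (H := fun j x => fderiv ℝ f x (stdVec j)) (fun j => .of_forall fun x =>
        ((hf.differentiable (by simp)) x).hasFDerivAt.hasLineDerivAt _) j η hη hc (subset_univ _)
    rw [Measure.restrict_univ] at h1
    rw [setIntegral_eq_integral_of_forall_compl_eq_zero fun x hx => ?_,
      setIntegral_eq_integral_of_forall_compl_eq_zero fun x hx => ?_, h1]
    · rw [image_eq_zero_of_notMem_tsupport fun h => hx (hs h), mul_zero]
    · rw [fderiv_of_notMem_tsupport (𝕜 := ℝ) fun h => hx (hs h), zero_apply, mul_zero]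
  · intro h0
    have h1 := Measure.eqOn_open_of_ae_eq h0 hS hf.continuous.continuousOn continuousOn_const
    have h2 := h1 hx₀
    rw [f.one_of_mem_closedBall (mem_closedBall_self f.rIn_pos.le)] at h2
    exact one_ne_zero h2

/-- Bounds for an extension operator are positive: the extension of a nonzero function is nonzero,
and by the Sobolev inequality so is its gradient. -/
theorem pos_of_isExtBound {n : ℕ} {p q T : ℝ} (hq : 0 < q) (hp : 0 < p)
    (hT : ∀ (v : Rn n → ℝ) (G : Fin n → Rn n → ℝ), MemW1 univ q v G →
      normLq univ p v ≤ ENNReal.ofReal T * normGrad univ q G)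
    {S : Set (Rn n)} (hS : IsOpen S) (hne : S.Nonempty) {E : (Rn n → ℝ) → Rn n → ℝ}
    (hE : ∀ v, ∀ x ∈ S, E v x = v x)
    (hEW : ∀ v G, MemW1 S q v G → ∃ H, MemW1 univ q (E v) H) {a a' : ℝ}
    (ha : IsExtBound S q E a) (ha' : IsExtGradBound S q E a') : 0 < a ∧ 0 < a' := by
  obtain ⟨v, G, hv, hv0⟩ := exists_memW1_ne_zero (q := q) hS hne
  obtain ⟨H, hH⟩ := hEW v G hv
  have key : ∀ r : ℝ, 0 < r → normLq univ r (E v) ≠ 0 := by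
    intro r hr h
    have hm : AEStronglyMeasurable (E v) (volume.restrict univ) := hH.memLp.aestronglyMeasurable
    rw [normLq, eLpNorm_eq_zero_iff hm (by simpa using hr)] at h
    rw [Measure.restrict_univ] at h
    refine hv0 ?_
    filter_upwards [ae_restrict_of_ae h, ae_restrict_mem hS.measurableSet] with x hx hxS
    rw [← hE v x hxS, hx]
  constructor
  · by_contra! h
    refine key q hq (le_zero_iff.1 ((ha v G hv).trans_eq ?_))
    rw [ENNReal.ofReal_of_nonpos h, zero_mul]
  · by_contra! h
    have h1 : normGrad univ q H = 0 := by
      refine le_zero_iff.1 ((ha' v G hv H hH).trans_eq ?_)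
      rw [ENNReal.ofReal_of_nonpos h, zero_mul]
    refine key p hp (le_zero_iff.1 ((hT _ H hH).trans_eq ?_))
    rw [h1, mul_zero]

/-- The embedding with the constant `constAq`, when extension operators `E i` from the special
Lipschitz domains with common bounds `A` and `A'` are given. -/
theorem normLq_le_of_extension {d : ℕ} {p q : ℝ} (hq : 1 < q) {T : ℝ}
    (hT : ∀ (v : Rn (d + 1) → ℝ) (G : Fin (d + 1) → Rn (d + 1) → ℝ), MemW1 univ q v G →
      normLq univ p v ≤ ENNReal.ofReal T * normGrad univ q G)
    {σ : ℝ} (hσ : 0 < σ) {Ω : Set (Rn (d + 1))} (D : MinimallySmooth Ω) {ε : ℝ} (hε : 0 < ε)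
    (hcov : D.Covers ε) {ρ : Rn (d + 1) → ℝ} (hρ : IsMollifier ρ) {b : ℝ} (hb : 0 < b)
    (hbρ : ∀ j, ∫ x, |fderiv ℝ (scaled ρ (ε / 4)) x (stdVec j)| ≤ b)
    {E : ℕ → (Rn (d + 1) → ℝ) → Rn (d + 1) → ℝ}
    (hE : ∀ i v, ∀ x ∈ D.special i, E i v x = v x) {A A' : ℝ} (hA : 0 ≤ A) (hA' : 0 ≤ A')
    (hEW : ∀ i v Gv, MemW1 (D.special i) q v Gv → ∃ H, MemW1 univ q (E i v) H ∧
      normLq univ q (E i v) ≤ ENNReal.ofReal A * normLq (D.special i) q v ∧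
      normGrad univ q H ≤ ENNReal.ofReal A' * normGrad (D.special i) q Gv)
    {u : Rn (d + 1) → ℝ} {G : Fin (d + 1) → Rn (d + 1) → ℝ} (hu : MemW1 Ω q u G) :
    normLq Ω p u ≤ ENNReal.ofReal ((2 : ℝ) ^ ((q - 1) / q) * T *
      constAq (d + 1) D.N q b (σ ^ (1 / q)) A A') * normW1 Ω q σ u G := by
  obtain ⟨κ, θ, Λ, hD⟩ := D.exists_gluingData hε hcov hρ hb hbρ
  have hSo : ∀ i, IsOpen (D.special i) := fun i =>
    let ⟨_, h⟩ := D.exists_isSpecial i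
    h.isOpen
  obtain ⟨W, H, hW, hWu, hH⟩ := exists_extension_of_gluingData hq D hb hD hSo hE hA hA' hEW hu
  have hα : 0 < (D.N : ℝ) * A' + 1 := by positivity
  have hAq : 0 ≤ constAq (d + 1) D.N q b (σ ^ (1 / q)) A A' := by
    unfold constAq lowerOrder
    split_ifs <;> positivity
  have h1 : normLq Ω p u = normLq Ω p W :=
    eLpNorm_congr_ae ((ae_restrict_mem D.isOpen.measurableSet).mono fun x hx => (hWu x hx).symm)
  calc normLq Ω p u ≤ normLq univ p W := by
        rw [h1]
        exact eLpNorm_mono_measure _ (Measure.restrict_mono (subset_univ _) le_rfl)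
    _ ≤ ENNReal.ofReal T * normGrad univ q H := hT W H hW
    _ ≤ ENNReal.ofReal T * (ENNReal.ofReal ((2 : ℝ) ^ ((q - 1) / q) *
        constAq (d + 1) D.N q b (σ ^ (1 / q)) A A') * normW1 Ω q σ u G) := by
        gcongr
        exact hH.trans (ofReal_mul_add_le_weighted hq hσ hα _ _)
    _ = _ := by
        rw [← mul_assoc, ← ENNReal.ofReal_mul' (by positivity)]
        congr 2
        ring

end SobolevEmb

theorem corollary1 (d : ℕ) (hd : 1 ≤ d) (n : ℕ) (hn : n = d + 1)
    (p q : ℝ) (hp : (n : ℝ) / ((n : ℝ) - 1) < p) (hq : q = n * p / (n + p))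
    -- a constant in the classical Sobolev inequality
    (T : ℝ)
    (hT : ∀ (v : SobolevEmb.Rn (d + 1) → ℝ) (G : Fin (d + 1) → SobolevEmb.Rn (d + 1) → ℝ),
      SobolevEmb.MemW1 univ q v G →
        SobolevEmb.normLq univ p v ≤ ENNReal.ofReal T * SobolevEmb.normGrad univ q G)
    (σ : ℝ) (hσ : 0 < σ)
    -- a domain with minimally smooth boundary, and an admissible `ε`
    (Ω : Set (SobolevEmb.Rn (d + 1))) (D : SobolevEmb.MinimallySmooth Ω)
    (ε : ℝ) (hε : 0 < ε) (hcov : D.Covers ε)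
    -- the mollifier and the number `b`
    (ρ : SobolevEmb.Rn (d + 1) → ℝ) (hρ : SobolevEmb.IsMollifier ρ)
    (b : ℝ) (hb : 0 < b)
    (hbρ : ∀ j, ∫ x, |fderiv ℝ (SobolevEmb.scaled ρ (ε / 4)) x (SobolevEmb.stdVec j)| ≤ b)
    -- the data of the extension operators on the special Lipschitz domains
    (τ ξ : ℝ) (hτ : 0 < τ) (hξ : ξ ∈ Ioo (0 : ℝ) 1)
    (ψ : ℝ → ℝ) (A₀ A₁ : ℝ) (hψ : SobolevEmb.IsWeight ψ A₀ A₁)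
    (P : (Fin (d + 1) → ℕ) → ℝ) (RD : ℕ → SobolevEmb.Rn (d + 1) → ℝ)
    (hRD : ∀ i, SobolevEmb.IsRegularizedDistance (closure (D.special i)) ξ P (RD i)) :
    -- with the explicit bounds on the special Lipschitz domains
    (D.AxisPreserving → ∀ P₁ : ℝ, (∀ j, P (Pi.single j 1) ≤ P₁) →
      ∀ (u : SobolevEmb.Rn (d + 1) → ℝ) (G : Fin (d + 1) → SobolevEmb.Rn (d + 1) → ℝ),
        SobolevEmb.MemW1 Ω q u G →
        SobolevEmb.normLq Ω p u ≤
          ENNReal.ofReal ((2 : ℝ) ^ ((q - 1) / q) * T *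
            SobolevEmb.constAq n D.N q b (σ ^ (1 / q))
              (⨆ i, SobolevEmb.specialA q τ ξ A₀ (D.lip i))
              (⨆ i, SobolevEmb.specialA' n q τ ξ A₀ A₁ P₁ (D.lip i))) *
          SobolevEmb.normW1 Ω q σ u G) ∧
    -- with any bounds for the extension operators on the special Lipschitz domains
    (∀ a a' : ℕ → ℝ, BddAbove (range a) → BddAbove (range a') →
      (∀ i, SobolevEmb.IsExtBound (D.special i) q
        (SobolevEmb.extension (D.special i) (D.up i)
          (SobolevEmb.gStar τ ξ (D.lip i) (RD i)) ψ) (a i)) →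
      (∀ i, SobolevEmb.IsExtGradBound (D.special i) q
        (SobolevEmb.extension (D.special i) (D.up i)
          (SobolevEmb.gStar τ ξ (D.lip i) (RD i)) ψ) (a' i)) →
      ∀ (u : SobolevEmb.Rn (d + 1) → ℝ) (G : Fin (d + 1) → SobolevEmb.Rn (d + 1) → ℝ),
        SobolevEmb.MemW1 Ω q u G →
        SobolevEmb.normLq Ω p u ≤
          ENNReal.ofReal ((2 : ℝ) ^ ((q - 1) / q) * T *
            SobolevEmb.constAq n D.N q b (σ ^ (1 / q)) (⨆ i, a i) (⨆ i, a' i)) *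
          SobolevEmb.normW1 Ω q σ u G) := by
  subst hn
  have hd1 : (1 : ℝ) ≤ d := by exact_mod_cast hd
  push_cast at hp hq
  rw [add_sub_cancel_right, div_lt_iff₀ (by linarith)] at hp
  have hp0 : 0 < p := by
    by_contra! h
    nlinarith
  have hq1 : 1 < q := by
    rw [hq, lt_div_iff₀ (by positivity)]
    linarith
  have hq0 : 0 < q := by linarith
  have hcl : ∀ i, ∀ g v, ∀ x ∈ D.special i,
      SobolevEmb.extension (D.special i) (D.up i) g ψ v x = v x := fun i g v x hx =>
    if_pos (subset_closure hx)
  choose ht hS using D.exists_isSpecial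
  constructor
  · intro hax P₁ hP u G hu
    have hsh := fun i => (hRD i).isShift (hS i) hτ hξ hP
    have hP0 : 0 ≤ P₁ := by
      obtain ⟨x, hx⟩ := (hS 0).compl_closure_nonempty
      exact (abs_nonneg _).trans (((hRD 0).abs_fderiv_le hx (Fin.last d)).trans (hP _))
    have hbA : BddAbove (range fun i => SobolevEmb.specialA q τ ξ A₀ (D.lip i)) :=
      ⟨SobolevEmb.specialA q τ ξ A₀ D.M, by
        rintro _ ⟨i, rfl⟩
        exact SobolevEmb.specialA_mono hq0 hτ hξ hψ.nonneg₀ (D.lip i).2 (D.lip_le i)⟩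
    have hbA' : BddAbove (range fun i =>
        SobolevEmb.specialA' (d + 1) q τ ξ A₀ A₁ P₁ (D.lip i)) :=
      ⟨SobolevEmb.specialA' (d + 1) q τ ξ A₀ A₁ P₁ D.M, by
        rintro _ ⟨i, rfl⟩
        exact SobolevEmb.specialA'_mono (by omega) hq0 hτ hξ hψ.nonneg₀ hψ.nonneg₁ hP0
          (D.lip i).2 (D.lip_le i)⟩
    refine SobolevEmb.normLq_le_of_extension hq1 hT hσ D hε hcov hρ hb hbρ
      (E := fun i => SobolevEmb.extension (D.special i) (D.up i)
        (SobolevEmb.gStar τ ξ (D.lip i) (RD i)) ψ) (fun i => hcl i _)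
      ((SobolevEmb.specialA_nonneg hq0 hτ hξ hψ.nonneg₀ _).trans (le_ciSup hbA 0))
      ((SobolevEmb.specialA'_nonneg hq0 hτ hξ hψ.nonneg₀ _).trans (le_ciSup hbA' 0))
      (fun i v Gv hv => ?_) hu
    have hQ := SobolevEmb.mul_hardyConst_eq_constQ q τ ξ (D.lip i)
    have hQ0 := SobolevEmb.constQ_nonneg hq0 hτ hξ (D.lip i)
    obtain ⟨k, hk⟩ := hax i (Fin.last d)
    have hEv := (hsh i).memW1_extension (hS i) hτ hq1 hψ hv
    have hb1 := (hsh i).normLq_extension_le_specialA (hS i) hτ hq1 hψ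
      hv.memLp.aestronglyMeasurable hQ hQ0
    have hb2 := (hsh i).normGrad_gradExt_le (hS i) hτ hq1 hψ
      (fun j => (hv.memLp_grad j).aestronglyMeasurable) hk hQ hQ0
      (B := SobolevEmb.constB A₁ P₁ τ ξ (D.lip i)) (by unfold SobolevEmb.constB; ring)
    rw [SobolevEmb.extension_indicator] at hEv hb1
    exact ⟨_, hEv, hb1.trans (by gcongr; exact le_ciSup hbA i),
      hb2.trans (by gcongr; exact le_ciSup hbA' i)⟩
  · intro a a' hba hba' ha ha' u G hu
    have hsh := fun i => (hRD i).isShift (hS i) hτ hξ (P₁ := ∑ j, |P (Pi.single j 1)|) fun j =>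
      (le_abs_self _).trans (Finset.single_le_sum (f := fun j => |P (Pi.single j 1)|)
        (fun j _ => abs_nonneg _) (Finset.mem_univ j))
    have hEW : ∀ i v Gv, SobolevEmb.MemW1 (D.special i) q v Gv → ∃ H, SobolevEmb.MemW1 univ q
        (SobolevEmb.extension (D.special i) (D.up i)
          (SobolevEmb.gStar τ ξ (D.lip i) (RD i)) ψ v) H := fun i v Gv hv => by
      have h := (hsh i).memW1_extension (hS i) hτ hq1 hψ hv
      rw [SobolevEmb.extension_indicator] at h
      exact ⟨_, h⟩
    obtain ⟨hpos, hpos'⟩ := SobolevEmb.pos_of_isExtBound hq0 hp0 hT (hS 0).isOpen (hS 0).nonempty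
      (hcl 0 _) (hEW 0) (ha 0) (ha' 0)
    refine SobolevEmb.normLq_le_of_extension hq1 hT hσ D hε hcov hρ hb hbρ
      (E := fun i => SobolevEmb.extension (D.special i) (D.up i)
        (SobolevEmb.gStar τ ξ (D.lip i) (RD i)) ψ) (fun i => hcl i _)
      (hpos.le.trans (le_ciSup hba 0)) (hpos'.le.trans (le_ciSup hba' 0))
      (fun i v Gv hv => ?_) hu
    obtain ⟨H, hH⟩ := hEW i v Gv hv
    exact ⟨H, hH, (ha i v Gv hv).trans (by gcongr; exact le_ciSup hba i),
      (ha' i v Gv hv H hH).trans (by gcongr; exact le_ciSup hba' i)⟩
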